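/- \textbf{Setting.} Use cylindrical coordinates $(x,r,\varphi)$. Let $X_1\in\mathbb R$, $X_2\in\mathbb R\cup\{+\infty\}$, and let a body of revolution occupy $r<f(x)$, $X_1<x<X_2$, where $f(X_1)=0$, $f$ is continuous from the right at $X_1$, $f>0$ and $f\in C^2$ on $(X_1,X_2)$, and $\dot f$ is bounded on $(X_1,b]$ for every finite $b<X_2$ (so a conical tip is allowed). Let $\Gamma$ be the surface $r=f(x)$, $X_1<x<X_2$. Let $\theta\in\mathbb R$ and let $k\in\mathbb C$ with $\operatorname{Im}k>0$ (limiting absorption). The incident wave is $u^{\rm in}=\exp\{ik(\theta r\cos\varphi-x\theta^2/2)\}$. Let $u$ be a total field of the parabolic diffraction problem in the part $x<X_2$ of the exterior of the body, that is: $u$ is $2\pi$-periodic in $\varphi$ and $C^2$ in the exterior, $u$ and $\partial_r u$ are continuous up to $\Gamma$, and, with $u^{\rm sc}=u-u^{\rm in}$, (a) $\left(\partial_x+\frac1{2ik}\Delta_\perp\right)u=0$ in the exterior, where $\Delta_\perp=\frac1r\partial_r r\partial_r+\frac1{r^2}\partial_\varphi^2$; (b) $\partial_r u-ik\dot f\,u=0$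 on $\Gamma$ (Neumann condition); (c) $u^{\rm sc}=0$ for $x<X_1$; (d) for every finite $b<X_2$, $u^{\rm sc}\to0$ as $r\to\infty$, uniformly in $x\le b$ and $\varphi$; (e) $|\nabla_\perp u|^2+|u|^2$ is integrable over every bounded part of the exterior with $x<b$, for every finite $b<X_2$ (Meixner's condition). For $n\in\mathbb Z$ let $$U_n(x)=\frac1{2\pi}\int_0^{2\pi}u(x,f(x),\varphi)e^{-in\varphi}d\varphi,\qquad U^{\rm in}_n(x)=\frac1{2\pi}\int_0^{2\pi}u^{\rm in}(x,f(x),\varphi)e^{-in\varphi}d\varphi$$ be the angular Fourier modes of the total and the incident field on the surface. Let $$g(x_*,r_*,\varphi_*;x,r,\varphi)=\frac{k}{2\pi i(x_*-x)}\exp\left\{\frac{ik}{2}\,\frac{r_*^2+r^2-2r_*r\cos(\varphi_*-\varphi)}{x_*-x}\right\}\quad(x<x_*)$$ be the Green's function of the parabolic equation (zero for $x\ge x_*$), and put $$K(x_*,\varphi_*,x,\varphi)=\frac{if(x)}{k}\left[\partial_r g+ik\dot f(x)\,g\right]_{r_*=f(x_*),\ r=f(x)},\qquad K_n(x_*,x)=\int_0^{2\pi}K(x_*,\varphi,x,0)e^{-in\varphi}d\varphi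 .$$ \textbf{Statement.} (1) For every $n\in\mathbb Z$ and every $x_*\in(X_1,X_2)$, the function $x\mapsto K_n(x_*,x)U_n(x)$ is integrable on $(X_1,x_*)$ and the one-dimensional Volterra equation $$U_n(x_*)=\int_{X_1}^{x_*}K_n(x_*,x)U_n(x)\,dx+2U^{\rm in}_n(x_*)$$ holds. (2) For every $n\in\mathbb Z$ and $X_1<x<x_*<X_2$ (and here for every complex $k\ne0$, real $k$ included), with $r=f(x)$, $r_*=f(x_*)$ and $J_n$ the Bessel function of the first kind, $$K_n(x_*,x)=\frac{ikr}{(x_*-x)^2}\exp\left\{\frac{ik}{2}\,\frac{r_*^2+r^2}{x_*-x}\right\}\left[(-i)^n\bigl(r+(x_*-x)\dot f(x)\bigr)J_n\!\left(\frac{kr_*r}{x_*-x}\right)+(-i)^{n+1}r_*\,\dot J_n\!\left(\frac{kr_*r}{x_*-x}\right)\right].$$ -/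

import Mathlib

open Complex Set MeasureTheory

noncomputable section

/-- The Bessel function of the first kind of integer order `n`: the power series for `n ≥ 0`,
and `J_{-n} = (-1)^n J_n`. -/
def besselJ (n : ℤ) (z : ℂ) : ℂ :=
  (if n < 0 then (-1 : ℂ) ^ n.natAbs else 1) *
    ∑' m : ℕ, (-1 : ℂ) ^ m / ((m.factorial : ℂ) * ((m + n.natAbs).factorial : ℂ)) *
      (z / 2) ^ (2 * m + n.natAbs)

/-- The body of revolution `r < f x`, with axis `X₁ < x < X₂` (the value `X₂ = ⊤` is a half-infinite
body).  The surface is `r = f x`; it starts at the tip `x = X₁`, `f X₁ = 0`, is twice continuously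
differentiable behind the tip, and its slope is bounded on every bounded front part of the body
(conical tips are allowed). -/
structure IsBodyProfile (X₁ : ℝ) (X₂ : EReal) (f : ℝ → ℝ) : Prop where
  tip : f X₁ = 0
  continuous_tip : ContinuousWithinAt f (Ici X₁) X₁
  pos : ∀ x : ℝ, X₁ < x → (x : EReal) < X₂ → 0 < f x
  smooth : ContDiffOn ℝ 2 f {x : ℝ | X₁ < x ∧ (x : EReal) < X₂}
  slope : ∀ b : ℝ, (b : EReal) < X₂ → ∃ M : ℝ, ∀ x : ℝ, X₁ < x → x ≤ b → |deriv f x| ≤ M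

/-- The part `x < X₂` of the space outside the body, in cylindrical coordinates `(x, r, φ)`. -/
def bodyExterior (X₁ : ℝ) (X₂ : EReal) (f : ℝ → ℝ) : Set (ℝ × ℝ × ℝ) :=
  {p | (p.1 : EReal) < X₂ ∧ 0 < p.2.1 ∧ (X₁ ≤ p.1 → f p.1 < p.2.1)}

/-- The part of the exterior of the body that lies behind the tip, together with the surface. -/
def closedBodyExterior (X₁ : ℝ) (X₂ : EReal) (f : ℝ → ℝ) : Set (ℝ × ℝ × ℝ) :=
  {p | X₁ < p.1 ∧ (p.1 : EReal) < X₂ ∧ f p.1 ≤ p.2.1}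

/-- The transversal Laplacian `(1/r) ∂_r (r ∂_r u) + (1/r²) ∂_φ² u`. -/
def transversalLaplacian (u : ℝ → ℝ → ℝ → ℂ) (x r φ : ℝ) : ℂ :=
  (1 / (r : ℂ)) * deriv (fun s : ℝ => (s : ℂ) * deriv (fun t : ℝ => u x t φ) s) r +
    (1 / (r : ℂ) ^ 2) * deriv (deriv (fun ψ : ℝ => u x r ψ)) φ

/-- The incident wave in the parabolic approximation, with angle of incidence `θ`. -/
def incidentField (k : ℂ) (θ : ℝ) (x r φ : ℝ) : ℂ :=
  exp (I * k * ((θ * r * Real.cos φ - x * θ ^ 2 / 2 : ℝ) : ℂ))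

/-- `u` is the total field of the diffraction problem for the parabolic equation
`(∂_x + (1/(2ik)) Δ_⊥) u = 0` outside the body, for the incident wave `incidentField k θ`. -/
structure IsTotalField (k : ℂ) (θ : ℝ) (X₁ : ℝ) (X₂ : EReal) (f : ℝ → ℝ)
    (u : ℝ → ℝ → ℝ → ℂ) : Prop where
  periodic : ∀ x r φ : ℝ, u x r (φ + 2 * Real.pi) = u x r φ
  smooth : ContDiffOn ℝ 2 (fun p : ℝ × ℝ × ℝ => u p.1 p.2.1 p.2.2) (bodyExterior X₁ X₂ f)
  equation : ∀ x r φ : ℝ, (x, r, φ) ∈ bodyExterior X₁ X₂ f →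
    deriv (fun t : ℝ => u t r φ) x + 1 / (2 * I * k) * transversalLaplacian u x r φ = 0
  /-- The field and its radial derivative are continuous up to the surface. -/
  continuous_trace : ContinuousOn (fun p : ℝ × ℝ × ℝ => u p.1 p.2.1 p.2.2)
    (closedBodyExterior X₁ X₂ f)
  radial_differentiable : ∀ x φ : ℝ, X₁ < x → (x : EReal) < X₂ →
    DifferentiableWithinAt ℝ (fun s : ℝ => u x s φ) (Ici (f x)) (f x)
  radial_continuous : ContinuousOn
    (fun p : ℝ × ℝ × ℝ => derivWithin (fun s : ℝ => u p.1 s p.2.2) (Ici (f p.1)) p.2.1)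
    (closedBodyExterior X₁ X₂ f)
  /-- The Neumann boundary condition in its parabolic form, `∂_r u - i k f' u = 0`. -/
  neumann : ∀ x φ : ℝ, X₁ < x → (x : EReal) < X₂ →
    derivWithin (fun s : ℝ => u x s φ) (Ici (f x)) (f x)
      - I * k * ((deriv f x : ℝ) : ℂ) * u x (f x) φ = 0
  /-- The initial condition: there is no scattered field in front of the body. -/
  initial : ∀ x r φ : ℝ, (x, r, φ) ∈ bodyExterior X₁ X₂ f → x < X₁ →
    u x r φ - incidentField k θ x r φ = 0
  /-- The radiation condition: the scattered field decays as `r → ∞`. -/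
  radiation : ∀ b : ℝ, (b : EReal) < X₂ → ∀ ε : ℝ, 0 < ε → ∃ R : ℝ, ∀ x r φ : ℝ,
    (x, r, φ) ∈ bodyExterior X₁ X₂ f → x ≤ b → R ≤ r →
      ‖u x r φ - incidentField k θ x r φ‖ ≤ ε
  /-- Meixner's condition: `|∇_⊥ u|² + |u|²` is locally integrable (`dV = r dx dr dφ`). -/
  meixner : ∀ a b R : ℝ, (b : EReal) < X₂ → IntegrableOn
    (fun p : ℝ × ℝ × ℝ =>
      (‖deriv (fun s : ℝ => u p.1 s p.2.2) p.2.1‖ ^ 2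
        + ‖(1 / (p.2.1 : ℂ)) * deriv (fun ψ : ℝ => u p.1 p.2.1 ψ) p.2.2‖ ^ 2
        + ‖u p.1 p.2.1 p.2.2‖ ^ 2) * p.2.1)
    {p : ℝ × ℝ × ℝ | p ∈ bodyExterior X₁ X₂ f ∧ a < p.1 ∧ p.1 < b ∧ p.2.1 < R ∧
      0 < p.2.2 ∧ p.2.2 < 2 * Real.pi}

/-- The Green's function of the parabolic equation, with observation point `(x', r', φ')` and
source `(x, r, φ)`. -/
def parabolicGreen (k : ℂ) (x' r' φ' x r φ : ℝ) : ℂ :=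
  if x < x' then
    k / (2 * Real.pi * I * ((x' - x : ℝ) : ℂ)) *
      exp (I * k / 2 *
        (((r' ^ 2 + r ^ 2 - 2 * r' * r * Real.cos (φ' - φ)) / (x' - x) : ℝ) : ℂ))
  else 0

/-- The kernel `K(x', φ', x, φ) = (i f(x) / k) N̄[g((x', f(x'), φ'), ·)](x, φ)` of the boundary
integral equation, where `N̄ w = ∂_r w + i k f' w` on the surface. -/
def surfaceKernel (k : ℂ) (f : ℝ → ℝ) (x' φ' x φ : ℝ) : ℂ :=
  I * (f x : ℂ) / k *
    (deriv (fun r : ℝ => parabolicGreen k x' (f x') φ' x r φ) (f x)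
      + I * k * ((deriv f x : ℝ) : ℂ) * parabolicGreen k x' (f x') φ' x (f x) φ)

/-- The Fourier component `K_n(x', x) = ∫_0^{2π} K(x', φ, x, 0) e^{-inφ} dφ`. -/
def modeKernel (k : ℂ) (f : ℝ → ℝ) (n : ℤ) (x' x : ℝ) : ℂ :=
  ∫ φ in (0 : ℝ)..(2 * Real.pi), surfaceKernel k f x' φ x 0 * exp (-(I * n * (φ : ℂ)))

/-- The `n`-th angular Fourier mode, at the longitudinal coordinate `x`, of the values of the field
`u` on the surface `r = f x`. -/
def surfaceMode (f : ℝ → ℝ) (u : ℝ → ℝ → ℝ → ℂ) (n : ℤ) (x : ℝ) : ℂ :=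
  1 / (2 * Real.pi) *
    ∫ φ in (0 : ℝ)..(2 * Real.pi), u x (f x) φ * exp (-(I * n * (φ : ℂ)))

end

noncomputable section


/-! ### Integrals depending on a parameter -/

/-! Everything is reduced to one angular mode. The mode `v` of the total field solves a parabolic
equation in `(x, r)` whose angular part is multiplication by `-n²/r²`, and it inherits the Neumann
condition (`IsTotalField.isFieldMode`). The mode `G` of the Green's function, as a function of the
source point, is a Gaussian times `∫ e^{-iz cos φ} e^{-inφ} dφ = 2π (-i)^n J_n(z)`; by Bessel's
equation it solves the adjoint equation (`modeGreen_adjoint_equation`). Statement (2) is this Bessel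
integral together with its derivative in `z` (`modeKernel_eq_bessel`).

For (1), fix the observation point `(x', f x')` on the surface. Since `v` and `G` solve adjoint
equations, the density `r v G` and the flux `r (G ∂_r v - v ∂_r G) / (2ik)` form a divergence-free
field in the `(x, r)` half-plane. Integration over the exterior between the tip and a cross-section
`c < x'` gives `∫_{r > f c} r v G dr - ∫_{r > 0} r v₀ G dr = (1/2) ∫_{X₁}^c K_n U_n dx`
(`green_identity_exterior`): by the Neumann condition the flux through the surface, including the
term `f' r v G` that comes from the slope of the boundary, is exactly half of the kernel times the
surface value. The second integral on the left is the incident mode after free propagation from `X₁`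
to `x'`, that is `U^in_n(x')` (`integral_incidentField_modeGreen`). When `c` increases to `x'`, the
Green's function concentrates at a surface point on the scale `√(x' - c)`; on that scale the surface
is flat and the exterior fills a half-plane, so the first integral tends to `U_n(x') / 2`
(`tendsto_volumePotential`). Multiplication by two is the Volterra equation.

Three places need estimates. At the tip the field may be singular, and only its energy is known to
be finite: a cutoff near the axis is removed with `inner_flux_bound`, and `surface_value_le` makes
the boundary term integrable. At infinity the incident wave may grow exponentially because `Im k >
0`, but for the same reason the Green's function decays like a Gaussian (`exists_modeGreen_bound`,
`outer_flux_bound`). At the diagonal `x = x'` the kernel is only `O((x' - x)^{-1/2})`, thanks to a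
Taylor cancellation in the radial derivative (`norm_modeKernel_le`). -/

theorem hasFDerivAt_intervalIntegral_of_continuousOn {𝕜 E : Type*} [RCLike 𝕜]
    [NormedAddCommGroup E] [NormedSpace 𝕜 E] [ProperSpace E] {G : Type*}
    [NormedAddCommGroup G] [NormedSpace 𝕜 G] [NormedSpace ℝ G]
    {F : E → ℝ → G} {F' : E → ℝ → E →L[𝕜] G} {Ω : Set E} (hΩ : IsOpen Ω) (a b : ℝ)
    (hF : ContinuousOn (fun q : E × ℝ => F q.1 q.2) (Ω ×ˢ univ))
    (hF' : ContinuousOn (fun q : E × ℝ => F' q.1 q.2) (Ω ×ˢ univ))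
    (hd : ∀ p ∈ Ω, ∀ φ : ℝ, HasFDerivAt (fun p => F p φ) (F' p φ) p) {p : E} (hp : p ∈ Ω) :
    HasFDerivAt (fun p => ∫ φ in a..b, F p φ) (∫ φ in a..b, F' p φ) p := by
  obtain ⟨ε, hε, hball⟩ := Metric.nhds_basis_closedBall.mem_iff.1 (hΩ.mem_nhds hp)
  have hslice : ∀ q ∈ Ω, ContinuousOn (fun φ => F q φ) univ := fun q hq =>
    hF.comp (f := fun φ : ℝ => (q, φ)) (by fun_prop) (fun φ _ => ⟨hq, mem_univ _⟩)
  have hslice' : ContinuousOn (fun φ => F' p φ) univ :=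
    hF'.comp (f := fun φ : ℝ => (p, φ)) (by fun_prop) (fun φ _ => ⟨hp, mem_univ _⟩)
  -- Local compactness of the parameter space supplies the dominating function: the derivative is
  -- bounded by a constant on a compact product.
  have hK : IsCompact (Metric.closedBall p ε ×ˢ uIcc a b) :=
    (isCompact_closedBall p ε).prod isCompact_uIcc
  obtain ⟨C, hC⟩ := hK.exists_bound_of_continuousOn
    (hF'.mono (prod_mono hball (subset_univ _)))
  refine intervalIntegral.hasFDerivAt_integral_of_dominated_of_fderiv_le (bound := fun _ => C)
    (s := Metric.closedBall p ε) (Metric.closedBall_mem_nhds p hε) ?_ ?_ ?_ ?_ ?_ ?_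
  · filter_upwards [hΩ.mem_nhds hp] with q hq
    exact (continuousOn_univ.1 (hslice q hq)).aestronglyMeasurable
  · exact (continuousOn_univ.1 (hslice p hp)).intervalIntegrable _ _
  · exact (continuousOn_univ.1 hslice').aestronglyMeasurable
  · exact Filter.Eventually.of_forall fun φ hφ q hq =>
      hC (q, φ) ⟨hq, uIoc_subset_uIcc hφ⟩
  · exact intervalIntegrable_const
  · exact Filter.Eventually.of_forall fun φ _ q hq => hd q (hball hq) φ

theorem continuousOn_intervalIntegral_of_continuousOn {E : Type*} [TopologicalSpace E]
    [FirstCountableTopology E] {F : E → ℝ → ℂ} {S : Set E} (a b : ℝ)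
    (hF : ContinuousOn (fun q : E × ℝ => F q.1 q.2) (S ×ˢ univ)) :
    ContinuousOn (fun p => ∫ φ in a..b, F p φ) S := by
  rw [continuousOn_iff_continuous_domRestrict]
  have h : Continuous (Function.uncurry fun (p : S) (φ : ℝ) => F p φ) :=
    hF.comp_continuous (f := fun q : S × ℝ => ((q.1 : E), q.2)) (by fun_prop)
      (fun q => ⟨q.1.2, mem_univ _⟩)
  exact intervalIntegral.continuous_parametric_intervalIntegral_of_continuous' h a b

/-! ### Bessel integrals -/

/-- The integrals `∫ (-i cos φ)^j e^{-i z cos φ} e^{-i n φ} dφ` over a period; the case `j = 0` is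
`2π (-i)^n J_n(z)`. -/
def besselIntegral (j : ℕ) (n : ℤ) (z : ℂ) : ℂ :=
  ∫ φ in (0 : ℝ)..(2 * Real.pi),
    (-(I * (Real.cos φ : ℂ))) ^ j * exp (-(I * z * (Real.cos φ : ℂ))) * exp (-(I * n * (φ : ℂ)))

/-- Each derivative in `z` brings down one factor `-i cos φ`, which is why the family is indexed by
the power `j`. -/
theorem hasDerivAt_besselIntegral (j : ℕ) (n : ℤ) (z : ℂ) :
    HasDerivAt (besselIntegral j n) (besselIntegral (j + 1) n z) z := by
  have h := hasFDerivAt_intervalIntegral_of_continuousOn (𝕜 := ℂ) (E := ℂ) isOpen_univ 0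
    (2 * Real.pi)
    (F := fun z φ => (-(I * (Real.cos φ : ℂ))) ^ j * exp (-(I * z * (Real.cos φ : ℂ)))
      * exp (-(I * n * (φ : ℂ))))
    (F' := fun z φ => ContinuousLinearMap.toSpanSingleton ℂ
      ((-(I * (Real.cos φ : ℂ))) ^ (j + 1) * exp (-(I * z * (Real.cos φ : ℂ)))
        * exp (-(I * n * (φ : ℂ)))))
    (by fun_prop)
    (Continuous.continuousOn ((ContinuousLinearMap.toSpanSingletonCLE (𝕜 := ℂ) (E := ℂ)).continuous.comp
      (by fun_prop))) (fun p _ φ => ?_) (mem_univ z)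
  · have h2 := h.hasDerivAt
    rw [ContinuousLinearMap.intervalIntegral_apply] at h2
    · simp only [ContinuousLinearMap.toSpanSingleton_apply, one_smul] at h2
      exact h2
    · apply Continuous.intervalIntegrable
      exact ((ContinuousLinearMap.toSpanSingletonCLE (𝕜 := ℂ) (E := ℂ)).continuous.comp
      (by fun_prop))
  · have h1 : HasDerivAt (fun w : ℂ => -(I * w * (Real.cos φ : ℂ))) (-(I * (Real.cos φ : ℂ))) p := by
      have := (((hasDerivAt_id' p).const_mul I).mul_const (Real.cos φ : ℂ)).fun_neg
      rwa [mul_one] at this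
    have h2 := ((h1.cexp).const_mul ((-(I * (Real.cos φ : ℂ))) ^ j)).mul_const
      (exp (-(I * n * (φ : ℂ))))
    rw [show (-(I * (Real.cos φ : ℂ))) ^ (j + 1) * exp (-(I * p * (Real.cos φ : ℂ)))
      * exp (-(I * n * (φ : ℂ))) = (-(I * (Real.cos φ : ℂ))) ^ j *
        (exp (-(I * p * (Real.cos φ : ℂ))) * -(I * (Real.cos φ : ℂ)))
      * exp (-(I * n * (φ : ℂ))) by ring]
    exact h2.hasFDerivAt

theorem differentiable_besselIntegral (j : ℕ) (n : ℤ) : Differentiable ℂ (besselIntegral j n) :=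
  fun z => (hasDerivAt_besselIntegral j n z).differentiableAt

theorem exp_neg_int_mul_two_pi (n : ℤ) : exp (-(I * n * ((2 * Real.pi : ℝ) : ℂ))) = 1 := by
  rw [Complex.exp_eq_one_iff]
  exact ⟨-n, by push_cast; ring⟩

/-- Bessel's differential equation. -/
theorem besselIntegral_ode (n : ℤ) (z : ℂ) :
    z ^ 2 * besselIntegral 2 n z + z * besselIntegral 1 n z
      + (z ^ 2 - n ^ 2) * besselIntegral 0 n z = 0 := by
  have hint : ∀ j, IntervalIntegrable (fun φ : ℝ => (-(I * (Real.cos φ : ℂ))) ^ j *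
      exp (-(I * z * (Real.cos φ : ℂ))) * exp (-(I * n * (φ : ℂ)))) volume 0 (2 * Real.pi) :=
    fun j => Continuous.intervalIntegrable (by fun_prop) _ _
  have key : ∫ φ in (0 : ℝ)..(2 * Real.pi),
      (z ^ 2 * ((-(I * (Real.cos φ : ℂ))) ^ 2 * exp (-(I * z * (Real.cos φ : ℂ)))
        * exp (-(I * n * (φ : ℂ))))
      + z * ((-(I * (Real.cos φ : ℂ))) ^ 1 * exp (-(I * z * (Real.cos φ : ℂ)))
        * exp (-(I * n * (φ : ℂ))))
      + (z ^ 2 - n ^ 2) * ((-(I * (Real.cos φ : ℂ))) ^ 0 * exp (-(I * z * (Real.cos φ : ℂ)))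
        * exp (-(I * n * (φ : ℂ))))) = 0 := by
    -- The combination in Bessel's equation is, under the integral sign, the derivative of a
    -- `2π`-periodic function, so its integral over a period vanishes.
    have hd : ∀ φ : ℝ, HasDerivAt (fun φ : ℝ => -((I * z * (Real.sin φ : ℂ) + I * n)
        * (exp (-(I * z * (Real.cos φ : ℂ))) * exp (-(I * n * (φ : ℂ))))))
        (z ^ 2 * ((-(I * (Real.cos φ : ℂ))) ^ 2 * exp (-(I * z * (Real.cos φ : ℂ)))
        * exp (-(I * n * (φ : ℂ))))
      + z * ((-(I * (Real.cos φ : ℂ))) ^ 1 * exp (-(I * z * (Real.cos φ : ℂ)))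
        * exp (-(I * n * (φ : ℂ))))
      + (z ^ 2 - n ^ 2) * ((-(I * (Real.cos φ : ℂ))) ^ 0 * exp (-(I * z * (Real.cos φ : ℂ)))
        * exp (-(I * n * (φ : ℂ))))) φ := by
      intro φ
      have hs : HasDerivAt (fun φ : ℝ => (Real.sin φ : ℂ)) (Real.cos φ : ℂ) φ :=
        (Real.hasDerivAt_sin φ).ofReal_comp
      have hc : HasDerivAt (fun φ : ℝ => (Real.cos φ : ℂ)) ((-Real.sin φ : ℝ) : ℂ) φ :=
        (Real.hasDerivAt_cos φ).ofReal_comp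
      have hi : HasDerivAt (fun φ : ℝ => (φ : ℂ)) 1 φ := (hasDerivAt_id φ).ofReal_comp
      have h1 := ((hc.const_mul (I * z)).fun_neg.cexp).fun_mul ((hi.const_mul (I * (n : ℂ))).fun_neg.cexp)
      have h2 := (((hs.const_mul (I * z)).add_const (I * (n : ℂ))).fun_mul h1).fun_neg
      refine h2.congr_deriv ?_
      have hsq : (Real.cos φ : ℂ) ^ 2 = 1 - (Real.sin φ : ℂ) ^ 2 := by
        rw [← Complex.ofReal_pow, ← Complex.ofReal_pow, Real.cos_sq']; push_cast; ring
      simp only [neg_sq, mul_pow, hsq, Complex.ofReal_neg, pow_zero, pow_one]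
      ring_nf
      simp only [I_sq]
      ring
    rw [intervalIntegral.integral_eq_sub_of_hasDerivAt (fun φ _ => hd φ)
      (Continuous.intervalIntegrable (by fun_prop) _ _)]
    simp [-ofReal_mul, exp_neg_int_mul_two_pi]
  rw [intervalIntegral.integral_add, intervalIntegral.integral_add,
    intervalIntegral.integral_const_mul, intervalIntegral.integral_const_mul,
    intervalIntegral.integral_const_mul] at key
  · exact key
  · exact (hint 2).const_mul _
  · exact (hint 1).const_mul _
  · exact ((hint 2).const_mul _).add ((hint 1).const_mul _)
  · exact (hint 0).const_mul _

theorem integral_exp_int_mul (m : ℤ) :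
    ∫ φ in (0 : ℝ)..(2 * Real.pi), exp (I * m * (φ : ℂ)) = if m = 0 then (2 * Real.pi : ℂ) else 0 := by
  split_ifs with h
  · simp [h]
  · have hm : I * (m : ℂ) ≠ 0 := mul_ne_zero I_ne_zero (by exact_mod_cast h)
    rw [integral_exp_mul_complex hm]
    have := exp_neg_int_mul_two_pi (-m)
    push_cast at this ⊢
    rw [show I * (m : ℂ) * (2 * Real.pi) = -(I * -(m : ℂ) * (2 * Real.pi)) by ring, this]
    simp

/-- The reflection `φ ↦ 2π - φ` preserves `cos φ` and changes the sign of the frequency. -/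
theorem besselIntegral_neg (n : ℤ) (z : ℂ) : besselIntegral 0 (-n) z = besselIntegral 0 n z := by
  unfold besselIntegral
  have h := intervalIntegral.integral_comp_sub_left (a := 0) (b := 2 * Real.pi)
    (fun φ : ℝ => (-(I * (Real.cos φ : ℂ))) ^ 0 * exp (-(I * z * (Real.cos φ : ℂ)))
      * exp (-(I * n * (φ : ℂ)))) (2 * Real.pi)
  rw [sub_self, sub_zero] at h
  rw [← h]
  refine intervalIntegral.integral_congr fun φ _ => ?_
  simp only [Real.cos_two_pi_sub]
  congr 1
  rw [Complex.ofReal_sub, show -(I * (n : ℂ) * (((2 * Real.pi : ℝ) : ℂ) - (φ : ℂ)))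
    = -(I * n * ((2 * Real.pi : ℝ) : ℂ)) + (I * n * φ) by ring, Complex.exp_add,
    exp_neg_int_mul_two_pi, one_mul]
  congr 1; push_cast; ring

/-- With `w = -iz/2` the exponential factors as `e^{-iz cos φ} = exp(w e^{iφ}) exp(w e^{-iφ})`. The
product of the two exponential series is a double series in `(a, b)` with frequencies `a - b`;
integration against `e^{-inφ}` keeps only `a = b + n`, and these terms form the power series of
`J_n`. -/
theorem besselIntegral_zero_natCast (n : ℕ) (z : ℂ) :
    besselIntegral 0 n z = 2 * Real.pi * (-I) ^ n *
      ∑' m : ℕ, (-1 : ℂ) ^ m / ((m.factorial : ℂ) * ((m + n).factorial : ℂ)) *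
        (z / 2) ^ (2 * m + n) := by
  set w : ℂ := -I * z / 2 with hw
  let T : ℕ × ℕ → ℝ → ℂ := fun p φ => (w ^ p.1 / (p.1.factorial : ℂ)) *
    (w ^ p.2 / (p.2.factorial : ℂ)) * exp (I * ((p.1 - p.2 - n : ℤ) : ℂ) * φ)
  have hexp : ∀ y : ℂ, HasSum (fun a : ℕ => y ^ a / (a.factorial : ℂ)) (exp y) := fun y => by
    rw [Complex.exp_eq_exp_ℂ]; exact NormedSpace.expSeries_div_hasSum_exp y
  have hnorm : Summable fun a : ℕ => ‖w ^ a / (a.factorial : ℂ)‖ :=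
    NormedSpace.norm_expSeries_div_summable w
  have hmul : ∀ (f g : ℕ → ℂ) (a b : ℂ), HasSum f a → HasSum g b → (Summable fun i => ‖f i‖) →
      (Summable fun i => ‖g i‖) → HasSum (fun p : ℕ × ℕ => f p.1 * g p.2) (a * b) :=
    fun f g a b hf hg nf ng => hf.mul hg (summable_mul_of_summable_norm nf ng)
  have hTsum : ∀ φ : ℝ, HasSum (fun p => T p φ)
      ((-(I * (Real.cos φ : ℂ))) ^ 0 * exp (-(I * z * (Real.cos φ : ℂ)))
        * exp (-(I * (n : ℤ) * (φ : ℂ)))) := by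
    intro φ
    have h1 := hexp (w * exp (I * φ))
    have h2 := hexp (w * exp (-(I * φ)))
    have n1 : Summable fun a : ℕ => ‖(w * exp (I * φ)) ^ a / (a.factorial : ℂ)‖ :=
      NormedSpace.norm_expSeries_div_summable _
    have n2 : Summable fun a : ℕ => ‖(w * exp (-(I * φ))) ^ a / (a.factorial : ℂ)‖ :=
      NormedSpace.norm_expSeries_div_summable _
    have h3 := (hmul _ _ _ _ h1 h2 n1 n2).mul_right
      (exp (-(I * (n : ℤ) * (φ : ℂ))))
    have e1 : ∀ p : ℕ × ℕ, T p φ = (w * exp (I * φ)) ^ p.1 / (p.1.factorial : ℂ) *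
        ((w * exp (-(I * φ))) ^ p.2 / (p.2.factorial : ℂ)) * exp (-(I * (n : ℤ) * (φ : ℂ))) := by
      intro p
      simp only [T, mul_pow, ← Complex.exp_nat_mul]
      rw [show I * ((p.1 - p.2 - n : ℤ) : ℂ) * φ = (p.1 : ℂ) * (I * φ) + (p.2 : ℂ) * (-(I * φ))
        + -(I * (n : ℤ) * (φ : ℂ)) by push_cast; ring, Complex.exp_add, Complex.exp_add]
      ring
    have e2 : (-(I * (Real.cos φ : ℂ))) ^ 0 * exp (-(I * z * (Real.cos φ : ℂ)))
        = exp (w * exp (I * φ)) * exp (w * exp (-(I * φ))) := by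
      rw [← Complex.exp_add, pow_zero, one_mul]
      congr 1
      rw [Complex.ofReal_cos, Complex.cos, hw]
      ring_nf
    rw [funext e1, e2]
    exact h3
  have hint := intervalIntegral.hasSum_integral_of_dominated_convergence (a := 0)
    (b := 2 * Real.pi) (μ := volume) (F := T)
    (fun p _ => ‖w ^ p.1 / (p.1.factorial : ℂ)‖ * ‖w ^ p.2 / (p.2.factorial : ℂ)‖)
    (fun p => Continuous.aestronglyMeasurable (by fun_prop))
    (fun p => Filter.Eventually.of_forall fun φ _ => ?_)
    (Filter.Eventually.of_forall fun φ _ => hnorm.mul_of_nonneg hnorm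
      (fun _ => norm_nonneg _) (fun _ => norm_nonneg _))
    intervalIntegrable_const (Filter.Eventually.of_forall fun φ _ => hTsum φ)
  · have hval : ∀ p : ℕ × ℕ, (∫ φ in (0 : ℝ)..(2 * Real.pi), T p φ)
        = (w ^ p.1 / (p.1.factorial : ℂ)) * (w ^ p.2 / (p.2.factorial : ℂ)) *
          (if p.1 = p.2 + n then (2 * Real.pi : ℂ) else 0) := by
      intro p
      simp only [T]
      rw [intervalIntegral.integral_const_mul, integral_exp_int_mul]
      congr 1
      refine if_congr ?_ rfl rfl
      omega
    simp only [hval] at hint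
    change HasSum _ (besselIntegral 0 n z) at hint
    -- This injection parametrizes the diagonal `a = b + n` that survives the integration.
    have hinj : Function.Injective fun m : ℕ => ((m + n, m) : ℕ × ℕ) := fun a b h => by
      simpa using congrArg Prod.snd h
    rw [← hinj.hasSum_iff] at hint
    · rw [← hint.tsum_eq, ← tsum_mul_left]
      refine tsum_congr fun m => ?_
      simp only [Function.comp]
      rw [if_pos trivial, hw, show 2 * m + n = m + (m + n) by ring]
      have hI : (-I : ℂ) ^ (m + n) * (-I) ^ m = (-I) ^ n * (-1) ^ m := by
        rw [pow_add, mul_right_comm, ← mul_pow, mul_comm]; congr 2; simp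
      have h4 : (-I * z / 2) ^ (m + n) * (-I * z / 2) ^ m
          = (-I) ^ n * (-1) ^ m * (z / 2) ^ (m + (m + n)) := by
        rw [← hI, show -I * z / 2 = -I * (z / 2) by ring, mul_pow, mul_pow, pow_add (z/2) m]
        ring
      rw [div_mul_div_comm, h4]
      ring
    · intro p hp
      rw [if_neg, mul_zero]
      intro h
      exact hp ⟨p.2, by ext <;> simp [h]⟩
  · simp only [T]
    rw [norm_mul, norm_mul, show I * ((p.1 - p.2 - n : ℤ) : ℂ) * φ
      = ((((p.1 - p.2 - n : ℤ) : ℝ) * φ : ℝ) : ℂ) * I by push_cast; ring, norm_exp_ofReal_mul_I,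
      mul_one]

/-- For negative orders the two sign conventions agree because `(-i)^{-m} (-1)^m = (-i)^m`. -/
theorem besselIntegral_zero_eq (n : ℤ) (z : ℂ) :
    besselIntegral 0 n z = 2 * Real.pi * (-I) ^ n * besselJ n z := by
  unfold besselJ
  obtain ⟨m, rfl | rfl⟩ := n.eq_nat_or_neg
  · rw [besselIntegral_zero_natCast]; simp
  · rw [besselIntegral_neg, besselIntegral_zero_natCast]
    rcases Nat.eq_zero_or_pos m with rfl | hm
    · simp
    · rw [if_pos (by omega)]
      simp only [Int.natAbs_neg, Int.natAbs_natCast]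
      rw [← mul_assoc, mul_assoc (2 * (Real.pi : ℂ)) ((-I) ^ (-(m : ℤ))), zpow_neg, zpow_natCast,
        ← inv_pow, ← mul_pow]
      simp


/-! ### Angular modes of the Green's function -/

/-- The Gaussian prefactor of the modes of the Green's function. -/
def modeGreenFactor (k : ℂ) (x' r' x r : ℝ) : ℂ :=
  k / (2 * Real.pi * I * ((x' - x : ℝ) : ℂ)) *
    exp (I * k / 2 * (((r' ^ 2 + r ^ 2) / (x' - x) : ℝ) : ℂ))

/-- The `n`-th angular mode of the Green's function. -/
def modeGreen (k : ℂ) (n : ℤ) (x' r' x r : ℝ) : ℂ :=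
  modeGreenFactor k x' r' x r * besselIntegral 0 n (k * ((r' * r / (x' - x) : ℝ) : ℂ))

/-- The radial derivative of `modeGreen`. -/
def modeGreenDr (k : ℂ) (n : ℤ) (x' r' x r : ℝ) : ℂ :=
  modeGreenFactor k x' r' x r *
    (I * k * ((r / (x' - x) : ℝ) : ℂ) * besselIntegral 0 n (k * ((r' * r / (x' - x) : ℝ) : ℂ))
      + k * ((r' / (x' - x) : ℝ) : ℂ) * besselIntegral 1 n (k * ((r' * r / (x' - x) : ℝ) : ℂ)))

theorem parabolicGreen_eq_factor (k : ℂ) {x' x : ℝ} (h : x < x') (r' φ r : ℝ) :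
    parabolicGreen k x' r' φ x r 0 = modeGreenFactor k x' r' x r *
      exp (-(I * (k * ((r' * r / (x' - x) : ℝ) : ℂ)) * (Real.cos φ : ℂ))) := by
  rw [parabolicGreen, if_pos h, modeGreenFactor, mul_assoc (k / _), ← Complex.exp_add, sub_zero]
  congr 2
  push_cast
  ring

theorem modeGreen_eq_integral (k : ℂ) (n : ℤ) {x' x : ℝ} (h : x < x') (r' r : ℝ) :
    modeGreen k n x' r' x r = ∫ φ in (0 : ℝ)..(2 * Real.pi),
      parabolicGreen k x' r' φ x r 0 * exp (-(I * n * (φ : ℂ))) := by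
  rw [modeGreen, besselIntegral, ← intervalIntegral.integral_const_mul]
  refine intervalIntegral.integral_congr fun φ _ => ?_
  simp only [parabolicGreen_eq_factor k h]
  ring

theorem hasDerivAt_modeGreenFactor_r (k : ℂ) (x' r' x r : ℝ) :
    HasDerivAt (fun r => modeGreenFactor k x' r' x r)
      (modeGreenFactor k x' r' x r * (I * k * ((r / (x' - x) : ℝ) : ℂ))) r := by
  have h1 : HasDerivAt (fun r : ℝ => (r' ^ 2 + r ^ 2) / (x' - x)) (2 * r / (x' - x)) r := by
    have := ((hasDerivAt_pow 2 r).const_add (r' ^ 2)).div_const (x' - x)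
    simpa using this
  have h2 := ((h1.ofReal_comp.const_mul (I * k / 2)).cexp).const_mul
    (k / (2 * Real.pi * I * ((x' - x : ℝ) : ℂ)))
  refine h2.congr_deriv ?_
  rw [modeGreenFactor]
  push_cast
  ring

theorem hasDerivAt_modeGreenFactor_x (k : ℂ) {x' x : ℝ} (h : x < x') (r' r : ℝ) :
    HasDerivAt (fun x => modeGreenFactor k x' r' x r)
      (modeGreenFactor k x' r' x r * (1 / ((x' - x : ℝ) : ℂ)
        + I * k / 2 * (((r' ^ 2 + r ^ 2) / (x' - x) ^ 2 : ℝ) : ℂ))) x := by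
  have hD : x' - x ≠ 0 := (sub_pos.2 h).ne'
  have hDc : ((x' - x : ℝ) : ℂ) ≠ 0 := by exact_mod_cast hD
  have h0 : HasDerivAt (fun x : ℝ => x' - x) (-1) x := by
    simpa using (hasDerivAt_id x).const_sub x'
  have h1 : HasDerivAt (fun x : ℝ => (r' ^ 2 + r ^ 2) / (x' - x))
      ((r' ^ 2 + r ^ 2) / (x' - x) ^ 2) x := by
    refine ((hasDerivAt_const x (r' ^ 2 + r ^ 2)).fun_div h0 hD).congr_deriv ?_
    ring
  have h3 : HasDerivAt (fun x : ℝ => k / (2 * Real.pi * I * ((x' - x : ℝ) : ℂ)))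
      (k / (2 * Real.pi * I * ((x' - x : ℝ) : ℂ)) * (1 / ((x' - x : ℝ) : ℂ))) x := by
    refine ((hasDerivAt_const x k).fun_div (h0.ofReal_comp.const_mul (2 * Real.pi * I)) ?_).congr_deriv ?_
    · exact mul_ne_zero (by simp [Real.pi_ne_zero]) hDc
    · have := Real.pi_ne_zero
      push_cast at hDc ⊢
      field_simp
      ring
  have h2 := h3.fun_mul ((h1.ofReal_comp.const_mul (I * k / 2)).cexp)
  refine h2.congr_deriv ?_
  rw [modeGreenFactor]
  ring

theorem hasDerivAt_besselIntegral_comp_r (k : ℂ) (j : ℕ) (n : ℤ) (x' r' x r : ℝ) :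
    HasDerivAt (fun r : ℝ => besselIntegral j n (k * ((r' * r / (x' - x) : ℝ) : ℂ)))
      (k * ((r' / (x' - x) : ℝ) : ℂ)
        * besselIntegral (j + 1) n (k * ((r' * r / (x' - x) : ℝ) : ℂ))) r := by
  have h1 : HasDerivAt (fun r : ℝ => r' * r / (x' - x)) (r' / (x' - x)) r := by
    simpa using ((hasDerivAt_id r).const_mul r').div_const (x' - x)
  have h2 := (hasDerivAt_besselIntegral j n (k * ((r' * r / (x' - x) : ℝ) : ℂ))).comp r
    (h1.ofReal_comp.const_mul k)
  refine h2.congr_deriv ?_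
  ring

theorem hasDerivAt_modeGreen_r (k : ℂ) (n : ℤ) (x' r' x r : ℝ) :
    HasDerivAt (fun r => modeGreen k n x' r' x r) (modeGreenDr k n x' r' x r) r := by
  refine ((hasDerivAt_modeGreenFactor_r k x' r' x r).fun_mul
    (hasDerivAt_besselIntegral_comp_r k 0 n x' r' x r)).congr_deriv ?_
  rw [modeGreenDr]
  ring

/-- The second radial derivative of `modeGreen`. -/
def modeGreenDrr (k : ℂ) (n : ℤ) (x' r' x r : ℝ) : ℂ :=
  modeGreenFactor k x' r' x r *
    (((I * k * ((r / (x' - x) : ℝ) : ℂ)) ^ 2 + I * k * ((1 / (x' - x) : ℝ) : ℂ))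
        * besselIntegral 0 n (k * ((r' * r / (x' - x) : ℝ) : ℂ))
      + 2 * (I * k * ((r / (x' - x) : ℝ) : ℂ)) * (k * ((r' / (x' - x) : ℝ) : ℂ))
        * besselIntegral 1 n (k * ((r' * r / (x' - x) : ℝ) : ℂ))
      + (k * ((r' / (x' - x) : ℝ) : ℂ)) ^ 2
        * besselIntegral 2 n (k * ((r' * r / (x' - x) : ℝ) : ℂ)))

/-- The derivative of `modeGreen` in the longitudinal coordinate of the source. -/
def modeGreenDx (k : ℂ) (n : ℤ) (x' r' x r : ℝ) : ℂ :=
  modeGreenFactor k x' r' x r *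
    ((1 / ((x' - x : ℝ) : ℂ) + I * k / 2 * (((r' ^ 2 + r ^ 2) / (x' - x) ^ 2 : ℝ) : ℂ))
        * besselIntegral 0 n (k * ((r' * r / (x' - x) : ℝ) : ℂ))
      + k * ((r' * r / (x' - x) ^ 2 : ℝ) : ℂ)
        * besselIntegral 1 n (k * ((r' * r / (x' - x) : ℝ) : ℂ)))

theorem hasDerivAt_modeGreenDr_r (k : ℂ) (n : ℤ) (x' r' x r : ℝ) :
    HasDerivAt (fun r => modeGreenDr k n x' r' x r) (modeGreenDrr k n x' r' x r) r := by
  have h1 : HasDerivAt (fun r : ℝ => r / (x' - x)) (1 / (x' - x)) r :=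
    (hasDerivAt_id r).div_const (x' - x)
  refine ((hasDerivAt_modeGreenFactor_r k x' r' x r).fun_mul
    (((h1.ofReal_comp.const_mul (I * k)).fun_mul
      (hasDerivAt_besselIntegral_comp_r k 0 n x' r' x r)).fun_add
      ((hasDerivAt_besselIntegral_comp_r k 1 n x' r' x r).const_mul
        (k * ((r' / (x' - x) : ℝ) : ℂ))))).congr_deriv ?_
  rw [modeGreenDrr]
  ring

theorem hasDerivAt_modeGreen_x (k : ℂ) (n : ℤ) {x' x : ℝ} (h : x < x') (r' r : ℝ) :
    HasDerivAt (fun x => modeGreen k n x' r' x r) (modeGreenDx k n x' r' x r) x := by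
  have hD : x' - x ≠ 0 := (sub_pos.2 h).ne'
  have h0 : HasDerivAt (fun x : ℝ => x' - x) (-1) x := by
    simpa using (hasDerivAt_id x).const_sub x'
  have h1 : HasDerivAt (fun x : ℝ => r' * r / (x' - x)) (r' * r / (x' - x) ^ 2) x := by
    refine ((hasDerivAt_const x (r' * r)).fun_div h0 hD).congr_deriv ?_
    ring
  have h2 := (hasDerivAt_besselIntegral 0 n (k * ((r' * r / (x' - x) : ℝ) : ℂ))).comp x
    (h1.ofReal_comp.const_mul k)
  refine ((hasDerivAt_modeGreenFactor_x k h r' r).fun_mul h2).congr_deriv ?_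
  rw [modeGreenDx, Function.comp]
  ring

/-- The modes of the Green's function solve the adjoint parabolic equation in the source point. -/
theorem modeGreen_adjoint_equation {k : ℂ} (hk : k ≠ 0) (n : ℤ) {x' x : ℝ} (h : x < x')
    (r' : ℝ) {r : ℝ} (hr : r ≠ 0) :
    modeGreenDx k n x' r' x r = 1 / (2 * I * k) * (modeGreenDrr k n x' r' x r
      + 1 / (r : ℂ) * modeGreenDr k n x' r' x r
      - (n : ℂ) ^ 2 / (r : ℂ) ^ 2 * modeGreen k n x' r' x r) := by
  have hD : ((x' : ℂ) - x) ≠ 0 := by exact_mod_cast (sub_pos.2 h).ne'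
  have hr' : (r : ℂ) ≠ 0 := by exact_mod_cast hr
  have ode := besselIntegral_ode n (k * ((r' * r / (x' - x) : ℝ) : ℂ))
  simp only [modeGreenDx, modeGreenDrr, modeGreenDr, modeGreen]
  set F := modeGreenFactor k x' r' x r
  set B0 := besselIntegral 0 n (k * ((r' * r / (x' - x) : ℝ) : ℂ))
  set B1 := besselIntegral 1 n (k * ((r' * r / (x' - x) : ℝ) : ℂ))
  set B2 := besselIntegral 2 n (k * ((r' * r / (x' - x) : ℝ) : ℂ))
  push_cast at ode ⊢
  have hI : (I : ℂ) ≠ 0 := I_ne_zero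
  -- Bessel's equation is used to eliminate `n² B0`, which carries the only occurrence of `n`; what
  -- remains is a polynomial identity in `B0`, `B1`, `B2`.
  have key : (n : ℂ) ^ 2 * B0 = (k * (r' * r / (x' - x))) ^ 2 * B2 + (k * (r' * r / (x' - x))) * B1
      + (k * (r' * r / (x' - x))) ^ 2 * B0 := by linear_combination -ode
  have e : ∀ X : ℂ, (n : ℂ) ^ 2 / (r : ℂ) ^ 2 * (X * B0) = X / r ^ 2 * ((n : ℂ) ^ 2 * B0) := by
    intro X; ring
  rw [e, key]
  field_simp
  ring_nf
  simp only [I_sq]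
  ring

theorem contDiff_besselIntegral (j : ℕ) (n : ℤ) : ContDiff ℝ 2 (besselIntegral j n) :=
  ((differentiable_besselIntegral j n).contDiff (n := 2)).restrict_scalars ℝ

theorem contDiffAt_modeGreenFactor (k : ℂ) (x' r' : ℝ) {p : ℝ × ℝ} (h : p.1 < x') :
    ContDiffAt ℝ 2 (fun p : ℝ × ℝ => modeGreenFactor k x' r' p.1 p.2) p := by
  have hD : x' - p.1 ≠ 0 := (sub_pos.2 h).ne'
  have h0 : ContDiffAt ℝ 2 (fun p : ℝ × ℝ => x' - p.1) p := by fun_prop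
  have hofR : ContDiff ℝ 2 (fun t : ℝ => (t : ℂ)) := Complex.ofRealCLM.contDiff
  simp only [modeGreenFactor, div_eq_mul_inv k]
  refine ContDiffAt.mul (contDiffAt_const.mul (ContDiffAt.inv (contDiffAt_const.mul
    (hofR.contDiffAt.comp p h0)) ?_)) (ContDiffAt.cexp (contDiffAt_const.mul
      (hofR.contDiffAt.comp p (ContDiffAt.fun_div (by fun_prop) h0 hD))))
  exact mul_ne_zero (by simp [Real.pi_ne_zero]) (by exact_mod_cast hD)

theorem contDiffAt_besselIntegral_comp (k : ℂ) (j : ℕ) (n : ℤ) (x' r' : ℝ) {p : ℝ × ℝ}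
    (h : p.1 < x') : ContDiffAt ℝ 2 (fun p : ℝ × ℝ =>
      besselIntegral j n (k * ((r' * p.2 / (x' - p.1) : ℝ) : ℂ))) p := by
  have hD : x' - p.1 ≠ 0 := (sub_pos.2 h).ne'
  have h0 : ContDiffAt ℝ 2 (fun p : ℝ × ℝ => x' - p.1) p := by fun_prop
  have hofR : ContDiff ℝ 2 (fun t : ℝ => (t : ℂ)) := Complex.ofRealCLM.contDiff
  exact (contDiff_besselIntegral j n).contDiffAt.comp p (contDiffAt_const.mul
    (hofR.contDiffAt.comp p (ContDiffAt.fun_div (by fun_prop) h0 hD)))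

theorem contDiffAt_modeGreen (k : ℂ) (n : ℤ) (x' r' : ℝ) {p : ℝ × ℝ} (h : p.1 < x') :
    ContDiffAt ℝ 2 (fun p : ℝ × ℝ => modeGreen k n x' r' p.1 p.2) p :=
  (contDiffAt_modeGreenFactor k x' r' h).mul (contDiffAt_besselIntegral_comp k 0 n x' r' h)

theorem contDiffAt_modeGreenDr (k : ℂ) (n : ℤ) (x' r' : ℝ) {p : ℝ × ℝ} (h : p.1 < x') :
    ContDiffAt ℝ 2 (fun p : ℝ × ℝ => modeGreenDr k n x' r' p.1 p.2) p := by
  have hD : x' - p.1 ≠ 0 := (sub_pos.2 h).ne'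
  have h0 : ContDiffAt ℝ 2 (fun p : ℝ × ℝ => x' - p.1) p := by fun_prop
  have hofR : ContDiff ℝ 2 (fun t : ℝ => (t : ℂ)) := Complex.ofRealCLM.contDiff
  refine (contDiffAt_modeGreenFactor k x' r' h).mul (ContDiffAt.add
    (ContDiffAt.mul (contDiffAt_const.mul (hofR.contDiffAt.comp p
      (ContDiffAt.fun_div (by fun_prop) h0 hD))) (contDiffAt_besselIntegral_comp k 0 n x' r' h))
    (ContDiffAt.mul (contDiffAt_const.mul (hofR.contDiffAt.comp p
      (ContDiffAt.fun_div contDiffAt_const h0 hD))) (contDiffAt_besselIntegral_comp k 1 n x' r' h)))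

theorem continuousOn_modeGreen (k : ℂ) (n : ℤ) (x' r' : ℝ) :
    ContinuousOn (fun p : ℝ × ℝ => modeGreen k n x' r' p.1 p.2) {p | p.1 < x'} :=
  fun _ hp => (contDiffAt_modeGreen k n x' r' hp).continuousAt.continuousWithinAt

theorem continuousOn_modeGreenDr (k : ℂ) (n : ℤ) (x' r' : ℝ) :
    ContinuousOn (fun p : ℝ × ℝ => modeGreenDr k n x' r' p.1 p.2) {p | p.1 < x'} :=
  fun _ hp => (contDiffAt_modeGreenDr k n x' r' hp).continuousAt.continuousWithinAt

/-- The radial derivative of the Green's function. -/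
theorem hasDerivAt_parabolicGreen_r (k : ℂ) {x' x : ℝ} (h : x < x') (r' φ r : ℝ) :
    HasDerivAt (fun r => parabolicGreen k x' r' φ x r 0)
      (parabolicGreen k x' r' φ x r 0 *
        (I * k * (((r - r' * Real.cos φ) / (x' - x) : ℝ) : ℂ))) r := by
  have h1 : HasDerivAt (fun r : ℝ => exp (-(I * (k * ((r' * r / (x' - x) : ℝ) : ℂ))
      * (Real.cos φ : ℂ)))) (exp (-(I * (k * ((r' * r / (x' - x) : ℝ) : ℂ))
      * (Real.cos φ : ℂ))) * -(I * (k * ((r' / (x' - x) : ℝ) : ℂ))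
      * (Real.cos φ : ℂ))) r := by
    have h1 : HasDerivAt (fun r : ℝ => r' * r / (x' - x)) (r' / (x' - x)) r := by
      simpa using ((hasDerivAt_id r).const_mul r').div_const (x' - x)
    exact (((h1.ofReal_comp.const_mul k).const_mul I).mul_const (Real.cos φ : ℂ)).fun_neg.cexp
  have h2 := (hasDerivAt_modeGreenFactor_r k x' r' x r).fun_mul h1
  simp only [parabolicGreen_eq_factor k h]
  refine h2.congr_deriv ?_
  push_cast
  ring

theorem modeGreenDr_eq_integral (k : ℂ) (n : ℤ) {x' x : ℝ} (h : x < x') (r' r : ℝ) :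
    modeGreenDr k n x' r' x r = ∫ φ in (0 : ℝ)..(2 * Real.pi),
      parabolicGreen k x' r' φ x r 0 * (I * k * (((r - r' * Real.cos φ) / (x' - x) : ℝ) : ℂ))
        * exp (-(I * n * (φ : ℂ))) := by
  rw [modeGreenDr, besselIntegral, besselIntegral, ← intervalIntegral.integral_const_mul,
    ← intervalIntegral.integral_const_mul, ← intervalIntegral.integral_add,
    ← intervalIntegral.integral_const_mul]
  · refine intervalIntegral.integral_congr fun φ _ => ?_
    simp only [parabolicGreen_eq_factor k h]
    push_cast
    ring
  · exact Continuous.intervalIntegrable (by fun_prop) _ _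
  · exact Continuous.intervalIntegrable (by fun_prop) _ _

/-! ### The mode kernel in terms of Green modes and Bessel functions -/

theorem continuous_parabolicGreen_angle (k : ℂ) {x' x : ℝ} (h : x < x') (r' r : ℝ) :
    Continuous fun φ => parabolicGreen k x' r' φ x r 0 := by
  simp only [parabolicGreen_eq_factor k h]
  fun_prop

theorem surfaceKernel_eq (k : ℂ) (f : ℝ → ℝ) {x' x : ℝ} (h : x < x') (φ : ℝ) :
    surfaceKernel k f x' φ x 0 = I * (f x : ℂ) / k *
      (parabolicGreen k x' (f x') φ x (f x) 0 *
          (I * k * (((f x - f x' * Real.cos φ) / (x' - x) : ℝ) : ℂ))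
        + I * k * ((deriv f x : ℝ) : ℂ) * parabolicGreen k x' (f x') φ x (f x) 0) := by
  rw [surfaceKernel, (hasDerivAt_parabolicGreen_r k h (f x') φ (f x)).deriv]

/-- This is the form in which the kernel appears as the surface term of Green's identity. -/
theorem modeKernel_eq (k : ℂ) (f : ℝ → ℝ) (n : ℤ) {x' x : ℝ} (h : x < x') :
    modeKernel k f n x' x = I * (f x : ℂ) / k * (modeGreenDr k n x' (f x') x (f x)
      + I * k * ((deriv f x : ℝ) : ℂ) * modeGreen k n x' (f x') x (f x)) := by
  have hc := continuous_parabolicGreen_angle k h (f x') (f x)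
  rw [modeKernel, modeGreenDr_eq_integral k n h, modeGreen_eq_integral k n h,
    ← intervalIntegral.integral_const_mul, ← intervalIntegral.integral_add,
    ← intervalIntegral.integral_const_mul]
  · refine intervalIntegral.integral_congr fun φ _ => ?_
    simp only [surfaceKernel_eq k f h]
    ring
  · exact Continuous.intervalIntegrable (by fun_prop) _ _
  · exact Continuous.intervalIntegrable (by fun_prop) _ _

theorem besselIntegral_one_eq (n : ℤ) (z : ℂ) :
    besselIntegral 1 n z = 2 * Real.pi * (-I) ^ n * deriv (besselJ n) z := by
  have hne : (2 * Real.pi * (-I) ^ n : ℂ) ≠ 0 :=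
    mul_ne_zero (by simp [Real.pi_ne_zero]) (zpow_ne_zero _ (by simp))
  have hJ : besselJ n = fun z => (2 * Real.pi * (-I) ^ n : ℂ)⁻¹ * besselIntegral 0 n z := by
    funext z
    rw [besselIntegral_zero_eq, inv_mul_cancel_left₀ hne]
  rw [hJ, ((hasDerivAt_besselIntegral 0 n z).const_mul _).deriv, mul_inv_cancel_left₀ hne]

theorem modeKernel_eq_bessel {k : ℂ} (hk : k ≠ 0) (f : ℝ → ℝ) (n : ℤ) {x' x : ℝ} (h : x < x') :
    modeKernel k f n x' x =
      I * k * (f x : ℂ) / ((x' - x : ℝ) : ℂ) ^ 2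
        * exp (I * k / 2 * (((f x' ^ 2 + f x ^ 2) / (x' - x) : ℝ) : ℂ))
        * ((-I) ^ n * ((f x + (x' - x) * deriv f x : ℝ) : ℂ)
              * besselJ n (k * ((f x' * f x / (x' - x) : ℝ) : ℂ))
            + (-I) ^ (n + 1) * (f x' : ℂ)
              * deriv (besselJ n) (k * ((f x' * f x / (x' - x) : ℝ) : ℂ))) := by
  have hD : ((x' : ℂ) - x) ≠ 0 := by exact_mod_cast (sub_pos.2 h).ne'
  have hI : (I : ℂ) ≠ 0 := I_ne_zero
  have hpi : (Real.pi : ℂ) ≠ 0 := by exact_mod_cast Real.pi_ne_zero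
  rw [modeKernel_eq k f n h, modeGreenDr, modeGreen, besselIntegral_zero_eq, besselIntegral_one_eq,
    modeGreenFactor, zpow_add₀ (by simp : (-I : ℂ) ≠ 0), zpow_one]
  generalize besselJ n (k * ((f x' * f x / (x' - x) : ℝ) : ℂ)) = J0
  generalize deriv (besselJ n) (k * ((f x' * f x / (x' - x) : ℝ) : ℂ)) = J1
  generalize (-I : ℂ) ^ n = N
  generalize exp (I * k / 2 * (((f x' ^ 2 + f x ^ 2) / (x' - x) : ℝ) : ℂ)) = e
  push_cast
  field_simp
  ring_nf
  simp only [I_sq]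
  ring


/-! ### Estimates for the Green's function -/

theorem norm_parabolicGreen {k : ℂ} {x' x : ℝ} (h : x < x') (r' φ r : ℝ) :
    ‖parabolicGreen k x' r' φ x r 0‖ = ‖k‖ / (2 * Real.pi * (x' - x)) *
      Real.exp (-(k.im / 2 * ((r' ^ 2 + r ^ 2 - 2 * r' * r * Real.cos φ) / (x' - x)))) := by
  have hD := sub_pos.2 h
  rw [parabolicGreen, if_pos h, norm_mul, norm_div, norm_exp, norm_mul, norm_mul, norm_mul, norm_I,
    Complex.norm_real, Complex.norm_real, sub_zero, Real.norm_of_nonneg hD.le,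
    Real.norm_of_nonneg Real.pi_pos.le, re_mul_ofReal]
  have e : (I * k / 2).re = -(k.im / 2) := by simp; ring
  rw [e, neg_mul]
  simp

/-- Absorption (`Im k > 0`) turns the oscillating exponential into a genuine Gaussian of the
transversal distance, and for given radii this distance is at least `|r - r'|`. -/
theorem norm_parabolicGreen_le {k : ℂ} (hk : 0 < k.im) {x' x : ℝ} (h : x < x') {r' r : ℝ}
    (hr' : 0 ≤ r') (hr : 0 ≤ r) (φ : ℝ) :
    ‖parabolicGreen k x' r' φ x r 0‖ ≤ ‖k‖ / (2 * Real.pi * (x' - x)) *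
      Real.exp (-(k.im / 2 * ((r - r') ^ 2 / (x' - x)))) := by
  have hD := sub_pos.2 h
  rw [norm_parabolicGreen h]
  have := Real.cos_le_one φ
  gcongr
  nlinarith [mul_nonneg hr' hr]

theorem norm_exp_angular (n : ℤ) (φ : ℝ) : ‖exp (-(I * n * (φ : ℂ)))‖ = 1 := by
  rw [show -(I * (n : ℂ) * (φ : ℂ)) = ((-(n * φ) : ℝ) : ℂ) * I by push_cast; ring,
    norm_exp_ofReal_mul_I]

theorem norm_modeGreen_le {k : ℂ} (hk : 0 < k.im) (n : ℤ) {x' x : ℝ} (h : x < x') {r' r : ℝ}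
    (hr' : 0 ≤ r') (hr : 0 ≤ r) :
    ‖modeGreen k n x' r' x r‖ ≤ ‖k‖ / (x' - x) *
      Real.exp (-(k.im / 2 * ((r - r') ^ 2 / (x' - x)))) := by
  have hD := sub_pos.2 h
  have hpi := Real.pi_pos
  rw [modeGreen_eq_integral k n h]
  refine (intervalIntegral.norm_integral_le_of_norm_le_const (C := ‖k‖ / (2 * Real.pi * (x' - x)) *
      Real.exp (-(k.im / 2 * ((r - r') ^ 2 / (x' - x))))) fun φ _ => ?_).trans_eq ?_
  · rw [norm_mul, norm_exp_angular, mul_one]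
    exact norm_parabolicGreen_le hk h hr' hr φ
  · rw [sub_zero, abs_of_pos (by positivity)]
    field_simp

theorem norm_modeGreenDr_le {k : ℂ} (hk : 0 < k.im) (n : ℤ) {x' x : ℝ} (h : x < x') {r' r : ℝ}
    (hr' : 0 ≤ r') (hr : 0 ≤ r) :
    ‖modeGreenDr k n x' r' x r‖ ≤ ‖k‖ / (x' - x) *
      Real.exp (-(k.im / 2 * ((r - r') ^ 2 / (x' - x)))) * (‖k‖ * ((r + r') / (x' - x))) := by
  have hD := sub_pos.2 h
  have hpi := Real.pi_pos
  rw [modeGreenDr_eq_integral k n h]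
  refine (intervalIntegral.norm_integral_le_of_norm_le_const (C := ‖k‖ / (2 * Real.pi * (x' - x)) *
      Real.exp (-(k.im / 2 * ((r - r') ^ 2 / (x' - x)))) *
        (‖k‖ * ((r + r') / (x' - x)))) fun φ _ => ?_).trans_eq ?_
  · rw [norm_mul, norm_exp_angular, mul_one, norm_mul]
    refine mul_le_mul (norm_parabolicGreen_le hk h hr' hr φ) ?_ (norm_nonneg _) (by positivity)
    rw [norm_mul, norm_mul, norm_I, one_mul, Complex.norm_real, Real.norm_eq_abs, abs_div,
      abs_of_pos hD]
    gcongr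
    rw [abs_le]
    constructor <;> nlinarith [Real.cos_le_one φ, Real.neg_one_le_cos φ]
  · rw [sub_zero, abs_of_pos (by positivity)]
    field_simp

/-- The modes of the Green's function decay faster than every exponential. -/
theorem exists_modeGreen_bound {k : ℂ} (hk : 0 < k.im) (n : ℤ) {a c x' r' : ℝ} (hc : c < x')
    (hr' : 0 ≤ r') (B : ℝ) : ∃ C : ℝ, 0 ≤ C ∧ ∀ x r : ℝ, a ≤ x → x ≤ c → 0 ≤ r →
      ‖modeGreen k n x' r' x r‖ ≤ C * Real.exp (-(B * r)) ∧
      ‖modeGreenDr k n x' r' x r‖ ≤ C * Real.exp (-(B * r)) := by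
  rcases lt_or_ge c a with hca | hac
  · exact ⟨0, le_rfl, fun x r h1 h2 => absurd (h1.trans h2) (not_le.2 hca)⟩
  set δ := x' - c with hδ
  have hδ0 : 0 < δ := sub_pos.2 hc
  set L := x' - a with hL
  have hL0 : 0 < L := by linarith
  set q := k.im / 2 / L with hq
  have hq0 : 0 < q := by positivity
  set A := ‖k‖ / δ with hA
  set A' := 1 + ‖k‖ * ((1 + r') / δ) with hA'
  have hA0 : 0 ≤ A := by positivity
  have hA1 : 1 ≤ A' := by
    have : 0 ≤ ‖k‖ * ((1 + r') / δ) := by positivity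
    linarith
  -- completing the square
  set E := (2 * q * r' + (B + 1)) ^ 2 / (4 * q) with hE
  have hsq : ∀ r : ℝ, -(q * (r - r') ^ 2) + (B + 1) * r ≤ E := fun r => by
    rw [hE, le_div_iff₀ (by positivity)]
    nlinarith [sq_nonneg (2 * q * r - (2 * q * r' + (B + 1))), sq_nonneg (q * r')]
  refine ⟨A * Real.exp E * A', by positivity, fun x r hx hxc hr => ?_⟩
  have hxx : x < x' := hxc.trans_lt hc
  have hD : 0 < x' - x := sub_pos.2 hxx
  have e1 : ‖k‖ / (x' - x) ≤ A := by
    rw [hA]; gcongr; linarith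
  have e2 : Real.exp (-(k.im / 2 * ((r - r') ^ 2 / (x' - x))))
      ≤ Real.exp E * Real.exp (-((B + 1) * r)) := by
    rw [← Real.exp_add]
    gcongr
    have : q * (r - r') ^ 2 ≤ k.im / 2 * ((r - r') ^ 2 / (x' - x)) := by
      rw [hq, div_mul_eq_mul_div, mul_div_assoc]
      gcongr
      linarith
    linarith [hsq r]
  -- The rate `B + 1` instead of `B` leaves a spare `e^{-r}`, which absorbs the linear factor `r +
  -- r'` of the radial derivative.
  have e3 : Real.exp (-((B + 1) * r)) = Real.exp (-(B * r)) * Real.exp (-r) := by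
    rw [← Real.exp_add]; congr 1; ring
  have e4 : Real.exp (-r) ≤ 1 := Real.exp_le_one_iff.2 (by linarith)
  constructor
  · refine (norm_modeGreen_le hk n hxx hr' hr).trans ?_
    calc _ ≤ A * (Real.exp E * (Real.exp (-(B * r)) * 1)) := by
          rw [e3] at e2
          exact mul_le_mul e1 (e2.trans (by gcongr)) (by positivity) hA0
      _ = A * Real.exp E * 1 * Real.exp (-(B * r)) := by ring
      _ ≤ _ := by gcongr
  · refine (norm_modeGreenDr_le hk n hxx hr' hr).trans ?_
    have e5 : ‖k‖ * ((r + r') / (x' - x)) ≤ A' * Real.exp r := by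
      have h1 : r + r' ≤ (1 + r') * Real.exp r := by
        nlinarith [Real.add_one_le_exp r, Real.one_le_exp hr]
      calc ‖k‖ * ((r + r') / (x' - x)) ≤ ‖k‖ * ((1 + r') * Real.exp r / δ) := by
            gcongr; linarith
        _ = (‖k‖ * ((1 + r') / δ)) * Real.exp r := by ring
        _ ≤ A' * Real.exp r := by gcongr; linarith
    calc _ ≤ A * (Real.exp E * (Real.exp (-(B * r)) * Real.exp (-r))) * (A' * Real.exp r) := by
          rw [e3] at e2
          refine mul_le_mul (mul_le_mul e1 e2 (by positivity) hA0) e5 (by positivity) (by positivity)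
      _ = A * Real.exp E * A' * Real.exp (-(B * r)) * (Real.exp (-r) * Real.exp r) := by ring
      _ = _ := by rw [← Real.exp_add]; simp

/-- On `[-π, π]` one has `1 - cos φ ≥ 2φ²/π²`, so a Gaussian over the whole line dominates. The
decay `b^{-1/2}` gains a factor `√(x' - x)`, which makes the singularity of the kernel integrable.
-/
theorem integral_exp_neg_one_sub_cos_le {b : ℝ} (hb : 0 < b) :
    ∫ φ in (0 : ℝ)..(2 * Real.pi), Real.exp (-(b * (1 - Real.cos φ)))
      ≤ Real.pi * Real.sqrt (Real.pi / (2 * b)) := by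
  have hpi := Real.pi_pos
  have hper : Function.Periodic (fun φ => Real.exp (-(b * (1 - Real.cos φ)))) (2 * Real.pi) :=
    fun φ => by simp
  have h1 := hper.intervalIntegral_add_eq 0 (-Real.pi)
  rw [zero_add, show -Real.pi + 2 * Real.pi = Real.pi by ring] at h1
  have hb' : 0 < 2 * b / Real.pi ^ 2 := by positivity
  rw [h1, intervalIntegral.integral_of_le (by linarith)]
  calc ∫ φ in Ioc (-Real.pi) Real.pi, Real.exp (-(b * (1 - Real.cos φ)))
      ≤ ∫ φ in Ioc (-Real.pi) Real.pi, Real.exp (-(2 * b / Real.pi ^ 2) * φ ^ 2) := by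
        refine setIntegral_mono_on ?_ ((integrable_exp_neg_mul_sq hb').integrableOn)
          measurableSet_Ioc fun φ hφ => ?_
        · exact (Continuous.integrableOn_Icc (by fun_prop)).mono_set Ioc_subset_Icc_self
        · gcongr
          have := Real.cos_le_one_sub_mul_cos_sq (abs_le.2 ⟨hφ.1.le, hφ.2⟩)
          have h2 : 2 / Real.pi ^ 2 * φ ^ 2 ≤ 1 - Real.cos φ := by linarith
          calc -(b * (1 - Real.cos φ)) ≤ -(b * (2 / Real.pi ^ 2 * φ ^ 2)) := by gcongr
            _ = _ := by ring
    _ ≤ ∫ φ : ℝ, Real.exp (-(2 * b / Real.pi ^ 2) * φ ^ 2) :=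
        setIntegral_le_integral (integrable_exp_neg_mul_sq hb')
          (Filter.Eventually.of_forall fun _ => (Real.exp_pos _).le)
    _ = Real.sqrt (Real.pi / (2 * b / Real.pi ^ 2)) := integral_gaussian _
    _ = _ := by
        rw [show Real.pi / (2 * b / Real.pi ^ 2) = Real.pi ^ 2 * (Real.pi / (2 * b)) by
          field_simp, Real.sqrt_mul (by positivity), Real.sqrt_sq hpi.le]

/-- Half of the exponent pays for the factor `t`. In the kernel `t` is a multiple of `(1 - cos φ) /
(x' - x)`, so one power of `1 / (x' - x)` is removed. -/
theorem mul_exp_neg_le (t : ℝ) : t * Real.exp (-t) ≤ 2 * Real.exp (-(t / 2)) := by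
  have h1 : Real.exp (-t) = Real.exp (-(t / 2)) * Real.exp (-(t / 2)) := by
    rw [← Real.exp_add]; ring_nf
  have h2 : t / 2 * Real.exp (-(t / 2)) ≤ 1 := by
    have := Real.add_one_le_exp (t / 2)
    calc t / 2 * Real.exp (-(t / 2)) ≤ Real.exp (t / 2) * Real.exp (-(t / 2)) := by
          gcongr; linarith
      _ = 1 := by rw [← Real.exp_add]; simp
  rw [h1]
  nlinarith [Real.exp_pos (-(t / 2))]

/-- The kernel of the boundary integral equation is weakly singular at the diagonal. -/
theorem norm_modeKernel_le {k : ℂ} (hk : 0 < k.im) (f : ℝ → ℝ) (n : ℤ) {x' x m M C : ℝ}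
    (h : x < x') (hm : 0 < m) (hmx : m ≤ f x) (hmx' : m ≤ f x') (hMx : f x ≤ M) (hMx' : f x' ≤ M)
    (hC : |f x - f x' + (x' - x) * deriv f x| ≤ C * (x' - x) ^ 2) :
    ‖modeKernel k f n x' x‖ ≤ M * ‖k‖ * C + M ^ 2 * ‖k‖ / (k.im * m ^ 2)
      * Real.sqrt (Real.pi / (k.im * m ^ 2)) * (1 / Real.sqrt (x' - x)) := by
  have hD := sub_pos.2 h
  have hpi := Real.pi_pos
  have hk0 : k ≠ 0 := fun h0 => by simp [h0] at hk
  set D := x' - x with hDdef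
  set b := k.im * m ^ 2 / D with hb
  have hb0 : 0 < b := by positivity
  have hM : 0 < M := hm.trans_le (hmx.trans hMx)
  have hC0 : 0 ≤ C := by
    by_contra hneg
    have := (abs_nonneg _).trans hC
    nlinarith [sq_pos_of_pos hD]
  set W : ℝ → ℝ := fun φ => M * ‖k‖ / (2 * Real.pi) * C
    + M ^ 2 * ‖k‖ / (Real.pi * (k.im * m ^ 2) * D) * Real.exp (-(b / 2 * (1 - Real.cos φ)))
  have hpt : ∀ φ : ℝ, ‖surfaceKernel k f x' φ x 0 * exp (-(I * n * (φ : ℂ)))‖ ≤ W φ := by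
    intro φ
    have hcos : 0 ≤ 1 - Real.cos φ := by linarith [Real.cos_le_one φ]
    have hfx : 0 ≤ f x := hm.le.trans hmx
    have hfx' : 0 ≤ f x' := hm.le.trans hmx'
    -- The numerator is split into a Taylor remainder of `f`, of order `D²`, and the term `f x' (1 -
    -- cos φ)`, which vanishes at the peak of the Gaussian.
    have e0 : surfaceKernel k f x' φ x 0 = -((f x / D : ℝ) : ℂ) *
        ((f x - f x' + D * deriv f x + f x' * (1 - Real.cos φ) : ℝ) : ℂ) *
        parabolicGreen k x' (f x') φ x (f x) 0 := by
      have hDc : ((x' : ℂ) - x) ≠ 0 := by exact_mod_cast hD.ne'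
      rw [surfaceKernel_eq k f h, hDdef]
      push_cast
      field_simp
      ring_nf
      simp only [I_sq]
      ring
    have e1 : ‖parabolicGreen k x' (f x') φ x (f x) 0‖ ≤ ‖k‖ / (2 * Real.pi * D) *
        Real.exp (-(b * (1 - Real.cos φ))) := by
      rw [norm_parabolicGreen h]
      refine mul_le_mul_of_nonneg_left (Real.exp_le_exp.2 (neg_le_neg ?_)) (by positivity)
      rw [hb, div_mul_eq_mul_div, ← mul_div_assoc]
      refine div_le_div_of_nonneg_right ?_ hD.le
      -- The squared transversal distance is `(f x - f x')² + 2 f x f x' (1 - cos φ)`; only the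
      -- angular part is kept.
      have : m ^ 2 ≤ f x * f x' := by nlinarith
      nlinarith [sq_nonneg (f x - f x'), mul_nonneg hk.le (sq_nonneg (f x - f x')),
        mul_nonneg hk.le (mul_nonneg hcos (sub_nonneg.2 this))]
    have e2 : |f x - f x' + D * deriv f x + f x' * (1 - Real.cos φ)|
        ≤ C * D ^ 2 + M * (1 - Real.cos φ) := by
      refine (abs_add_le _ _).trans (add_le_add hC ?_)
      rw [abs_of_nonneg (by positivity)]
      gcongr
    have e3 : b * (1 - Real.cos φ) * Real.exp (-(b * (1 - Real.cos φ)))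
        ≤ 2 * Real.exp (-(b / 2 * (1 - Real.cos φ))) := by
      refine (mul_exp_neg_le _).trans_eq ?_
      congr 3; ring
    have e4 : Real.exp (-(b * (1 - Real.cos φ))) ≤ 1 :=
      Real.exp_le_one_iff.2 (by nlinarith)
    rw [norm_mul, norm_exp_angular, mul_one, e0, norm_mul, norm_mul, norm_neg, Complex.norm_real,
      Complex.norm_real, Real.norm_eq_abs, Real.norm_eq_abs, abs_of_nonneg (by positivity)]
    calc f x / D * |f x - f x' + D * deriv f x + f x' * (1 - Real.cos φ)| *
          ‖parabolicGreen k x' (f x') φ x (f x) 0‖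
        ≤ M / D * (C * D ^ 2 + M * (1 - Real.cos φ)) * (‖k‖ / (2 * Real.pi * D) *
          Real.exp (-(b * (1 - Real.cos φ)))) := by gcongr
      _ = M * ‖k‖ / (2 * Real.pi) * C * Real.exp (-(b * (1 - Real.cos φ)))
          + M ^ 2 * ‖k‖ / (2 * Real.pi * (k.im * m ^ 2) * D) *
            (b * (1 - Real.cos φ) * Real.exp (-(b * (1 - Real.cos φ)))) := by
          rw [hb]; field_simp
      _ ≤ M * ‖k‖ / (2 * Real.pi) * C * 1
          + M ^ 2 * ‖k‖ / (2 * Real.pi * (k.im * m ^ 2) * D) *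
            (2 * Real.exp (-(b / 2 * (1 - Real.cos φ)))) := by gcongr
      _ = W φ := by simp only [W]; field_simp
  have hle := intervalIntegral.norm_integral_le_of_norm_le (μ := volume) (a := 0) (b := 2 * Real.pi)
    (by positivity) (Filter.Eventually.of_forall fun φ _ => hpt φ)
    (Continuous.intervalIntegrable (by fun_prop) _ _)
  refine (show ‖modeKernel k f n x' x‖ ≤ _ from hle).trans ?_
  simp only [W]
  rw [intervalIntegral.integral_add (Continuous.intervalIntegrable (by fun_prop) _ _)
    (Continuous.intervalIntegrable (by fun_prop) _ _), intervalIntegral.integral_const,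
    intervalIntegral.integral_const_mul]
  refine add_le_add (le_of_eq ?_) ?_
  · rw [sub_zero, smul_eq_mul]; field_simp
  · refine (mul_le_mul_of_nonneg_left (integral_exp_neg_one_sub_cos_le (b := b / 2) (by positivity))
      (by positivity)).trans_eq ?_
    rw [hb, show Real.pi / (2 * (k.im * m ^ 2 / D / 2)) = Real.pi / (k.im * m ^ 2) * D by
      field_simp, Real.sqrt_mul (by positivity)]
    have hs : Real.sqrt D * Real.sqrt D = D := Real.mul_self_sqrt hD.le
    have hs0 : 0 < Real.sqrt D := Real.sqrt_pos.2 hD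
    rw [← hs, Real.sqrt_mul_self hs0.le]
    field_simp


/-! ### The exterior of the body in a meridional half-plane -/

/-- The exterior of the body in the half-plane of the coordinates `(x, r)`. -/
def planarExterior (X₁ : ℝ) (X₂ : EReal) (f : ℝ → ℝ) : Set (ℝ × ℝ) :=
  {p | (p.1 : EReal) < X₂ ∧ 0 < p.2 ∧ (X₁ ≤ p.1 → f p.1 < p.2)}

/-- The part `X₁ ≤ x` of the exterior of the body, with the surface but without the tip. -/
def rearExterior (X₁ : ℝ) (X₂ : EReal) (f : ℝ → ℝ) : Set (ℝ × ℝ) :=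
  {p | X₁ ≤ p.1 ∧ (p.1 : EReal) < X₂ ∧ 0 < p.2 ∧ f p.1 ≤ p.2}

namespace IsBodyProfile

variable {X₁ : ℝ} {X₂ : EReal} {f : ℝ → ℝ}

theorem isOpen_domain (X₁ : ℝ) (X₂ : EReal) : IsOpen {x : ℝ | X₁ < x ∧ (x : EReal) < X₂} :=
  (isOpen_lt continuous_const continuous_id).inter
    (isOpen_lt continuous_coe_real_ereal continuous_const)

theorem contDiffAt (hf : IsBodyProfile X₁ X₂ f) {x : ℝ} (h1 : X₁ < x) (h2 : (x : EReal) < X₂) :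
    ContDiffAt ℝ 2 f x :=
  hf.smooth.contDiffAt ((isOpen_domain X₁ X₂).mem_nhds ⟨h1, h2⟩)

theorem differentiableAt (hf : IsBodyProfile X₁ X₂ f) {x : ℝ} (h1 : X₁ < x)
    (h2 : (x : EReal) < X₂) : DifferentiableAt ℝ f x :=
  (hf.contDiffAt h1 h2).differentiableAt (by norm_num)

theorem contDiffAt_deriv (hf : IsBodyProfile X₁ X₂ f) {x : ℝ} (h1 : X₁ < x)
    (h2 : (x : EReal) < X₂) : ContDiffAt ℝ 1 (deriv f) x := by
  have h : ContDiffOn ℝ 1 (deriv f) {x : ℝ | X₁ < x ∧ (x : EReal) < X₂} :=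
    ((contDiffOn_succ_iff_deriv_of_isOpen (n := 1) (isOpen_domain X₁ X₂)).1
      (by simpa [one_add_one_eq_two] using hf.smooth)).2.2
  exact h.contDiffAt ((isOpen_domain X₁ X₂).mem_nhds ⟨h1, h2⟩)

theorem continuousWithinAt (hf : IsBodyProfile X₁ X₂ f) {x : ℝ} (h1 : X₁ ≤ x)
    (h2 : (x : EReal) < X₂) : ContinuousWithinAt f (Ici X₁) x := by
  rcases h1.eq_or_lt with rfl | h
  · exact hf.continuous_tip
  · exact (hf.contDiffAt h h2).continuousAt.continuousWithinAt

theorem nonneg (hf : IsBodyProfile X₁ X₂ f) {x : ℝ} (h1 : X₁ ≤ x) (h2 : (x : EReal) < X₂) :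
    0 ≤ f x := by
  rcases h1.eq_or_lt with rfl | h
  · exact hf.tip.ge
  · exact (hf.pos x h h2).le

theorem continuousOn_Icc (hf : IsBodyProfile X₁ X₂ f) {b : ℝ} (hb : (b : EReal) < X₂) :
    ContinuousOn f (Icc X₁ b) := fun _ hx =>
  (hf.continuousWithinAt hx.1 ((EReal.coe_le_coe_iff.2 hx.2).trans_lt hb)).mono Icc_subset_Ici_self

/-- The only delicate points lie on the plane `x = X₁`: to the left of it there is no constraint
from the body, and to the right of it the continuity of `f` from the right at the tip is what is
needed. -/
theorem isOpen_planarExterior (hf : IsBodyProfile X₁ X₂ f) :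
    IsOpen (planarExterior X₁ X₂ f) := by
  have h1 : IsOpen {p : ℝ × ℝ | (p.1 : EReal) < X₂} :=
    isOpen_lt (continuous_coe_real_ereal.comp continuous_fst) continuous_const
  have h2 : IsOpen {p : ℝ × ℝ | 0 < p.2} := isOpen_lt continuous_const continuous_snd
  rw [isOpen_iff_mem_nhds]
  rintro p ⟨hp1, hp2, hp3⟩
  have h3 : ∀ᶠ q : ℝ × ℝ in nhds p, X₁ ≤ q.1 → f q.1 < q.2 := by
    rcases lt_or_ge p.1 X₁ with h | h
    · filter_upwards [(isOpen_lt continuous_fst continuous_const).mem_nhds h] with q hq h'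
      exact absurd h' (not_le.2 hq)
    · have hc : ContinuousWithinAt (fun q : ℝ × ℝ => f q.1) {q | X₁ ≤ q.1} p :=
        (hf.continuousWithinAt h hp1).comp (f := Prod.fst) continuous_fst.continuousWithinAt
          (fun q hq => hq)
      have hc2 := hc.sub (continuous_snd.continuousWithinAt (x := p) (s := {q : ℝ × ℝ | X₁ ≤ q.1}))
      have := hc2.eventually_lt_const (sub_neg.2 (hp3 h))
      rw [eventually_nhdsWithin_iff] at this
      filter_upwards [this] with q hq h'
      exact sub_neg.1 (hq h')
  filter_upwards [h1.mem_nhds hp1, h2.mem_nhds hp2, h3] with q a b c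
  exact ⟨a, b, c⟩

theorem isOpen_bodyExterior (hf : IsBodyProfile X₁ X₂ f) : IsOpen (bodyExterior X₁ X₂ f) :=
  hf.isOpen_planarExterior.preimage (f := fun p : ℝ × ℝ × ℝ => (p.1, p.2.1)) (by fun_prop)

end IsBodyProfile

/-! ### Angular modes -/

/-- The `n`-th angular Fourier mode of a function of `(x, r, φ)`. -/
def angularMode (n : ℤ) (W : ℝ × ℝ × ℝ → ℂ) (x r : ℝ) : ℂ :=
  1 / (2 * Real.pi) * ∫ φ in (0 : ℝ)..(2 * Real.pi), W (x, r, φ) * exp (-(I * n * (φ : ℂ)))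

/-- Differentiation passes under the angular integral. A joint derivative is recorded, and not only
the two partial ones, because Green's identity is later applied along the sheared coordinates `(x, f
x + s)`. -/
theorem hasFDerivAt_angularMode {Ω : Set (ℝ × ℝ)} (hΩ : IsOpen Ω) {W : ℝ × ℝ × ℝ → ℂ}
    (hW : ContDiffOn ℝ 1 W {q | (q.1, q.2.1) ∈ Ω}) (n : ℤ) {x r : ℝ} (hp : (x, r) ∈ Ω) :
    ∃ L : ℝ × ℝ →L[ℝ] ℂ, HasFDerivAt (fun p : ℝ × ℝ => angularMode n W p.1 p.2) L (x, r) ∧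
      L (1, 0) = angularMode n (fun q => fderiv ℝ W q (1, 0, 0)) x r ∧
      L (0, 1) = angularMode n (fun q => fderiv ℝ W q (0, 1, 0)) x r := by
  have hopen : IsOpen {q : ℝ × ℝ × ℝ | (q.1, q.2.1) ∈ Ω} :=
    hΩ.preimage (f := fun p : ℝ × ℝ × ℝ => (p.1, p.2.1)) (by fun_prop)
  have hfd := hW.continuousOn_fderiv_of_isOpen hopen le_rfl
  let ι : ℝ × ℝ →L[ℝ] ℝ × ℝ × ℝ := (ContinuousLinearMap.fst ℝ ℝ ℝ).prod
    ((ContinuousLinearMap.snd ℝ ℝ ℝ).prod 0)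
  have hmap : ContinuousOn (fun q : (ℝ × ℝ) × ℝ => (q.1.1, q.1.2, q.2)) (Ω ×ˢ univ) := by fun_prop
  have hmaps : MapsTo (fun q : (ℝ × ℝ) × ℝ => (q.1.1, q.1.2, q.2)) (Ω ×ˢ univ)
      {q : ℝ × ℝ × ℝ | (q.1, q.2.1) ∈ Ω} := fun q hq => hq.1
  have hexp : ContinuousOn (fun q : (ℝ × ℝ) × ℝ => exp (-(I * n * (q.2 : ℂ)))) (Ω ×ˢ univ) :=
    Continuous.continuousOn (by fun_prop)
  have hF' : ContinuousOn (fun q : (ℝ × ℝ) × ℝ => exp (-(I * n * (q.2 : ℂ))) •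
      (fderiv ℝ W (q.1.1, q.1.2, q.2)).comp ι) (Ω ×ˢ univ) := by
    refine ContinuousOn.smul hexp ?_
    exact (hfd.comp hmap hmaps).clm_comp continuousOn_const
  have key := hasFDerivAt_intervalIntegral_of_continuousOn (𝕜 := ℝ) (E := ℝ × ℝ) hΩ 0
    (2 * Real.pi) (F := fun p φ => W (p.1, p.2, φ) * exp (-(I * n * (φ : ℂ))))
    (F' := fun p φ => exp (-(I * n * (φ : ℂ))) • (fderiv ℝ W (p.1, p.2, φ)).comp ι)
    ((hW.continuousOn.comp hmap hmaps).mul hexp) hF' (fun p hp φ => ?_) hp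
  · have hslice : Continuous fun φ : ℝ => exp (-(I * n * (φ : ℂ))) •
        (fderiv ℝ W (x, r, φ)).comp ι := by
      refine continuousOn_univ.1 (hF'.comp (f := fun φ : ℝ => ((x, r), φ)) (by fun_prop)
        (fun φ _ => ⟨hp, mem_univ _⟩))
    refine ⟨_, key.const_mul (1 / (2 * Real.pi) : ℂ), ?_, ?_⟩
    all_goals
      rw [smul_apply,
        ContinuousLinearMap.intervalIntegral_apply (hslice.intervalIntegrable _ _), angularMode,
        smul_eq_mul]
      congr 1
      refine intervalIntegral.integral_congr fun φ _ => ?_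
      simp [ι, mul_comm]
  · have h1 : HasFDerivAt W (fderiv ℝ W (p.1, p.2, φ)) (p.1, p.2, φ) :=
      ((hW.contDiffAt (hopen.mem_nhds hp)).differentiableAt one_ne_zero).hasFDerivAt
    have h2 : HasFDerivAt (fun p : ℝ × ℝ => (p.1, p.2, φ)) ι p :=
      hasFDerivAt_fst.prodMk (hasFDerivAt_snd.prodMk (hasFDerivAt_const φ p))
    exact (HasFDerivAt.comp p h1 h2).mul_const _

/-- This is the Cauchy–Schwarz inequality, obtained from the nonnegativity of the variance of `‖W‖`
over the circle. It carries the energy bound from the field to its modes. -/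
theorem sq_norm_angularMode_le {W : ℝ × ℝ × ℝ → ℂ} (n : ℤ) (x r : ℝ)
    (hW : Continuous fun φ : ℝ => W (x, r, φ)) :
    ‖angularMode n W x r‖ ^ 2
      ≤ 1 / (2 * Real.pi) * ∫ φ in (0 : ℝ)..(2 * Real.pi), ‖W (x, r, φ)‖ ^ 2 := by
  have hpi := Real.pi_pos
  have hle : (0 : ℝ) ≤ 2 * Real.pi := by positivity
  set t := 1 / (2 * Real.pi) * ∫ φ in (0 : ℝ)..(2 * Real.pi), ‖W (x, r, φ)‖ with ht
  have h1 : ‖angularMode n W x r‖ ≤ t := by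
    rw [angularMode, norm_mul, ht]
    refine mul_le_mul (by simp [abs_of_pos hpi]) ?_ (norm_nonneg _) (by positivity)
    refine (intervalIntegral.norm_integral_le_integral_norm hle).trans_eq ?_
    refine intervalIntegral.integral_congr fun φ _ => ?_
    simp only [norm_mul, norm_exp_angular, mul_one]
  have hi1 : IntervalIntegrable (fun φ => ‖W (x, r, φ)‖ ^ 2) volume 0 (2 * Real.pi) :=
    (hW.norm.pow 2).intervalIntegrable _ _
  have hi2 : IntervalIntegrable (fun φ => ‖W (x, r, φ)‖) volume 0 (2 * Real.pi) :=
    hW.norm.intervalIntegrable _ _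
  have h2 : 0 ≤ ∫ φ in (0 : ℝ)..(2 * Real.pi), (‖W (x, r, φ)‖ - t) ^ 2 :=
    intervalIntegral.integral_nonneg hle fun φ _ => sq_nonneg _
  have h3 : ∫ φ in (0 : ℝ)..(2 * Real.pi), (‖W (x, r, φ)‖ - t) ^ 2
      = (∫ φ in (0 : ℝ)..(2 * Real.pi), ‖W (x, r, φ)‖ ^ 2)
        - 2 * t * (∫ φ in (0 : ℝ)..(2 * Real.pi), ‖W (x, r, φ)‖) + 2 * Real.pi * t ^ 2 := by
    have : ∀ φ : ℝ, (‖W (x, r, φ)‖ - t) ^ 2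
        = ‖W (x, r, φ)‖ ^ 2 - 2 * t * ‖W (x, r, φ)‖ + t ^ 2 := fun φ => by ring
    simp only [this]
    rw [intervalIntegral.integral_add (hi1.sub (hi2.const_mul _)) intervalIntegrable_const,
      intervalIntegral.integral_sub hi1 (hi2.const_mul _), intervalIntegral.integral_const_mul,
      intervalIntegral.integral_const, sub_zero, smul_eq_mul]
  have h4 : (∫ φ in (0 : ℝ)..(2 * Real.pi), ‖W (x, r, φ)‖) = 2 * Real.pi * t := by
    rw [ht]; field_simp
  rw [h3, h4] at h2
  calc ‖angularMode n W x r‖ ^ 2 ≤ t ^ 2 := by gcongr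
    _ = 1 / (2 * Real.pi) * (2 * Real.pi * t ^ 2) := by field_simp
    _ ≤ _ := by gcongr; linarith

/-- An angular mode `v` of a field in the exterior of the body, with its radial derivative `vr` and
the initial values `v₀`. -/
structure IsFieldMode (k : ℂ) (n : ℤ) (X₁ : ℝ) (X₂ : EReal) (f : ℝ → ℝ) (v₀ : ℝ → ℂ)
    (v vr : ℝ → ℝ → ℂ) : Prop where
  continuousOn : ContinuousOn (fun p : ℝ × ℝ => v p.1 p.2) (rearExterior X₁ X₂ f)
  continuousOn_dr : ContinuousOn (fun p : ℝ × ℝ => vr p.1 p.2) (rearExterior X₁ X₂ f)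
  differentiableAt : ∀ x r : ℝ, X₁ < x → (x, r) ∈ planarExterior X₁ X₂ f →
    DifferentiableAt ℝ (fun p : ℝ × ℝ => v p.1 p.2) (x, r)
  differentiableAt_dr : ∀ x r : ℝ, X₁ < x → (x, r) ∈ planarExterior X₁ X₂ f →
    DifferentiableAt ℝ (fun p : ℝ × ℝ => vr p.1 p.2) (x, r)
  hasDerivAt : ∀ x r : ℝ, X₁ < x → (x, r) ∈ planarExterior X₁ X₂ f →
    HasDerivAt (fun r => v x r) (vr x r) r
  equation : ∀ x r : ℝ, X₁ < x → (x, r) ∈ planarExterior X₁ X₂ f →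
    deriv (fun x => v x r) x + 1 / (2 * I * k) * (deriv (fun r => vr x r) r
      + 1 / (r : ℂ) * vr x r - (n : ℂ) ^ 2 / (r : ℂ) ^ 2 * v x r) = 0
  neumann : ∀ x : ℝ, X₁ < x → (x : EReal) < X₂ →
    vr x (f x) = I * k * ((deriv f x : ℝ) : ℂ) * v x (f x)
  initial : ∀ r : ℝ, 0 < r → v X₁ r = v₀ r
  growth : ∀ b : ℝ, (b : EReal) < X₂ → ∃ C B R : ℝ, 0 ≤ C ∧ 0 ≤ B ∧ ∀ x r : ℝ,
    (x, r) ∈ planarExterior X₁ X₂ f → x ≤ b → R ≤ r → ‖v x r‖ ≤ C * Real.exp (B * r)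
  meixner : ∀ b R : ℝ, (b : EReal) < X₂ → IntegrableOn
    (fun p : ℝ × ℝ => (‖vr p.1 p.2‖ ^ 2 + ‖v p.1 p.2‖ ^ 2) * p.2)
    {p : ℝ × ℝ | p ∈ planarExterior X₁ X₂ f ∧ X₁ < p.1 ∧ p.1 < b ∧ p.2 < R}


/-! ### The angular modes of a total field -/

/-- A function of `x`, `r`, `φ` as a function on the product space. -/
def uncurriedField (u : ℝ → ℝ → ℝ → ℂ) (q : ℝ × ℝ × ℝ) : ℂ := u q.1 q.2.1 q.2.2

/-- The radial derivative of a field in the exterior of the body, one-sided on the surface. -/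
def radialDerivative (f : ℝ → ℝ) (u : ℝ → ℝ → ℝ → ℂ) (q : ℝ × ℝ × ℝ) : ℂ :=
  derivWithin (fun s : ℝ => u q.1 s q.2.2) (Ici (f q.1)) q.2.1

theorem radialDerivative_eq_deriv {f : ℝ → ℝ} (u : ℝ → ℝ → ℝ → ℂ) {x r : ℝ} (h : f x < r)
    (φ : ℝ) : radialDerivative f u (x, r, φ) = deriv (fun s : ℝ => u x s φ) r :=
  derivWithin_of_mem_nhds (Ici_mem_nhds h)

theorem continuous_exp_angular (n : ℤ) : Continuous fun φ : ℝ => exp (-(I * n * (φ : ℂ))) := by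
  fun_prop

namespace IsTotalField

variable {k : ℂ} {θ : ℝ} {X₁ : ℝ} {X₂ : EReal} {f : ℝ → ℝ} {u : ℝ → ℝ → ℝ → ℂ}

theorem contDiffAt (hf : IsBodyProfile X₁ X₂ f) (hu : IsTotalField k θ X₁ X₂ f u)
    {q : ℝ × ℝ × ℝ} (hq : q ∈ bodyExterior X₁ X₂ f) : ContDiffAt ℝ 2 (uncurriedField u) q :=
  hu.smooth.contDiffAt (hf.isOpen_bodyExterior.mem_nhds hq)

theorem hasFDerivAt (hf : IsBodyProfile X₁ X₂ f) (hu : IsTotalField k θ X₁ X₂ f u)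
    {q : ℝ × ℝ × ℝ} (hq : q ∈ bodyExterior X₁ X₂ f) :
    HasFDerivAt (uncurriedField u) (fderiv ℝ (uncurriedField u) q) q :=
  ((hu.contDiffAt hf hq).differentiableAt (by norm_num)).hasFDerivAt

theorem contDiffOn_fderiv (hf : IsBodyProfile X₁ X₂ f) (hu : IsTotalField k θ X₁ X₂ f u)
    (w : ℝ × ℝ × ℝ) :
    ContDiffOn ℝ 1 (fun q => fderiv ℝ (uncurriedField u) q w) (bodyExterior X₁ X₂ f) :=
  (ContDiffOn.fderiv_of_isOpen (f := uncurriedField u) hu.smooth hf.isOpen_bodyExterior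
    (by norm_num : (1 : WithTop ℕ∞) + 1 ≤ 2)).clm_apply contDiffOn_const

theorem _root_.HasFDerivAt.hasDerivAt_fst {W : ℝ × ℝ × ℝ → ℂ} {L : ℝ × ℝ × ℝ →L[ℝ] ℂ}
    {x r φ : ℝ} (h : HasFDerivAt W L (x, r, φ)) :
    HasDerivAt (fun t => W (t, r, φ)) (L (1, 0, 0)) x :=
  h.comp_hasDerivAt (f := fun t : ℝ => (t, r, φ)) x
    ((hasDerivAt_id x).prodMk ((hasDerivAt_const x r).prodMk (hasDerivAt_const x φ)))

theorem _root_.HasFDerivAt.hasDerivAt_snd {W : ℝ × ℝ × ℝ → ℂ} {L : ℝ × ℝ × ℝ →L[ℝ] ℂ}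
    {x r φ : ℝ} (h : HasFDerivAt W L (x, r, φ)) :
    HasDerivAt (fun s => W (x, s, φ)) (L (0, 1, 0)) r :=
  h.comp_hasDerivAt (f := fun s : ℝ => (x, s, φ)) r
    ((hasDerivAt_const r x).prodMk ((hasDerivAt_id r).prodMk (hasDerivAt_const r φ)))

theorem _root_.HasFDerivAt.hasDerivAt_thd {W : ℝ × ℝ × ℝ → ℂ} {L : ℝ × ℝ × ℝ →L[ℝ] ℂ}
    {x r φ : ℝ} (h : HasFDerivAt W L (x, r, φ)) :
    HasDerivAt (fun ψ => W (x, r, ψ)) (L (0, 0, 1)) φ :=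
  h.comp_hasDerivAt (f := fun ψ : ℝ => (x, r, ψ)) φ
    ((hasDerivAt_const φ x).prodMk ((hasDerivAt_const φ r).prodMk (hasDerivAt_id φ)))

theorem hasFDerivAt_fderiv (hf : IsBodyProfile X₁ X₂ f) (hu : IsTotalField k θ X₁ X₂ f u)
    (w : ℝ × ℝ × ℝ) {q : ℝ × ℝ × ℝ} (hq : q ∈ bodyExterior X₁ X₂ f) :
    HasFDerivAt (fun q => fderiv ℝ (uncurriedField u) q w)
      (fderiv ℝ (fun q => fderiv ℝ (uncurriedField u) q w) q) q :=
  (((hu.contDiffOn_fderiv hf w).contDiffAt (hf.isOpen_bodyExterior.mem_nhds hq)).differentiableAt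
    one_ne_zero).hasFDerivAt

theorem continuous_angle {W : ℝ × ℝ × ℝ → ℂ}
    (hW : ContinuousOn W (bodyExterior X₁ X₂ f)) {x r : ℝ} (hp : (x, r) ∈ planarExterior X₁ X₂ f) :
    Continuous fun φ : ℝ => W (x, r, φ) :=
  hW.comp_continuous (by fun_prop) fun _ => hp

/-- The parabolic equation in terms of Fréchet derivatives. -/
theorem equation_fderiv (hf : IsBodyProfile X₁ X₂ f) (hu : IsTotalField k θ X₁ X₂ f u)
    {x r : ℝ} (hp : (x, r) ∈ planarExterior X₁ X₂ f) (φ : ℝ) :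
    fderiv ℝ (uncurriedField u) (x, r, φ) (1, 0, 0) + 1 / (2 * I * k) *
      (fderiv ℝ (fun q => fderiv ℝ (uncurriedField u) q (0, 1, 0)) (x, r, φ) (0, 1, 0)
        + 1 / (r : ℂ) * fderiv ℝ (uncurriedField u) (x, r, φ) (0, 1, 0)
        + 1 / (r : ℂ) ^ 2 *
          fderiv ℝ (fun q => fderiv ℝ (uncurriedField u) q (0, 0, 1)) (x, r, φ) (0, 0, 1)) = 0 := by
  have hmem : ∀ ψ : ℝ, (x, r, ψ) ∈ bodyExterior X₁ X₂ f := fun _ => hp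
  have hr : (r : ℂ) ≠ 0 := by exact_mod_cast hp.2.1.ne'
  have e := hu.equation x r φ hp
  have e1 : deriv (fun t : ℝ => u t r φ) x = fderiv ℝ (uncurriedField u) (x, r, φ) (1, 0, 0) :=
    (hu.hasFDerivAt hf (hmem φ)).hasDerivAt_fst.deriv
  have e2 : deriv (fun s : ℝ => (s : ℂ) * deriv (fun t : ℝ => u x t φ) s) r
      = fderiv ℝ (uncurriedField u) (x, r, φ) (0, 1, 0) + r *
        fderiv ℝ (fun q => fderiv ℝ (uncurriedField u) q (0, 1, 0)) (x, r, φ) (0, 1, 0) := by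
    have hev : (fun s : ℝ => (s : ℂ) * deriv (fun t : ℝ => u x t φ) s) =ᶠ[nhds r]
        fun s : ℝ => (s : ℂ) * fderiv ℝ (uncurriedField u) (x, s, φ) (0, 1, 0) := by
      have : ∀ᶠ s in nhds r, (x, s, φ) ∈ bodyExterior X₁ X₂ f :=
        (Continuous.continuousAt (f := fun s : ℝ => (x, s, φ)) (by fun_prop)).eventually
          (hf.isOpen_bodyExterior.mem_nhds (hmem φ))
      filter_upwards [this] with s hs
      congr 1
      exact (hu.hasFDerivAt hf hs).hasDerivAt_snd.deriv
    rw [hev.deriv_eq]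
    have h1 : HasDerivAt (fun s : ℝ => (s : ℂ)) 1 r := (hasDerivAt_id r).ofReal_comp
    have h2 := h1.fun_mul (hu.hasFDerivAt_fderiv hf (0, 1, 0) (hmem φ)).hasDerivAt_snd
    rw [h2.deriv, one_mul]
  have e3 : deriv (deriv (fun ψ : ℝ => u x r ψ)) φ
      = fderiv ℝ (fun q => fderiv ℝ (uncurriedField u) q (0, 0, 1)) (x, r, φ) (0, 0, 1) := by
    have hev : deriv (fun ψ : ℝ => u x r ψ)
        = fun ψ => fderiv ℝ (uncurriedField u) (x, r, ψ) (0, 0, 1) :=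
      funext fun ψ => (hu.hasFDerivAt hf (hmem ψ)).hasDerivAt_thd.deriv
    rw [hev]
    exact (hu.hasFDerivAt_fderiv hf (0, 0, 1) (hmem φ)).hasDerivAt_thd.deriv
  rw [transversalLaplacian, e1, e2, e3] at e
  rw [← e]
  field_simp
  ring

/-- The angular part of the Laplacian acts on the `n`-th mode as multiplication by `-n²`. -/
theorem angularMode_second_derivative (hf : IsBodyProfile X₁ X₂ f)
    (hu : IsTotalField k θ X₁ X₂ f u) (n : ℤ) {x r : ℝ} (hp : (x, r) ∈ planarExterior X₁ X₂ f) :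
    angularMode n (fun q => fderiv ℝ (fun q => fderiv ℝ (uncurriedField u) q (0, 0, 1)) q (0, 0, 1))
      x r = -(n : ℂ) ^ 2 * angularMode n (uncurriedField u) x r := by
  have hmem : ∀ ψ : ℝ, (x, r, ψ) ∈ bodyExterior X₁ X₂ f := fun _ => hp
  set U := uncurriedField u
  set U' : ℝ × ℝ × ℝ → ℂ := fun q => fderiv ℝ U q (0, 0, 1)
  set U'' : ℝ × ℝ × ℝ → ℂ := fun q => fderiv ℝ U' q (0, 0, 1)
  have hc : Continuous fun φ : ℝ => U (x, r, φ) := continuous_angle hu.smooth.continuousOn hp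
  have hc'' : Continuous fun φ : ℝ => U'' (x, r, φ) :=
    continuous_angle (((hu.contDiffOn_fderiv hf (0, 0, 1)).continuousOn_fderiv_of_isOpen
      hf.isOpen_bodyExterior le_rfl).clm_apply continuousOn_const) hp
  -- This primitive performs both integrations by parts at once; the periodicity of the field and of
  -- its angular derivative cancels the boundary values.
  have hd : ∀ φ : ℝ, HasDerivAt (fun φ : ℝ => (U' (x, r, φ) + I * n * U (x, r, φ))
      * exp (-(I * n * (φ : ℂ))))
      (U'' (x, r, φ) * exp (-(I * n * (φ : ℂ)))
        + (n : ℂ) ^ 2 * (U (x, r, φ) * exp (-(I * n * (φ : ℂ))))) φ := by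
    intro φ
    have h1 := (hu.hasFDerivAt_fderiv hf (0, 0, 1) (hmem φ)).hasDerivAt_thd
    have h2 := (hu.hasFDerivAt hf (hmem φ)).hasDerivAt_thd
    have hi : HasDerivAt (fun φ : ℝ => (φ : ℂ)) 1 φ := (hasDerivAt_id φ).ofReal_comp
    refine ((h1.fun_add (h2.const_mul (I * (n : ℂ)))).fun_mul
      (hi.const_mul (I * (n : ℂ))).fun_neg.cexp).congr_deriv ?_
    simp only [U'', U', U]
    ring_nf
    simp only [I_sq]
    ring
  have hper : ∀ φ, U (x, r, φ + 2 * Real.pi) = U (x, r, φ) := fun φ => hu.periodic x r φ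
  have hper' : U' (x, r, 2 * Real.pi) = U' (x, r, 0) := by
    have h2 := (hu.hasFDerivAt hf (hmem (0 + 2 * Real.pi))).hasDerivAt_thd
    have h3 := h2.comp_add_const 0 (2 * Real.pi)
    simp only [zero_add] at h3
    have h4 := (hu.hasFDerivAt hf (hmem 0)).hasDerivAt_thd
    exact h3.unique (h4.congr_of_eventuallyEq (Filter.Eventually.of_forall hper))
  have i1 := hc''.fun_mul (continuous_exp_angular n)
  have i2 := (hc.fun_mul (continuous_exp_angular n)).const_mul ((n : ℂ) ^ 2)
  have key := intervalIntegral.integral_eq_sub_of_hasDerivAt (a := 0) (b := 2 * Real.pi)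
    (fun φ _ => hd φ) ((i1.fun_add i2).intervalIntegrable _ _)
  have hper0 := hper 0
  rw [zero_add] at hper0
  rw [exp_neg_int_mul_two_pi, hper', hper0, intervalIntegral.integral_add
    (i1.intervalIntegrable _ _) (i2.intervalIntegrable _ _),
    intervalIntegral.integral_const_mul] at key
  simp only [ofReal_zero, mul_zero, neg_zero, Complex.exp_zero, sub_self] at key
  rw [angularMode, angularMode]
  linear_combination (1 / (2 * Real.pi) : ℂ) * key

theorem _root_.angularMode_const_mul (n : ℤ) (c : ℂ) (W : ℝ × ℝ × ℝ → ℂ) (x r : ℝ) :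
    angularMode n (fun q => c * W q) x r = c * angularMode n W x r := by
  simp only [angularMode, mul_assoc c, intervalIntegral.integral_const_mul]
  ring

theorem _root_.angularMode_add (n : ℤ) {W V : ℝ × ℝ × ℝ → ℂ} {x r : ℝ}
    (hW : Continuous fun φ : ℝ => W (x, r, φ)) (hV : Continuous fun φ : ℝ => V (x, r, φ)) :
    angularMode n (fun q => W q + V q) x r = angularMode n W x r + angularMode n V x r := by
  simp only [angularMode, add_mul]
  rw [intervalIntegral.integral_add ((hW.fun_mul (continuous_exp_angular n)).intervalIntegrable _ _)
    ((hV.fun_mul (continuous_exp_angular n)).intervalIntegrable _ _)]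
  ring

/-- The pointwise equation is integrated against `e^{-inφ}`, and the angular second derivative
becomes the factor `-n²`. -/
theorem angularMode_equation (hf : IsBodyProfile X₁ X₂ f)
    (hu : IsTotalField k θ X₁ X₂ f u) (n : ℤ) {x r : ℝ} (hp : (x, r) ∈ planarExterior X₁ X₂ f) :
    angularMode n (fun q => fderiv ℝ (uncurriedField u) q (1, 0, 0)) x r + 1 / (2 * I * k) *
      (angularMode n (fun q => fderiv ℝ
          (fun q => fderiv ℝ (uncurriedField u) q (0, 1, 0)) q (0, 1, 0)) x r
        + 1 / (r : ℂ) * angularMode n (fun q => fderiv ℝ (uncurriedField u) q (0, 1, 0)) x r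
        - (n : ℂ) ^ 2 / (r : ℂ) ^ 2 * angularMode n (uncurriedField u) x r) = 0 := by
  have c1 : ∀ w, Continuous fun φ : ℝ => fderiv ℝ (uncurriedField u) (x, r, φ) w := fun w =>
    continuous_angle (hu.contDiffOn_fderiv hf w).continuousOn hp
  have c2 : ∀ w, Continuous fun φ : ℝ =>
      fderiv ℝ (fun q => fderiv ℝ (uncurriedField u) q w) (x, r, φ) w := fun w =>
    continuous_angle (((hu.contDiffOn_fderiv hf w).continuousOn_fderiv_of_isOpen
      hf.isOpen_bodyExterior le_rfl).clm_apply continuousOn_const) hp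
  have h0 : angularMode n (fun q => fderiv ℝ (uncurriedField u) q (1, 0, 0) + 1 / (2 * I * k) *
      (fderiv ℝ (fun q => fderiv ℝ (uncurriedField u) q (0, 1, 0)) q (0, 1, 0)
        + 1 / (r : ℂ) * fderiv ℝ (uncurriedField u) q (0, 1, 0)
        + 1 / (r : ℂ) ^ 2 *
          fderiv ℝ (fun q => fderiv ℝ (uncurriedField u) q (0, 0, 1)) q (0, 0, 1))) x r = 0 := by
    simp only [angularMode, hu.equation_fderiv hf hp, zero_mul, intervalIntegral.integral_zero,
      mul_zero]
  have a1 := (c1 (0, 1, 0)).const_mul (1 / (r : ℂ))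
  have a2 := (c2 (0, 0, 1)).const_mul (1 / (r : ℂ) ^ 2)
  have a3 := (c2 (0, 1, 0)).fun_add a1
  rw [angularMode_add n (c1 (1, 0, 0)) ((a3.fun_add a2).const_mul _), angularMode_const_mul,
    angularMode_add n a3 a2, angularMode_add n (c2 (0, 1, 0)) a1,
    angularMode_const_mul, angularMode_const_mul, hu.angularMode_second_derivative hf n hp] at h0
  rw [← h0]
  ring

theorem continuousOn_angularMode {S : Set (ℝ × ℝ)} {W : ℝ × ℝ × ℝ → ℂ} (n : ℤ)
    (hW : ContinuousOn W {q | (q.1, q.2.1) ∈ S}) :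
    ContinuousOn (fun p : ℝ × ℝ => angularMode n W p.1 p.2) S := by
  have h1 : ContinuousOn (fun q : (ℝ × ℝ) × ℝ => W (q.1.1, q.1.2, q.2)) (S ×ˢ univ) :=
    hW.comp (f := fun q : (ℝ × ℝ) × ℝ => (q.1.1, q.1.2, q.2)) (by fun_prop) fun q hq => hq.1
  have h2 : ContinuousOn (fun q : (ℝ × ℝ) × ℝ => exp (-(I * n * (q.2 : ℂ)))) (S ×ˢ univ) :=
    Continuous.continuousOn (by fun_prop)
  have h3 : ContinuousOn (fun p : ℝ × ℝ => ∫ φ in (0 : ℝ)..(2 * Real.pi),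
      W (p.1, p.2, φ) * exp (-(I * n * (φ : ℂ)))) S :=
    continuousOn_intervalIntegral_of_continuousOn 0 (2 * Real.pi)
      (F := fun (p : ℝ × ℝ) φ => W (p.1, p.2, φ) * exp (-(I * n * (φ : ℂ)))) (h1.fun_mul h2)
  simp only [angularMode]
  exact continuousOn_const.fun_mul h3

/-- A function which is continuous in the exterior and up to the surface is continuous on the
rear part of the closed exterior without the tip. -/
theorem continuousOn_rear (hf : IsBodyProfile X₁ X₂ f) {W V : ℝ × ℝ × ℝ → ℂ}
    (h1 : ContinuousOn W (closedBodyExterior X₁ X₂ f))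
    (h2 : ContinuousOn V (bodyExterior X₁ X₂ f))
    (h : ∀ q ∈ bodyExterior X₁ X₂ f, X₁ ≤ q.1 → W q = V q) :
    ContinuousOn W {q | (q.1, q.2.1) ∈ rearExterior X₁ X₂ f} := by
  rintro q ⟨hq1, hq2, hq3, hq4⟩
  simp only at hq1 hq2 hq3 hq4
  by_cases hq : q ∈ bodyExterior X₁ X₂ f
  · have hc := (h2.continuousAt (hf.isOpen_bodyExterior.mem_nhds hq)).continuousWithinAt
      (s := {q : ℝ × ℝ × ℝ | (q.1, q.2.1) ∈ rearExterior X₁ X₂ f})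
    refine hc.congr_of_eventuallyEq ?_ (h q hq hq1)
    filter_upwards [mem_nhdsWithin_of_mem_nhds (hf.isOpen_bodyExterior.mem_nhds hq),
      self_mem_nhdsWithin] with p hp hp'
    exact h p hp hp'.1
  · have hX : X₁ < q.1 := by
      rcases hq1.eq_or_lt with he | hlt
      · exfalso
        refine hq ⟨hq2, hq3, fun _ => ?_⟩
        rw [← he, hf.tip]; exact hq3
      · exact hlt
    refine (h1 q ⟨hX, hq2, hq4⟩).mono_of_mem_nhdsWithin ?_
    have : {p : ℝ × ℝ × ℝ | X₁ < p.1} ∈ nhds q :=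
      (isOpen_lt continuous_const continuous_fst).mem_nhds hX
    filter_upwards [mem_nhdsWithin_of_mem_nhds this, self_mem_nhdsWithin] with p hp hp'
    exact ⟨hp, hp'.2.1, hp'.2.2.2⟩

theorem norm_incidentField (k : ℂ) (θ x r φ : ℝ) :
    ‖incidentField k θ x r φ‖ = Real.exp (-(k.im * (θ * r * Real.cos φ - x * θ ^ 2 / 2))) := by
  rw [incidentField, norm_exp, re_mul_ofReal]
  simp

end IsTotalField


/-! ### Growth, energy and initial values of the modes -/

namespace IsTotalField

variable {k : ℂ} {θ : ℝ} {X₁ : ℝ} {X₂ : EReal} {f : ℝ → ℝ} {u : ℝ → ℝ → ℝ → ℂ}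

theorem radialDerivative_eq_fderiv (hf : IsBodyProfile X₁ X₂ f) (hu : IsTotalField k θ X₁ X₂ f u)
    {q : ℝ × ℝ × ℝ} (hq : q ∈ bodyExterior X₁ X₂ f) (hx : X₁ ≤ q.1) :
    radialDerivative f u q = fderiv ℝ (uncurriedField u) q (0, 1, 0) := by
  obtain ⟨x, r, φ⟩ := q
  rw [radialDerivative_eq_deriv u (hq.2.2 hx)]
  exact (hu.hasFDerivAt hf hq).hasDerivAt_snd.deriv

/-- Far from the axis the scattered field is at most `1` by the radiation condition, and the
incident wave is at most a constant times `e^{Im k |θ| r}`; for `θ ≠ 0` it does grow in some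
directions. -/
theorem growth (hk : 0 < k.im) (hu : IsTotalField k θ X₁ X₂ f u) (n : ℤ) (b : ℝ)
    (hb : (b : EReal) < X₂) : ∃ C B R : ℝ, 0 ≤ C ∧ 0 ≤ B ∧ ∀ x r : ℝ,
      (x, r) ∈ planarExterior X₁ X₂ f → x ≤ b → R ≤ r →
        ‖angularMode n (uncurriedField u) x r‖ ≤ C * Real.exp (B * r) := by
  obtain ⟨R, hR⟩ := hu.radiation b hb 1 one_pos
  have hpi := Real.pi_pos
  refine ⟨1 + Real.exp (k.im * (b * θ ^ 2 / 2)), k.im * |θ|, R, by positivity, by positivity,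
    fun x r hp hx hr => ?_⟩
  have hr0 : 0 < r := hp.2.1
  have hbound : ∀ φ : ℝ, ‖u x r φ‖
      ≤ (1 + Real.exp (k.im * (b * θ ^ 2 / 2))) * Real.exp (k.im * |θ| * r) := by
    intro φ
    have h1 := hR x r φ hp hx hr
    have h2 : ‖incidentField k θ x r φ‖
        ≤ Real.exp (k.im * (b * θ ^ 2 / 2)) * Real.exp (k.im * |θ| * r) := by
      rw [norm_incidentField, ← Real.exp_add]
      gcongr
      have h3 : -(θ * r * Real.cos φ) ≤ |θ| * r := by
        calc -(θ * r * Real.cos φ) ≤ |θ * r * Real.cos φ| := neg_le_abs _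
          _ = |θ| * r * |Real.cos φ| := by rw [abs_mul, abs_mul, abs_of_pos hr0]
          _ ≤ |θ| * r * 1 := by gcongr; exact Real.abs_cos_le_one φ
          _ = _ := mul_one _
      have h4 : x * θ ^ 2 / 2 ≤ b * θ ^ 2 / 2 := by gcongr
      nlinarith
    calc ‖u x r φ‖ = ‖(u x r φ - incidentField k θ x r φ) + incidentField k θ x r φ‖ := by
          rw [sub_add_cancel]
      _ ≤ 1 + Real.exp (k.im * (b * θ ^ 2 / 2)) * Real.exp (k.im * |θ| * r) :=
          (norm_add_le _ _).trans (add_le_add h1 h2)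
      _ ≤ 1 * Real.exp (k.im * |θ| * r)
          + Real.exp (k.im * (b * θ ^ 2 / 2)) * Real.exp (k.im * |θ| * r) := by
          rw [one_mul]; gcongr; exact Real.one_le_exp (by positivity)
      _ = _ := by ring
  rw [angularMode, norm_mul]
  have h5 := intervalIntegral.norm_integral_le_of_norm_le_const (a := 0) (b := 2 * Real.pi)
    (f := fun φ : ℝ => uncurriedField u (x, r, φ) * exp (-(I * n * (φ : ℂ))))
    (C := (1 + Real.exp (k.im * (b * θ ^ 2 / 2))) * Real.exp (k.im * |θ| * r))
    (fun φ _ => by rw [norm_mul, norm_exp_angular, mul_one]; exact hbound φ)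
  rw [sub_zero, abs_of_pos (show 0 < 2 * Real.pi by positivity)] at h5
  calc _ ≤ 1 / (2 * Real.pi) * ((1 + Real.exp (k.im * (b * θ ^ 2 / 2)))
        * Real.exp (k.im * |θ| * r) * (2 * Real.pi)) := by
        refine mul_le_mul (by simp [abs_of_pos hpi]) h5 (norm_nonneg _) (by positivity)
    _ = _ := by field_simp

theorem isOpen_meixner_domain (hf : IsBodyProfile X₁ X₂ f) (b R : ℝ) :
    IsOpen {p : ℝ × ℝ | p ∈ planarExterior X₁ X₂ f ∧ X₁ < p.1 ∧ p.1 < b ∧ p.2 < R} :=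
  hf.isOpen_planarExterior.inter ((isOpen_lt continuous_const continuous_fst).inter
    ((isOpen_lt continuous_fst continuous_const).inter
      (isOpen_lt continuous_snd continuous_const)))

theorem rear_subset (b R : ℝ) :
    {p : ℝ × ℝ | p ∈ planarExterior X₁ X₂ f ∧ X₁ < p.1 ∧ p.1 < b ∧ p.2 < R}
      ⊆ rearExterior X₁ X₂ f :=
  fun _ hp => ⟨hp.2.1.le, hp.1.1, hp.1.2.1, (hp.1.2.2 hp.2.1.le).le⟩

/-- Fubini's theorem gives integrability of the angular mean of the energy density, and
Cauchy–Schwarz on each circle bounds the energy of the mode by it; the angular derivative is simply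
dropped. -/
theorem meixner_mode (hf : IsBodyProfile X₁ X₂ f) (hu : IsTotalField k θ X₁ X₂ f u) (n : ℤ)
    (hc : ContinuousOn (fun p : ℝ × ℝ => angularMode n (uncurriedField u) p.1 p.2)
      (rearExterior X₁ X₂ f))
    (hcr : ContinuousOn (fun p : ℝ × ℝ => angularMode n (radialDerivative f u) p.1 p.2)
      (rearExterior X₁ X₂ f)) (b R : ℝ) (hb : (b : EReal) < X₂) :
    IntegrableOn (fun p : ℝ × ℝ => (‖angularMode n (radialDerivative f u) p.1 p.2‖ ^ 2
        + ‖angularMode n (uncurriedField u) p.1 p.2‖ ^ 2) * p.2)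
      {p : ℝ × ℝ | p ∈ planarExterior X₁ X₂ f ∧ X₁ < p.1 ∧ p.1 < b ∧ p.2 < R} := by
  set A := {p : ℝ × ℝ | p ∈ planarExterior X₁ X₂ f ∧ X₁ < p.1 ∧ p.1 < b ∧ p.2 < R} with hA
  have hpi := Real.pi_pos
  have hAo : IsOpen A := isOpen_meixner_domain hf b R
  have hsub : A ⊆ rearExterior X₁ X₂ f := rear_subset b R
  set H : ℝ × ℝ × ℝ → ℝ := fun p => (‖deriv (fun s : ℝ => u p.1 s p.2.2) p.2.1‖ ^ 2
        + ‖(1 / (p.2.1 : ℂ)) * deriv (fun ψ : ℝ => u p.1 p.2.1 ψ) p.2.2‖ ^ 2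
        + ‖u p.1 p.2.1 p.2.2‖ ^ 2) * p.2.1 with hH
  have h0 := hu.meixner X₁ b R hb
  have h1 : IntegrableOn (fun q : (ℝ × ℝ) × ℝ => H (q.1.1, q.1.2, q.2))
      (A ×ˢ Ioo 0 (2 * Real.pi)) := by
    -- The coordinates are regrouped as `((x, r), φ)` so that `φ` can be integrated out.
    have hmp := MeasureTheory.volume_preserving_prodAssoc (α₁ := ℝ) (β₁ := ℝ) (γ₁ := ℝ)
    have := (hmp.integrableOn_comp_preimage
      (MeasurableEquiv.prodAssoc (α := ℝ) (β := ℝ) (γ := ℝ)).measurableEmbedding).2 h0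
    refine this.mono_set ?_
    rintro ⟨⟨x, r⟩, φ⟩ ⟨⟨h1, h2, h3, h4⟩, h5, h6⟩
    exact ⟨h1, h2, h3, h4, h5, h6⟩
  have h2 : IntegrableOn (fun p : ℝ × ℝ => ∫ φ in Ioo 0 (2 * Real.pi), H (p.1, p.2, φ)) A := by
    rw [IntegrableOn, Measure.volume_eq_prod, ← Measure.prod_restrict] at h1
    exact h1.integral_prod_left
  refine (h2.const_mul (1 / (2 * Real.pi))).mono' ?_ ?_
  · refine ContinuousOn.aestronglyMeasurable ?_ hAo.measurableSet
    exact ((((hcr.mono hsub).norm.pow 2).add ((hc.mono hsub).norm.pow 2)).mul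
      continuousOn_snd)
  · rw [ae_restrict_iff' hAo.measurableSet]
    refine Filter.Eventually.of_forall fun p hp => ?_
    obtain ⟨x, r⟩ := p
    have hp' : (x, r) ∈ planarExterior X₁ X₂ f := hp.1
    have hr : 0 < r := hp'.2.1
    have hx : X₁ ≤ x := hp.2.1.le
    have c1 : Continuous fun φ : ℝ => uncurriedField u (x, r, φ) :=
      continuous_angle hu.smooth.continuousOn hp'
    have c2 : Continuous fun φ : ℝ => fderiv ℝ (uncurriedField u) (x, r, φ) (0, 1, 0) :=
      continuous_angle (hu.contDiffOn_fderiv hf (0, 1, 0)).continuousOn hp'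
    have c3 : Continuous fun φ : ℝ => fderiv ℝ (uncurriedField u) (x, r, φ) (0, 0, 1) :=
      continuous_angle (hu.contDiffOn_fderiv hf (0, 0, 1)).continuousOn hp'
    have e2 : ∀ φ : ℝ, radialDerivative f u (x, r, φ)
        = fderiv ℝ (uncurriedField u) (x, r, φ) (0, 1, 0) :=
      fun φ => hu.radialDerivative_eq_fderiv hf hp' hx
    have c4 : Continuous fun φ : ℝ => radialDerivative f u (x, r, φ) := by
      simpa only [e2] using c2
    have eH : ∀ φ : ℝ, H (x, r, φ) = (‖radialDerivative f u (x, r, φ)‖ ^ 2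
        + ‖(1 / (r : ℂ)) * fderiv ℝ (uncurriedField u) (x, r, φ) (0, 0, 1)‖ ^ 2
        + ‖uncurriedField u (x, r, φ)‖ ^ 2) * r := by
      intro φ
      simp only [hH]
      rw [← radialDerivative_eq_deriv u (hp'.2.2 hx),
        show deriv (fun ψ : ℝ => u x r ψ) φ = fderiv ℝ (uncurriedField u) (x, r, φ) (0, 0, 1) from
          (hu.hasFDerivAt hf hp').hasDerivAt_thd.deriv]
      rfl
    have i1 : IntervalIntegrable (fun φ : ℝ => ‖uncurriedField u (x, r, φ)‖ ^ 2) volume 0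
      (2 * Real.pi) := (c1.norm.pow 2).intervalIntegrable _ _
    have i2 : IntervalIntegrable (fun φ : ℝ => ‖radialDerivative f u (x, r, φ)‖ ^ 2) volume 0
      (2 * Real.pi) := (c4.norm.pow 2).intervalIntegrable _ _
    have i3 : IntervalIntegrable (fun φ : ℝ => H (x, r, φ)) volume 0 (2 * Real.pi) := by
      simp only [eH]
      exact ((((c4.norm.pow 2).add ((continuous_const.mul c3).norm.pow 2)).add
        (c1.norm.pow 2)).mul_const r).intervalIntegrable _ _
    have b1 := sq_norm_angularMode_le n x r c1
    have b2 := sq_norm_angularMode_le n x r c4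
    rw [Real.norm_of_nonneg (by positivity), ← integral_Ioc_eq_integral_Ioo,
      ← intervalIntegral.integral_of_le (by positivity)]
    calc _ ≤ (1 / (2 * Real.pi) * (∫ φ in (0 : ℝ)..(2 * Real.pi),
            ‖radialDerivative f u (x, r, φ)‖ ^ 2)
          + 1 / (2 * Real.pi) * ∫ φ in (0 : ℝ)..(2 * Real.pi),
            ‖uncurriedField u (x, r, φ)‖ ^ 2) * r := by
          gcongr
      _ = 1 / (2 * Real.pi) * ∫ φ in (0 : ℝ)..(2 * Real.pi),
          (‖radialDerivative f u (x, r, φ)‖ ^ 2 + ‖uncurriedField u (x, r, φ)‖ ^ 2) * r := by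
          rw [intervalIntegral.integral_mul_const, intervalIntegral.integral_add i2 i1]
          ring
      _ ≤ _ := by
          gcongr
          refine intervalIntegral.integral_mono_on (by positivity) ((i2.add i1).mul_const r) i3
            fun φ _ => ?_
          rw [eH]
          gcongr
          exact le_add_of_nonneg_right (sq_nonneg _)

/-- The angular modes of a total field satisfy the reduced problem. -/
theorem isFieldMode (hf : IsBodyProfile X₁ X₂ f) (hX : (X₁ : EReal) < X₂) (hk : 0 < k.im)
    (hu : IsTotalField k θ X₁ X₂ f u) (n : ℤ) :
    IsFieldMode k n X₁ X₂ f (angularMode n (uncurriedField (incidentField k θ)) X₁)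
      (angularMode n (uncurriedField u)) (angularMode n (radialDerivative f u)) := by
  have hc : ContinuousOn (fun p : ℝ × ℝ => angularMode n (uncurriedField u) p.1 p.2)
      (rearExterior X₁ X₂ f) :=
    continuousOn_angularMode n (continuousOn_rear hf hu.continuous_trace hu.smooth.continuousOn
      fun q _ _ => rfl)
  have hcr : ContinuousOn (fun p : ℝ × ℝ => angularMode n (radialDerivative f u) p.1 p.2)
      (rearExterior X₁ X₂ f) :=
    continuousOn_angularMode n (continuousOn_rear hf hu.radial_continuous
      (hu.contDiffOn_fderiv hf (0, 1, 0)).continuousOn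
      fun q hq hx => hu.radialDerivative_eq_fderiv hf hq hx)
  have hdr : ∀ x r : ℝ, X₁ ≤ x → (x, r) ∈ planarExterior X₁ X₂ f →
      angularMode n (radialDerivative f u) x r
        = angularMode n (fun q => fderiv ℝ (uncurriedField u) q (0, 1, 0)) x r := by
    intro x r hx hp
    have : ∀ φ : ℝ, radialDerivative f u (x, r, φ)
        = fderiv ℝ (uncurriedField u) (x, r, φ) (0, 1, 0) :=
      fun φ => hu.radialDerivative_eq_fderiv hf (q := (x, r, φ)) hp hx
    simp only [angularMode, this]
  have hΩ := hf.isOpen_planarExterior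
  have hev : ∀ x r : ℝ, X₁ < x → (x, r) ∈ planarExterior X₁ X₂ f → ∀ᶠ p : ℝ × ℝ in nhds (x, r),
      angularMode n (radialDerivative f u) p.1 p.2
        = angularMode n (fun q => fderiv ℝ (uncurriedField u) q (0, 1, 0)) p.1 p.2 := by
    intro x r hx hp
    filter_upwards [hΩ.mem_nhds hp,
      (isOpen_lt continuous_const continuous_fst).mem_nhds hx] with p h1 h2
    exact hdr p.1 p.2 (le_of_lt h2) h1
  have hd1 : ∀ x r : ℝ, (x, r) ∈ planarExterior X₁ X₂ f → _ := fun x r hp =>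
    hasFDerivAt_angularMode hΩ (W := uncurriedField u) (hu.smooth.of_le (by norm_num)) n hp
  have hd2 : ∀ x r : ℝ, (x, r) ∈ planarExterior X₁ X₂ f → _ := fun x r hp =>
    hasFDerivAt_angularMode hΩ (hu.contDiffOn_fderiv hf (0, 1, 0)) n hp
  have line_x : ∀ x r : ℝ, HasDerivAt (fun t : ℝ => (t, r)) ((1, 0) : ℝ × ℝ) x := fun x r =>
    (hasDerivAt_id x).prodMk (hasDerivAt_const x r)
  have line_r : ∀ x r : ℝ, HasDerivAt (fun s : ℝ => (x, s)) ((0, 1) : ℝ × ℝ) r := fun x r =>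
    (hasDerivAt_const r x).prodMk (hasDerivAt_id r)
  refine ⟨hc, hcr, fun x r _ hp => ?_, fun x r hx hp => ?_, fun x r hx hp => ?_,
    fun x r hx hp => ?_, fun x hx hx2 => ?_, fun r hr => ?_, hu.growth hk n,
    hu.meixner_mode hf n hc hcr⟩
  · obtain ⟨L, hL, -⟩ := hd1 x r hp
    exact hL.differentiableAt
  · obtain ⟨L, hL, -⟩ := hd2 x r hp
    exact (hL.congr_of_eventuallyEq (hev x r hx hp)).differentiableAt
  · obtain ⟨L, hL, -, h2⟩ := hd1 x r hp
    rw [hdr x r hx.le hp, ← h2]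
    exact hL.comp_hasDerivAt r (line_r x r)
  · obtain ⟨L, hL, h1, -⟩ := hd1 x r hp
    obtain ⟨M, hM, -, h3⟩ := hd2 x r hp
    have d1 := (hL.comp_hasDerivAt x (line_x x r)).deriv
    have d2 := ((hM.congr_of_eventuallyEq (hev x r hx hp)).comp_hasDerivAt r (line_r x r)).deriv
    simp only [Function.comp_def] at d1 d2
    rw [d1, d2, h1, h3, hdr x r hx.le hp]
    exact hu.angularMode_equation hf n hp
  · have : ∀ φ : ℝ, radialDerivative f u (x, f x, φ)
        = I * k * ((deriv f x : ℝ) : ℂ) * uncurriedField u (x, f x, φ) :=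
      fun φ => sub_eq_zero.1 (hu.neumann x φ hx hx2)
    have h2 : angularMode n (radialDerivative f u) x (f x) = angularMode n
        (fun q => I * k * ((deriv f x : ℝ) : ℂ) * uncurriedField u q) x (f x) := by
      simp only [angularMode, this]
    rw [h2, angularMode_const_mul]
  · have hmem : ∀ φ : ℝ, (X₁, r, φ) ∈ bodyExterior X₁ X₂ f := fun φ =>
      ⟨hX, hr, fun _ => by simpa [hf.tip] using hr⟩
    -- The initial condition concerns only `x < X₁`. Points `(X₁, r)` with `r > 0` are interior to
    -- the exterior, so continuity from the left transfers it to the plane of the tip.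
    have : ∀ φ : ℝ, u X₁ r φ = incidentField k θ X₁ r φ := by
      intro φ
      have hcu : ContinuousAt (fun x => u x r φ) X₁ :=
        (hu.hasFDerivAt hf (hmem φ)).hasDerivAt_fst.continuousAt
      have hci : ContinuousAt (fun x => incidentField k θ x r φ) X₁ := by
        unfold incidentField
        fun_prop
      have hev : ∀ᶠ x in nhdsWithin X₁ (Iio X₁), u x r φ = incidentField k θ x r φ := by
        filter_upwards [self_mem_nhdsWithin] with x hx
        refine sub_eq_zero.1 (hu.initial x r φ ⟨?_, hr, fun h => absurd h (not_le.2 hx)⟩ hx)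
        exact (EReal.coe_lt_coe_iff.2 hx).trans hX
      exact tendsto_nhds_unique_of_eventuallyEq (hcu.tendsto.mono_left nhdsWithin_le_nhds)
        (hci.tendsto.mono_left nhdsWithin_le_nhds) hev
    simp only [angularMode, uncurriedField, this]

end IsTotalField


/-! ### Green's identity with a radial cutoff -/

/-- The integrand is extended constantly beyond the end points of the interval, which reduces the
claim to integrands continuous on the whole line. -/
theorem continuousOn_intervalIntegral_of_continuousOn_uIcc {E : Type*} [TopologicalSpace E]
    [FirstCountableTopology E] {F : E → ℝ → ℂ} {S : Set E} {a b : ℝ} (hab : a ≤ b)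
    (hF : ContinuousOn (fun q : E × ℝ => F q.1 q.2) (S ×ˢ Icc a b)) :
    ContinuousOn (fun p => ∫ φ in a..b, F p φ) S := by
  have h : ContinuousOn (fun q : E × ℝ => F q.1 (projIcc a b hab q.2)) (S ×ˢ univ) :=
    hF.comp (f := fun q : E × ℝ => (q.1, (projIcc a b hab q.2 : ℝ)))
      (continuousOn_fst.prodMk (continuous_subtype_val.comp
        (continuous_projIcc.comp continuous_snd)).continuousOn)
      (fun q hq => ⟨hq.1, (projIcc a b hab q.2).2⟩)
  refine (continuousOn_intervalIntegral_of_continuousOn (F := fun p φ => F p (projIcc a b hab φ))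
    a b h).congr fun p _ => ?_
  refine intervalIntegral.integral_congr fun φ hφ => ?_
  rw [uIcc_of_le hab] at hφ
  simp only [projIcc_of_mem hab hφ]

/-- It undoes the shear `r = f x + s` in the terms of Green's identity. -/
theorem integral_comp_add_eq_integral_Ioi {g : ℝ → ℂ} {a S : ℝ} (hS : 0 ≤ S)
    (hg : ∀ r, a + S < r → g r = 0) : ∫ s in (0 : ℝ)..S, g (a + s) = ∫ r in Ioi a, g r := by
  rw [intervalIntegral.integral_comp_add_left g, add_zero,
    intervalIntegral.integral_of_le (by linarith)]
  refine (setIntegral_eq_of_subset_of_forall_sdiff_eq_zero measurableSet_Ioi Ioc_subset_Ioi_self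
    fun r hr => ?_).symm
  refine hg r ?_
  by_contra h
  exact hr.2 ⟨hr.1, not_lt.1 h⟩

theorem _root_.HasFDerivAt.hasDerivAt_left {h : ℝ × ℝ → ℂ} {L : ℝ × ℝ →L[ℝ] ℂ} {x r : ℝ}
    (hh : HasFDerivAt h L (x, r)) : HasDerivAt (fun t => h (t, r)) (L (1, 0)) x :=
  hh.comp_hasDerivAt (f := fun t : ℝ => (t, r)) x
    ((hasDerivAt_id x).prodMk (hasDerivAt_const x r))

theorem _root_.HasFDerivAt.hasDerivAt_right {h : ℝ × ℝ → ℂ} {L : ℝ × ℝ →L[ℝ] ℂ} {x r : ℝ}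
    (hh : HasFDerivAt h L (x, r)) : HasDerivAt (fun s => h (x, s)) (L (0, 1)) r :=
  hh.comp_hasDerivAt (f := fun s : ℝ => (x, s)) r
    ((hasDerivAt_const r x).prodMk (hasDerivAt_id r))

namespace IsFieldMode

variable {k : ℂ} {n : ℤ} {X₁ : ℝ} {X₂ : EReal} {f : ℝ → ℝ} {v₀ : ℝ → ℂ} {v vr : ℝ → ℝ → ℂ}

/-- The density `r v G` of Green's identity with a cutoff factor. -/
def density (k : ℂ) (n : ℤ) (x' r' : ℝ) (v : ℝ → ℝ → ℂ) (η : ℝ → ℝ) (x r : ℝ) : ℂ :=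
  (η r : ℂ) * ((r : ℂ) * (v x r * modeGreen k n x' r' x r))

/-- The radial flux `r (G ∂_r v - v ∂_r G) / (2ik)` of Green's identity with a cutoff factor. -/
def flux (k : ℂ) (n : ℤ) (x' r' : ℝ) (v vr : ℝ → ℝ → ℂ) (η : ℝ → ℝ) (x r : ℝ) : ℂ :=
  (η r : ℂ) * (1 / (2 * I * k) * ((r : ℂ) *
    (modeGreen k n x' r' x r * vr x r - v x r * modeGreenDr k n x' r' x r)))

/-- The equation for the mode and the adjoint equation for the Green mode cancel in the divergence
`∂_x (density) + ∂_r (flux)`; only the term with the derivative of the cutoff survives. -/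
theorem hasFDerivAt_density_flux (hv : IsFieldMode k n X₁ X₂ f v₀ v vr) (hk : k ≠ 0) (r' : ℝ)
    {x' x r : ℝ} (hx : X₁ < x) (hx' : x < x') (hp : (x, r) ∈ planarExterior X₁ X₂ f)
    {η : ℝ → ℝ} (hη : Differentiable ℝ η) :
    ∃ L M : ℝ × ℝ →L[ℝ] ℂ,
      HasFDerivAt (fun p : ℝ × ℝ => density k n x' r' v η p.1 p.2) L (x, r) ∧
      HasFDerivAt (fun p : ℝ × ℝ => flux k n x' r' v vr η p.1 p.2) M (x, r) ∧
      L (1, 0) + M (0, 1) = flux k n x' r' v vr (deriv η) x r := by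
  have hr : (r : ℂ) ≠ 0 := by exact_mod_cast hp.2.1.ne'
  have dv := hv.differentiableAt x r hx hp
  have dvr := hv.differentiableAt_dr x r hx hp
  have dG := (contDiffAt_modeGreen k n x' r' (p := (x, r)) hx').differentiableAt (by norm_num)
  have dGr := (contDiffAt_modeGreenDr k n x' r' (p := (x, r)) hx').differentiableAt (by norm_num)
  have dofR : Differentiable ℝ (fun t : ℝ => (t : ℂ)) := Complex.ofRealCLM.differentiable
  have dη : DifferentiableAt ℝ (fun p : ℝ × ℝ => (η p.2 : ℂ)) (x, r) :=
    (dofR.comp (hη.comp differentiable_snd)).differentiableAt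
  have dr : DifferentiableAt ℝ (fun p : ℝ × ℝ => (p.2 : ℂ)) (x, r) :=
    (dofR.comp differentiable_snd).differentiableAt
  have dP : DifferentiableAt ℝ (fun p : ℝ × ℝ => density k n x' r' v η p.1 p.2) (x, r) :=
    dη.fun_mul (dr.fun_mul (dv.fun_mul dG))
  have dQ : DifferentiableAt ℝ (fun p : ℝ × ℝ => flux k n x' r' v vr η p.1 p.2) (x, r) :=
    dη.fun_mul ((dr.fun_mul ((dG.fun_mul dvr).fun_sub (dv.fun_mul dGr))).const_mul _)
  refine ⟨_, _, dP.hasFDerivAt, dQ.hasFDerivAt, ?_⟩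
  have vx : HasDerivAt (fun x => v x r) (deriv (fun x => v x r) x) x :=
    dv.hasFDerivAt.hasDerivAt_left.differentiableAt.hasDerivAt
  have vrr : HasDerivAt (fun r => vr x r) (deriv (fun r => vr x r) r) r :=
    dvr.hasFDerivAt.hasDerivAt_right.differentiableAt.hasDerivAt
  have vr1 := hv.hasDerivAt x r hx hp
  have Gx := hasDerivAt_modeGreen_x k n hx' r' r
  have Gr := hasDerivAt_modeGreen_r k n x' r' x r
  have Grr := hasDerivAt_modeGreenDr_r k n x' r' x r
  have hη' : HasDerivAt (fun s : ℝ => (η s : ℂ)) ((deriv η r : ℝ) : ℂ) r :=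
    (hη r).hasDerivAt.ofReal_comp
  have hid : HasDerivAt (fun s : ℝ => (s : ℂ)) 1 r := (hasDerivAt_id r).ofReal_comp
  have e1 := HasDerivAt.unique (f := fun t => density k n x' r' v η t r) dP.hasFDerivAt.hasDerivAt_left
    (((vx.fun_mul Gx).const_mul (r : ℂ)).const_mul (η r : ℂ))
  have e2 := HasDerivAt.unique (f := fun s => flux k n x' r' v vr η x s) dQ.hasFDerivAt.hasDerivAt_right
    (hη'.fun_mul ((hid.fun_mul ((Gr.fun_mul vrr).fun_sub (vr1.fun_mul Grr))).const_mul
      (1 / (2 * I * k))))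
  rw [e1, e2, modeGreen_adjoint_equation hk n hx' r' hp.2.1.ne',
    eq_neg_of_add_eq_zero_left (hv.equation x r hx hp), flux]
  field_simp
  ring

theorem continuousOn_density (hv : IsFieldMode k n X₁ X₂ f v₀ v vr) (x' r' : ℝ) {η : ℝ → ℝ}
    (hη : Continuous η) :
    ContinuousOn (fun p : ℝ × ℝ => density k n x' r' v η p.1 p.2)
      (rearExterior X₁ X₂ f ∩ {p | p.1 < x'}) :=
  (Continuous.continuousOn (by fun_prop)).fun_mul
    ((Continuous.continuousOn (by fun_prop)).fun_mul ((hv.continuousOn.mono inter_subset_left).fun_mul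
      ((continuousOn_modeGreen k n x' r').mono inter_subset_right)))

theorem continuousOn_flux (hv : IsFieldMode k n X₁ X₂ f v₀ v vr) (x' r' : ℝ) {η : ℝ → ℝ}
    (hη : Continuous η) :
    ContinuousOn (fun p : ℝ × ℝ => flux k n x' r' v vr η p.1 p.2)
      (rearExterior X₁ X₂ f ∩ {p | p.1 < x'}) := by
  have c1 := hv.continuousOn.mono (inter_subset_left (t := {p : ℝ × ℝ | p.1 < x'}))
  have c2 := hv.continuousOn_dr.mono (inter_subset_left (t := {p : ℝ × ℝ | p.1 < x'}))
  have c3 := (continuousOn_modeGreen k n x' r').mono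
    (inter_subset_right (s := rearExterior X₁ X₂ f))
  have c4 := (continuousOn_modeGreenDr k n x' r').mono
    (inter_subset_right (s := rearExterior X₁ X₂ f))
  exact (Continuous.continuousOn (by fun_prop)).fun_mul (continuousOn_const.fun_mul
    ((Continuous.continuousOn (by fun_prop)).fun_mul ((c3.fun_mul c2).fun_sub (c1.fun_mul c4))))

/-- Functions that vanish near the axis extend continuously to the tip. -/
theorem continuousOn_of_vanishing {h : ℝ × ℝ → ℂ} {x' ρ : ℝ} (hρ : 0 < ρ)
    (hc : ContinuousOn h (rearExterior X₁ X₂ f ∩ {p | p.1 < x'}))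
    (h0 : ∀ p : ℝ × ℝ, p.2 < ρ → h p = 0) :
    ContinuousOn h {p | X₁ ≤ p.1 ∧ (p.1 : EReal) < X₂ ∧ p.1 < x' ∧ f p.1 ≤ p.2} := by
  rintro p ⟨h1, h2, h3, h4⟩
  rcases lt_or_ge p.2 ρ with hp | hp
  · refine ContinuousAt.continuousWithinAt ?_
    refine (continuousAt_const (y := (0 : ℂ))).congr ?_
    filter_upwards [(isOpen_lt continuous_snd continuous_const).mem_nhds hp] with q hq
    exact (h0 q hq).symm
  · refine (hc p ⟨⟨h1, h2, hρ.trans_le hp, h4⟩, h3⟩).mono_of_mem_nhdsWithin ?_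
    have : {q : ℝ × ℝ | 0 < q.2} ∈ nhds p :=
      (isOpen_lt continuous_const continuous_snd).mem_nhds (hρ.trans_le hp)
    filter_upwards [mem_nhdsWithin_of_mem_nhds this, self_mem_nhdsWithin] with q hq hq'
    exact ⟨⟨hq'.1, hq'.2.1, hq, hq'.2.2.2⟩, hq'.2.2.1⟩

/-- The boundary term of Green's identity. -/
def boundaryTerm (k : ℂ) (n : ℤ) (f : ℝ → ℝ) (v : ℝ → ℝ → ℂ) (x' r' x : ℝ) : ℂ :=
  I * (f x : ℂ) / k * (modeGreenDr k n x' r' x (f x)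
      + I * k * ((deriv f x : ℝ) : ℂ) * modeGreen k n x' r' x (f x)) * v x (f x)

theorem mem_shift (hf : IsBodyProfile X₁ X₂ f) {x s : ℝ} (h1 : X₁ < x) (h2 : (x : EReal) < X₂)
    (hs : 0 < s) : (x, f x + s) ∈ planarExterior X₁ X₂ f :=
  ⟨h2, add_pos (hf.pos x h1 h2) hs, fun _ => lt_add_of_pos_right _ hs⟩

/-- The shear `r = f x + s` straightens the surface, so the divergence theorem on a rectangle
applies; the flux in the new coordinates acquires the term `-f' · density`. Staying behind the tip
(`X₁ < a`) keeps `f` twice continuously differentiable on the rectangle. -/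
theorem green_identity_rectangle (hf : IsBodyProfile X₁ X₂ f)
    (hv : IsFieldMode k n X₁ X₂ f v₀ v vr) (hk : k ≠ 0) (r' : ℝ) {a c x' S R : ℝ} (ha : X₁ < a)
    (hac : a ≤ c) (hcx : c < x') (hc : (c : EReal) < X₂) (hS : 0 ≤ S) {η : ℝ → ℝ}
    (hη : ContDiff ℝ 1 η) (hR : ∀ r, R ≤ r → η r = 0) (hSR : R ≤ S) :
    ∫ x in a..c, ∫ s in (0 : ℝ)..S, flux k n x' r' v vr (deriv η) x (f x + s)
      = -(∫ x in a..c, 1 / 2 * ((η (f x) : ℂ) * boundaryTerm k n f v x' r' x))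
        + (∫ s in (0 : ℝ)..S, density k n x' r' v η c (f c + s))
        - ∫ s in (0 : ℝ)..S, density k n x' r' v η a (f a + s) := by
  have hmem : ∀ x ∈ Icc a c, X₁ < x ∧ (x : EReal) < X₂ ∧ x < x' := fun x hx =>
    ⟨ha.trans_le hx.1, (EReal.coe_le_coe_iff.2 hx.2).trans_lt hc, hx.2.trans_lt hcx⟩
  have hfc : ContinuousOn f (Icc a c) :=
    (hf.continuousOn_Icc hc).mono (Icc_subset_Icc_left ha.le)
  have hdfc : ContinuousOn (deriv f) (Icc a c) := fun x hx =>
    (hf.contDiffAt_deriv (hmem x hx).1 (hmem x hx).2.1).continuousAt.continuousWithinAt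
  have hσc : ContinuousOn (fun p : ℝ × ℝ => (p.1, f p.1 + p.2)) (uIcc a c ×ˢ uIcc 0 S) := by
    rw [uIcc_of_le hac]
    exact continuousOn_fst.prodMk ((hfc.comp continuousOn_fst fun p hp => hp.1).add
      continuousOn_snd)
  have hσm : MapsTo (fun p : ℝ × ℝ => (p.1, f p.1 + p.2)) (uIcc a c ×ˢ uIcc 0 S)
      (rearExterior X₁ X₂ f ∩ {p | p.1 < x'}) := by
    rw [uIcc_of_le hac, uIcc_of_le hS]
    rintro ⟨x, s⟩ ⟨hx, hs⟩
    obtain ⟨h1, h2, h3⟩ := hmem x hx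
    have := hf.pos x h1 h2
    exact ⟨⟨h1.le, h2, by have := hs.1; simp only at *; linarith,
      by have := hs.1; simp only at *; linarith⟩, h3⟩
  have hcP := (hv.continuousOn_density x' r' hη.continuous).comp hσc hσm
  have hcQ := (hv.continuousOn_flux x' r' hη.continuous).comp hσc hσm
  have hcE := (hv.continuousOn_flux x' r' (hη.continuous_deriv le_rfl)).comp hσc hσm
  have hcd : ContinuousOn (fun p : ℝ × ℝ => ((deriv f p.1 : ℝ) : ℂ)) (uIcc a c ×ˢ uIcc 0 S) := by
    rw [uIcc_of_le hac]
    exact (Complex.continuous_ofReal.comp_continuousOn hdfc).comp continuousOn_fst fun p hp => hp.1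
  -- the derivatives of the sheared density and flux
  have hD : ∀ p : ℝ × ℝ, ∃ L M : ℝ × ℝ →L[ℝ] ℂ, (p ∈ Ioo a c ×ˢ Ioo 0 S →
      HasFDerivAt (fun p : ℝ × ℝ => density k n x' r' v η p.1 (f p.1 + p.2)) L p ∧
      HasFDerivAt (fun p : ℝ × ℝ => flux k n x' r' v vr η p.1 (f p.1 + p.2)
        - ((deriv f p.1 : ℝ) : ℂ) * density k n x' r' v η p.1 (f p.1 + p.2)) M p) ∧
      L (1, 0) + M (0, 1) = flux k n x' r' v vr (deriv η) p.1 (f p.1 + p.2) := by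
    rintro ⟨x, s⟩
    by_cases hxs : (x, s) ∈ Ioo a c ×ˢ Ioo 0 S
    swap
    -- Off the open rectangle the maps are arbitrary, chosen so that the divergence formula holds at
    -- every point and integrability can be read off the right-hand side.
    · exact ⟨(ContinuousLinearMap.fst ℝ ℝ ℝ).smulRight
        (flux k n x' r' v vr (deriv η) x (f x + s)), 0, fun h => absurd h hxs, by simp⟩
    obtain ⟨hx, hs⟩ := hxs
    obtain ⟨h1, h2, h3⟩ := hmem x (Ioo_subset_Icc_self hx)
    obtain ⟨L, M, hL, hM, hLM⟩ := hv.hasFDerivAt_density_flux hk r' h1 h3 (mem_shift hf h1 h2 hs.1)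
      (hη.differentiable one_ne_zero)
    have hf1 : HasFDerivAt (fun p : ℝ × ℝ => f p.1) (deriv f x • ContinuousLinearMap.fst ℝ ℝ ℝ)
        (x, s) :=
      (hf.differentiableAt h1 h2).hasDerivAt.comp_hasFDerivAt (x, s) hasFDerivAt_fst
    have hσ : HasFDerivAt (fun p : ℝ × ℝ => (p.1, f p.1 + p.2))
        ((ContinuousLinearMap.fst ℝ ℝ ℝ).prod (deriv f x • ContinuousLinearMap.fst ℝ ℝ ℝ
          + ContinuousLinearMap.snd ℝ ℝ ℝ)) (x, s) :=
      hasFDerivAt_fst.prodMk (hf1.add hasFDerivAt_snd)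
    have hd2 : DifferentiableAt ℝ (fun p : ℝ × ℝ => ((deriv f p.1 : ℝ) : ℂ)) (x, s) :=
      Complex.ofRealCLM.differentiableAt.comp (x, s) (f := fun p : ℝ × ℝ => deriv f p.1)
        (DifferentiableAt.comp (x, s) (g := deriv f) (f := Prod.fst)
          ((hf.contDiffAt_deriv h1 h2).differentiableAt one_ne_zero) differentiableAt_fst)
    have hL' := HasFDerivAt.comp (x, s) (f := fun p : ℝ × ℝ => (p.1, f p.1 + p.2)) hL hσ
    have hM' := HasFDerivAt.comp (x, s) (f := fun p : ℝ × ℝ => (p.1, f p.1 + p.2)) hM hσ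
    have hdz : fderiv ℝ (fun p : ℝ × ℝ => ((deriv f p.1 : ℝ) : ℂ)) (x, s) (0, 1) = 0 := by
      exact hd2.hasFDerivAt.hasDerivAt_right.unique (hasDerivAt_const s ((deriv f x : ℝ) : ℂ))
    refine ⟨_, _, fun _ => ⟨hL', hM'.fun_sub (hd2.hasFDerivAt.fun_mul hL')⟩, ?_⟩
    rw [← hLM]
    have e : ((deriv f x : ℝ) : ℂ) * L (0, 1) = L (0, deriv f x) := by
      rw [← real_smul, ← map_smul]; simp
    have e2 : L (1, deriv f x) = L (1, 0) + L (0, deriv f x) := by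
      rw [← map_add]; simp
    simp [hdz, e, e2]
  choose L M hL hLM using hD
  have hint : IntegrableOn (fun p : ℝ × ℝ => L p (1, 0) + M p (0, 1)) (uIcc a c ×ˢ uIcc 0 S) := by
    simp only [hLM]
    exact hcE.integrableOn_compact (isCompact_uIcc.prod isCompact_uIcc)
  have key := integral2_divergence_prod_of_hasFDerivAt_off_countable
    (fun p : ℝ × ℝ => density k n x' r' v η p.1 (f p.1 + p.2))
    (fun p : ℝ × ℝ => flux k n x' r' v vr η p.1 (f p.1 + p.2)
        - ((deriv f p.1 : ℝ) : ℂ) * density k n x' r' v η p.1 (f p.1 + p.2))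
    L M a 0 c S ∅ countable_empty hcP (hcQ.fun_sub (hcd.fun_mul hcP))
    (fun p hp => (hL p (by simpa [hac, hS] using hp)).1)
    (fun p hp => (hL p (by simpa [hac, hS] using hp)).2) hint
  simp only [hLM] at key
  rw [key]
  have e1 : ∫ x in a..c, (flux k n x' r' v vr η x (f x + S)
        - ((deriv f x : ℝ) : ℂ) * density k n x' r' v η x (f x + S)) = 0 := by
    rw [intervalIntegral.integral_congr (g := fun _ => 0), intervalIntegral.integral_zero]
    intro x hx
    rw [uIcc_of_le hac] at hx
    obtain ⟨h1, h2, -⟩ := hmem x hx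
    have : η (f x + S) = 0 := hR _ (by linarith [hf.pos x h1 h2])
    simp [flux, density, this]
  -- The bottom edge is the surface: the Neumann condition replaces `∂_r v` by `ik f' v`, and half
  -- of the term `f' r v G` remains, which is the source of the factor `1/2`.
  have e2 : ∫ x in a..c, (flux k n x' r' v vr η x (f x + 0)
        - ((deriv f x : ℝ) : ℂ) * density k n x' r' v η x (f x + 0))
      = ∫ x in a..c, 1 / 2 * ((η (f x) : ℂ) * boundaryTerm k n f v x' r' x) := by
    refine intervalIntegral.integral_congr fun x hx => ?_
    rw [uIcc_of_le hac] at hx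
    obtain ⟨h1, h2, -⟩ := hmem x hx
    simp only [flux, density, boundaryTerm, add_zero]
    rw [hv.neumann x h1 h2]
    have hI : (I : ℂ) ≠ 0 := I_ne_zero
    field_simp
    ring_nf
    simp only [I_sq, show I ^ 3 = -I by rw [pow_succ, I_sq]; ring]
    ring
  rw [e1, e2]
  ring

theorem flux_deriv_eq_zero {x' r' x r ρ R : ℝ} {η : ℝ → ℝ} (h0 : ∀ r, r ≤ ρ → η r = 0)
    (hR : ∀ r, R ≤ r → η r = 0) (hr : r < ρ ∨ R < r) :
    flux k n x' r' v vr (deriv η) x r = 0 := by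
  have : deriv η r = 0 := by
    rcases hr with h | h
    · have : η =ᶠ[nhds r] fun _ => 0 := by
        filter_upwards [Iio_mem_nhds h] with t ht using h0 t (le_of_lt ht)
      rw [this.deriv_eq, deriv_const]
    · have : η =ᶠ[nhds r] fun _ => 0 := by
        filter_upwards [Ioi_mem_nhds h] with t ht using hR t (le_of_lt ht)
      rw [this.deriv_eq, deriv_const]
  simp [flux, this]

theorem continuousAt_surface (hf : IsBodyProfile X₁ X₂ f)
    (hv : IsFieldMode k n X₁ X₂ f v₀ v vr) {x : ℝ} (h1 : X₁ < x) (h2 : (x : EReal) < X₂) :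
    ContinuousAt (fun x => v x (f x)) x := by
  have hO : ContinuousOn (fun x => v x (f x)) {x : ℝ | X₁ < x ∧ (x : EReal) < X₂} :=
    hv.continuousOn.comp (f := fun x => (x, f x))
      (continuousOn_id.prodMk fun x hx =>
        (hf.contDiffAt hx.1 hx.2).continuousAt.continuousWithinAt)
      fun x hx => ⟨hx.1.le, hx.2, hf.pos x hx.1 hx.2, le_rfl⟩
  exact hO.continuousAt ((IsBodyProfile.isOpen_domain X₁ X₂).mem_nhds ⟨h1, h2⟩)

theorem continuousAt_boundaryTerm (hf : IsBodyProfile X₁ X₂ f)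
    (hv : IsFieldMode k n X₁ X₂ f v₀ v vr) (r' : ℝ) {x x' : ℝ} (h1 : X₁ < x)
    (h2 : (x : EReal) < X₂) (h3 : x < x') :
    ContinuousAt (boundaryTerm k n f v x' r') x := by
  have cf := (hf.contDiffAt h1 h2).continuousAt
  have cd := (hf.contDiffAt_deriv h1 h2).continuousAt
  have hp : ContinuousAt (fun x => (x, f x)) x := continuousAt_id.prodMk cf
  have cG := (contDiffAt_modeGreen k n x' r' (p := (x, f x)) h3).continuousAt
  have cGr := (contDiffAt_modeGreenDr k n x' r' (p := (x, f x)) h3).continuousAt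
  have cG' := ContinuousAt.comp (f := fun x => (x, f x)) cG hp
  have cGr' := ContinuousAt.comp (f := fun x => (x, f x)) cGr hp
  have cfc : ContinuousAt (fun x => (f x : ℂ)) x := Complex.continuous_ofReal.continuousAt.comp cf
  have cdc : ContinuousAt (fun x => ((deriv f x : ℝ) : ℂ)) x :=
    Complex.continuous_ofReal.continuousAt.comp cd
  exact (((continuousAt_const.fun_mul cfc).div_const k).fun_mul (cGr'.fun_add
    ((continuousAt_const.fun_mul cdc).fun_mul cG'))).fun_mul (hv.continuousAt_surface hf h1 h2)

/-- Green's identity for a mode of the field and a mode of the Green's function, between the tip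
and the cross-section `x = c`, with a cutoff in the radial variable. -/
theorem green_identity (hf : IsBodyProfile X₁ X₂ f)
    (hv : IsFieldMode k n X₁ X₂ f v₀ v vr) (hk : k ≠ 0) (r' : ℝ) {c x' ρ R : ℝ}
    (hXc : X₁ < c) (hcx : c < x') (hc : (c : EReal) < X₂) {η : ℝ → ℝ}
    (hη : ContDiff ℝ 1 η) (hρ : 0 < ρ) (h0 : ∀ r, r ≤ ρ → η r = 0) (hR0 : 0 ≤ R)
    (hR : ∀ r, R ≤ r → η r = 0) :
    (∫ r in Ioi (f c), density k n x' r' v η c r) - ∫ r in Ioi 0, density k n x' r' v η X₁ r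
      = (∫ x in X₁..c, 1 / 2 * ((η (f x) : ℂ) * boundaryTerm k n f v x' r' x))
        + ∫ x in X₁..c, ∫ r in Ioi (f x), flux k n x' r' v vr (deriv η) x r := by
  set S := R + 1
  have hS : 0 ≤ S := by positivity
  have hmem : ∀ x ∈ Icc X₁ c, (x : EReal) < X₂ := fun x hx =>
    (EReal.coe_le_coe_iff.2 hx.2).trans_lt hc
  have hfc := hf.continuousOn_Icc hc
  have hσc : ContinuousOn (fun p : ℝ × ℝ => (p.1, f p.1 + p.2)) (Icc X₁ c ×ˢ Icc 0 S) :=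
    continuousOn_fst.prodMk ((hfc.comp continuousOn_fst fun p hp => hp.1).add continuousOn_snd)
  have hσm : MapsTo (fun p : ℝ × ℝ => (p.1, f p.1 + p.2)) (Icc X₁ c ×ˢ Icc 0 S)
      {p | X₁ ≤ p.1 ∧ (p.1 : EReal) < X₂ ∧ p.1 < x' ∧ f p.1 ≤ p.2} := by
    rintro ⟨x, s⟩ ⟨hx, hs⟩
    exact ⟨hx.1, hmem x hx, hx.2.trans_lt hcx, le_add_of_nonneg_right hs.1⟩
  have hcP := ((continuousOn_of_vanishing hρ (hv.continuousOn_density x' r' hη.continuous)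
    fun p hp => by simp [density, h0 p.2 hp.le]).comp hσc hσm)
  have hcE := ((continuousOn_of_vanishing hρ (hv.continuousOn_flux x' r'
    (hη.continuous_deriv le_rfl)) fun p hp => flux_deriv_eq_zero h0 hR (Or.inl hp)).comp hσc hσm)
  have c1 := continuousOn_intervalIntegral_of_continuousOn_uIcc hS
    (F := fun x s => density k n x' r' v η x (f x + s)) hcP
  have c2 := continuousOn_intervalIntegral_of_continuousOn_uIcc hS
    (F := fun x s => flux k n x' r' v vr (deriv η) x (f x + s)) hcE
  have c3 : ContinuousOn (fun x => 1 / 2 * ((η (f x) : ℂ) * boundaryTerm k n f v x' r' x))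
      (Icc X₁ c) := by
    intro x hx
    -- Near the tip `f < ρ`, so the cutoff annihilates the boundary term and no control of the field
    -- is needed there.
    rcases hx.1.eq_or_lt with rfl | hlt
    · have hev : ∀ᶠ y in nhdsWithin X₁ (Icc X₁ c),
          1 / 2 * ((η (f y) : ℂ) * boundaryTerm k n f v x' r' y) = 0 := by
        have := (hfc X₁ hx).eventually_lt_const (u := ρ) (by rw [hf.tip]; exact hρ)
        filter_upwards [this] with y hy
        simp [h0 _ hy.le]
      refine (continuousWithinAt_const (b := (0 : ℂ))).congr_of_eventuallyEq hev ?_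
      simp [hf.tip, h0 0 hρ.le]
    · have h1 := hv.continuousAt_boundaryTerm hf r' hlt (hmem x hx) (hx.2.trans_lt hcx)
      have h2 : ContinuousWithinAt (fun y => (η (f y) : ℂ)) (Icc X₁ c) x :=
        (Complex.continuous_ofReal.comp hη.continuous).continuousAt.comp_continuousWithinAt
          (hfc x hx)
      exact continuousWithinAt_const.fun_mul (h2.fun_mul h1.continuousWithinAt)
  have hI : ∀ a b, a ∈ Icc X₁ c → b ∈ Icc X₁ c → IntervalIntegrable
      (fun x => 1 / 2 * ((η (f x) : ℂ) * boundaryTerm k n f v x' r' x)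
        + ∫ s in (0 : ℝ)..S, flux k n x' r' v vr (deriv η) x (f x + s)) volume a b :=
    fun a b ha hb => ((c3.add c2).mono (uIcc_subset_Icc ha hb)).intervalIntegrable
  have hIc : c ∈ Icc X₁ c := ⟨hXc.le, le_rfl⟩
  have hIX : X₁ ∈ Icc X₁ c := ⟨le_rfl, hXc.le⟩
  -- Both sides are continuous in the left end point `a` down to the tip and agree for `a > X₁`;
  -- this carries the identity to `a = X₁`.
  have heq : EqOn (fun a => (∫ s in (0 : ℝ)..S, density k n x' r' v η c (f c + s))
      - ∫ s in (0 : ℝ)..S, density k n x' r' v η a (f a + s))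
      (fun a => ∫ x in a..c, (1 / 2 * ((η (f x) : ℂ) * boundaryTerm k n f v x' r' x)
        + ∫ s in (0 : ℝ)..S, flux k n x' r' v vr (deriv η) x (f x + s))) (Ioc X₁ c) := by
    intro a ha
    have hsub := uIcc_subset_Icc (Ioc_subset_Icc_self ha) hIc
    have h := green_identity_rectangle hf hv hk r' ha.1 ha.2 hcx hc hS hη hR
      (by simp [S] : R ≤ S)
    simp only
    rw [intervalIntegral.integral_add (c3.mono hsub).intervalIntegrable
      (c2.mono hsub).intervalIntegrable, h]
    ring
  have hcl : ContinuousOn (fun a => ∫ x in a..c, (1 / 2 * ((η (f x) : ℂ)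
      * boundaryTerm k n f v x' r' x)
        + ∫ s in (0 : ℝ)..S, flux k n x' r' v vr (deriv η) x (f x + s))) (Icc X₁ c) := by
    have := intervalIntegral.continuousOn_primitive_interval_left
      (f := fun x => 1 / 2 * ((η (f x) : ℂ) * boundaryTerm k n f v x' r' x)
        + ∫ s in (0 : ℝ)..S, flux k n x' r' v vr (deriv η) x (f x + s)) (a := X₁) (b := c)
      (μ := volume) ?_
    · rwa [uIcc_of_le hXc.le] at this
    · rw [uIcc_of_le hXc.le]
      exact (c3.add c2).integrableOn_Icc
  have hfin := heq.of_subset_closure (continuousOn_const.sub c1) hcl Ioc_subset_Icc_self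
    (by rw [closure_Ioc hXc.ne]) hIX
  simp only at hfin
  rw [intervalIntegral.integral_add (c3.mono (uIcc_subset_Icc hIX hIc)).intervalIntegrable
      (c2.mono (uIcc_subset_Icc hIX hIc)).intervalIntegrable] at hfin
  have d1 : ∀ x ∈ Icc X₁ c, ∫ s in (0 : ℝ)..S, density k n x' r' v η x (f x + s)
      = ∫ r in Ioi (f x), density k n x' r' v η x r := fun x hx =>
    integral_comp_add_eq_integral_Ioi hS fun r hr => by
      have := hf.nonneg hx.1 (hmem x hx)
      simp [density, hR r (by simp only [S] at hr; linarith)]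
  have d2 : ∀ x ∈ Icc X₁ c, ∫ s in (0 : ℝ)..S, flux k n x' r' v vr (deriv η) x (f x + s)
      = ∫ r in Ioi (f x), flux k n x' r' v vr (deriv η) x r := fun x hx =>
    integral_comp_add_eq_integral_Ioi hS fun r hr => by
      have := hf.nonneg hx.1 (hmem x hx)
      exact flux_deriv_eq_zero h0 hR (Or.inr (by simp only [S] at hr; linarith))
  rw [d1 c hIc, d1 X₁ hIX, hf.tip, intervalIntegral.integral_congr
    (a := X₁) (b := c) (f := fun x => ∫ s in (0 : ℝ)..S, flux k n x' r' v vr (deriv η) x (f x + s))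
    (g := fun x => ∫ r in Ioi (f x), flux k n x' r' v vr (deriv η) x r)
    (fun x hx => d2 x (by rwa [uIcc_of_le hXc.le] at hx))] at hfin
  exact hfin

end IsFieldMode


namespace IsFieldMode

variable {k : ℂ} {n : ℤ} {X₁ : ℝ} {X₂ : EReal} {f : ℝ → ℝ} {v₀ : ℝ → ℂ} {v vr : ℝ → ℝ → ℂ}

/-! ### Integrability of the surface values near the tip -/

/-- The energy density of a mode, on a bounded part of the exterior. -/
def energy (X₁ : ℝ) (X₂ : EReal) (f : ℝ → ℝ) (v vr : ℝ → ℝ → ℂ) (b R : ℝ) : ℝ × ℝ → ℝ :=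
  indicator {p : ℝ × ℝ | p ∈ planarExterior X₁ X₂ f ∧ X₁ < p.1 ∧ p.1 < b ∧ p.2 < R}
    fun p => (‖vr p.1 p.2‖ ^ 2 + ‖v p.1 p.2‖ ^ 2) * p.2

theorem energy_nonneg (b R : ℝ) (p : ℝ × ℝ) : 0 ≤ energy X₁ X₂ f v vr b R p := by
  refine indicator_nonneg (fun q hq => ?_) p
  have := hq.1.2.1
  positivity

theorem integrable_energy (hf : IsBodyProfile X₁ X₂ f) (hv : IsFieldMode k n X₁ X₂ f v₀ v vr)
    {b : ℝ} (hb : (b : EReal) < X₂) (R : ℝ) : Integrable (energy X₁ X₂ f v vr b R) :=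
  (integrable_indicator_iff (IsTotalField.isOpen_meixner_domain hf b R).measurableSet).2
    (hv.meixner b R hb)

theorem integrable_energy_slice (hf : IsBodyProfile X₁ X₂ f)
    (hv : IsFieldMode k n X₁ X₂ f v₀ v vr) {b : ℝ} (hb : (b : EReal) < X₂) (R : ℝ) :
    Integrable fun x => ∫ r, energy X₁ X₂ f v vr b R (x, r) := by
  have := hv.integrable_energy hf hb R
  rw [Measure.volume_eq_prod] at this
  exact this.integral_prod_left

theorem rear_slice (hf : IsBodyProfile X₁ X₂ f) {x r : ℝ} (h1 : X₁ < x)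
    (h2 : (x : EReal) < X₂) (hr : f x ≤ r) : (x, r) ∈ rearExterior X₁ X₂ f :=
  ⟨h1.le, h2, (hf.pos x h1 h2).trans_le hr, hr⟩

theorem continuousOn_slice (hf : IsBodyProfile X₁ X₂ f) (hv : IsFieldMode k n X₁ X₂ f v₀ v vr)
    {x : ℝ} (h1 : X₁ < x) (h2 : (x : EReal) < X₂) :
    ContinuousOn (fun r => v x r) (Ici (f x)) :=
  hv.continuousOn.comp (f := fun r => (x, r)) (Continuous.continuousOn (by fun_prop))
    fun _ hr => rear_slice hf h1 h2 hr

theorem continuousOn_slice_dr (hf : IsBodyProfile X₁ X₂ f) (hv : IsFieldMode k n X₁ X₂ f v₀ v vr)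
    {x : ℝ} (h1 : X₁ < x) (h2 : (x : EReal) < X₂) :
    ContinuousOn (fun r => vr x r) (Ici (f x)) :=
  hv.continuousOn_dr.comp (f := fun r => (x, r)) (Continuous.continuousOn (by fun_prop))
    fun _ hr => rear_slice hf h1 h2 hr

theorem interior_slice (hf : IsBodyProfile X₁ X₂ f) {x r : ℝ} (h1 : X₁ < x)
    (h2 : (x : EReal) < X₂) (hr : f x < r) : (x, r) ∈ planarExterior X₁ X₂ f :=
  ⟨h2, (hf.pos x h1 h2).trans hr, fun _ => hr⟩

theorem integral_energy_slice (hf : IsBodyProfile X₁ X₂ f) {b x : ℝ} (hx : X₁ < x) (hxb : x < b)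
    (hb : (b : EReal) < X₂) (R : ℝ) : ∫ r, energy X₁ X₂ f v vr b R (x, r)
      = ∫ r in Ioo (f x) R, (‖vr x r‖ ^ 2 + ‖v x r‖ ^ 2) * r := by
  have h2 : (x : EReal) < X₂ := (EReal.coe_lt_coe_iff.2 hxb).trans hb
  rw [← integral_indicator measurableSet_Ioo]
  congr 1
  funext r
  by_cases hr : r ∈ Ioo (f x) R
  · rw [indicator_of_mem hr, energy, indicator_of_mem]
    exact ⟨interior_slice hf hx h2 hr.1, hx, hxb, hr.2⟩
  · rw [indicator_of_notMem hr, energy, indicator_of_notMem]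
    exact fun h => hr ⟨h.1.2.2 hx.le, h.2.2.2⟩

/-- The surface value is recovered from the energy by the fundamental theorem of calculus along `[f
x, f x + 1]`, averaged over the end point. The weight `f x` is what makes this work: `f x ≤ r` on
the segment, so it can be replaced by the weight `r` of the energy. -/
theorem surface_value_le (hf : IsBodyProfile X₁ X₂ f)
    (hv : IsFieldMode k n X₁ X₂ f v₀ v vr) {b x F : ℝ} (hx : X₁ < x) (hxb : x < b)
    (hb : (b : EReal) < X₂) (hF : f x ≤ F) :
    f x * ‖v x (f x)‖ ≤ (F + 1) + ∫ r, energy X₁ X₂ f v vr b (F + 2) (x, r) := by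
  have h2 : (x : EReal) < X₂ := (EReal.coe_lt_coe_iff.2 hxb).trans hb
  have hf0 := hf.pos x hx h2
  have cv := hv.continuousOn_slice hf hx h2
  have cvr := hv.continuousOn_slice_dr hf hx h2
  set a := f x
  have cb : ∀ M, ContinuousOn (fun r => ‖vr x r‖) (Icc a M) := fun M =>
    cvr.norm.mono Icc_subset_Ici_self
  have iv : IntervalIntegrable (fun r => r * ‖v x r‖) volume a (a + 1) := by
    refine ContinuousOn.intervalIntegrable ?_
    rw [uIcc_of_le (by linarith)]
    exact continuousOn_id.mul (cv.norm.mono Icc_subset_Ici_self)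
  have ivr : IntervalIntegrable (fun r => r * ‖vr x r‖) volume a (a + 1) := by
    refine ContinuousOn.intervalIntegrable ?_
    rw [uIcc_of_le (by linarith)]
    exact continuousOn_id.mul (cb _)
  have hpt : ∀ s ∈ Icc a (a + 1), a * ‖v x a‖
      ≤ s * ‖v x s‖ + ∫ r in a..(a + 1), r * ‖vr x r‖ := by
    intro s hs
    have hftc : ∫ r in a..s, vr x r = v x s - v x a :=
      intervalIntegral.integral_eq_sub_of_hasDerivAt_of_le hs.1 (cv.mono Icc_subset_Ici_self)
        (fun r hr => hv.hasDerivAt x r hx (interior_slice hf hx h2 hr.1))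
        (ContinuousOn.intervalIntegrable (by
          rw [uIcc_of_le hs.1]; exact cvr.mono Icc_subset_Ici_self))
    have h3 : ‖v x a‖ ≤ ‖v x s‖ + ∫ r in a..s, ‖vr x r‖ := by
      have : v x a = v x s - ∫ r in a..s, vr x r := by rw [hftc]; ring
      rw [this]
      exact (norm_sub_le _ _).trans (add_le_add le_rfl
        (intervalIntegral.norm_integral_le_integral_norm hs.1))
    have h4 : a * ∫ r in a..s, ‖vr x r‖ ≤ ∫ r in a..(a + 1), r * ‖vr x r‖ := by
      rw [← intervalIntegral.integral_const_mul]
      have i1 : IntervalIntegrable (fun r => a * ‖vr x r‖) volume a s :=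
        ContinuousOn.intervalIntegrable (by
          rw [uIcc_of_le hs.1]; exact continuousOn_const.mul (cb _))
      have i2 : IntervalIntegrable (fun r => r * ‖vr x r‖) volume a s :=
        ContinuousOn.intervalIntegrable (by
          rw [uIcc_of_le hs.1]; exact continuousOn_id.mul (cb _))
      refine (intervalIntegral.integral_mono_on hs.1 i1 i2 fun r hr => ?_).trans ?_
      · exact mul_le_mul_of_nonneg_right hr.1 (norm_nonneg _)
      · refine intervalIntegral.integral_mono_interval le_rfl hs.1 hs.2 ?_ ivr
        rw [Filter.EventuallyLE, ae_restrict_iff' measurableSet_Ioc]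
        exact Filter.Eventually.of_forall fun r hr =>
          mul_nonneg (hf0.le.trans hr.1.le) (norm_nonneg _)
    calc a * ‖v x a‖ ≤ a * (‖v x s‖ + ∫ r in a..s, ‖vr x r‖) := by gcongr
      _ = a * ‖v x s‖ + a * ∫ r in a..s, ‖vr x r‖ := by ring
      _ ≤ _ := add_le_add (mul_le_mul_of_nonneg_right hs.1 (norm_nonneg _)) h4
  -- Averaging over the upper limit `s` in an interval of length one replaces the unknown value `v x
  -- s` by an integral.
  have hmean := intervalIntegral.integral_mono_on (a := a) (b := a + 1) (by linarith)
    (intervalIntegrable_const (c := a * ‖v x a‖))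
    (iv.add (intervalIntegrable_const (c := ∫ r in a..(a + 1), r * ‖vr x r‖))) hpt
  rw [intervalIntegral.integral_const, intervalIntegral.integral_add iv intervalIntegrable_const,
    intervalIntegral.integral_const, add_sub_cancel_left, one_smul, one_smul] at hmean
  refine hmean.trans ?_
  have cH : ContinuousOn (fun r => (‖vr x r‖ ^ 2 + ‖v x r‖ ^ 2) * r) (Icc a (F + 2)) :=
    (((cvr.norm.pow 2).add (cv.norm.pow 2)).mul continuousOn_id).mono Icc_subset_Ici_self
  have iH : IntervalIntegrable (fun r => (‖vr x r‖ ^ 2 + ‖v x r‖ ^ 2) * r) volume a (a + 1) := by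
    refine ContinuousOn.intervalIntegrable ?_
    rw [uIcc_of_le (by linarith)]
    exact cH.mono (Icc_subset_Icc_right (by linarith))
  rw [integral_energy_slice hf hx hxb hb, ← intervalIntegral.integral_add iv ivr]
  calc ∫ r in a..(a + 1), (r * ‖v x r‖ + r * ‖vr x r‖)
      ≤ ∫ r in a..(a + 1), ((F + 1) + (‖vr x r‖ ^ 2 + ‖v x r‖ ^ 2) * r) := by
        refine intervalIntegral.integral_mono_on (by linarith) (iv.add ivr)
          (intervalIntegrable_const.add iH) fun r hr => ?_
        have hr0 : 0 ≤ r := hf0.le.trans hr.1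
        have : ‖v x r‖ + ‖vr x r‖ ≤ 1 + (‖vr x r‖ ^ 2 + ‖v x r‖ ^ 2) := by
          nlinarith [sq_nonneg (‖v x r‖ - 1 / 2), sq_nonneg (‖vr x r‖ - 1 / 2)]
        nlinarith [mul_le_mul_of_nonneg_left this hr0, hr.2]
    _ = (F + 1) + ∫ r in a..(a + 1), (‖vr x r‖ ^ 2 + ‖v x r‖ ^ 2) * r := by
        rw [intervalIntegral.integral_add intervalIntegrable_const iH,
          intervalIntegral.integral_const, add_sub_cancel_left, one_smul]
    _ ≤ _ := by
        gcongr
        rw [intervalIntegral.integral_of_le (by linarith)]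
        refine setIntegral_mono_set (cH.integrableOn_Icc.mono_set Ioo_subset_Icc_self) ?_ ?_
        · rw [Filter.EventuallyLE, ae_restrict_iff' measurableSet_Ioo]
          refine Filter.Eventually.of_forall fun r hr => ?_
          have : 0 ≤ r := hf0.le.trans hr.1.le
          simp only [Pi.zero_apply]
          positivity
        · refine Filter.Eventually.of_forall fun r hr => ?_
          exact ⟨hr.1, by have := hr.2; linarith⟩

/-- The boundary term is integrable up to the tip. -/
theorem integrableOn_boundaryTerm (hf : IsBodyProfile X₁ X₂ f)
    (hv : IsFieldMode k n X₁ X₂ f v₀ v vr) (r' : ℝ) {c x' : ℝ}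
    (hcx : c < x') (hx'0 : (x' : EReal) < X₂) :
    IntegrableOn (boundaryTerm k n f v x' r') (Ioc X₁ c) := by
  have hmem : ∀ x ∈ Icc X₁ c, (x : EReal) < X₂ := fun x hx =>
    (EReal.coe_lt_coe_iff.2 (hx.2.trans_lt hcx)).trans hx'0
  rcases lt_or_ge X₁ c with hXc | hXc
  swap
  · rw [Ioc_eq_empty (not_lt.2 hXc)]; exact integrableOn_empty
  have hc : (c : EReal) < X₂ := hmem c ⟨hXc.le, le_rfl⟩
  have hfc := hf.continuousOn_Icc hc
  obtain ⟨F, hF⟩ := isCompact_Icc.exists_bound_of_continuousOn hfc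
  obtain ⟨M, hM⟩ := hf.slope c hc
  have hpc : ContinuousOn (fun x => (x, f x)) (Icc X₁ c) := continuousOn_id.prodMk hfc
  have hpm : MapsTo (fun x => (x, f x)) (Icc X₁ c) {p : ℝ × ℝ | p.1 < x'} := fun x hx =>
    hx.2.trans_lt hcx
  obtain ⟨C1, hC1⟩ := isCompact_Icc.exists_bound_of_continuousOn
    ((continuousOn_modeGreen k n x' r').comp hpc hpm)
  obtain ⟨C2, hC2⟩ := isCompact_Icc.exists_bound_of_continuousOn
    ((continuousOn_modeGreenDr k n x' r').comp hpc hpm)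
  set D := 1 / ‖k‖ * (C2 + ‖k‖ * M * C1)
  have hint : IntegrableOn (fun x => D * ((F + 1) +
      ∫ r, energy X₁ X₂ f v vr x' (F + 2) (x, r))) (Ioc X₁ c) :=
    Integrable.const_mul (Integrable.add (integrableOn_const (by simp))
      (hv.integrable_energy_slice hf hx'0 (F + 2)).integrableOn) D
  refine Integrable.mono' hint ?_ ?_
  · exact ContinuousOn.aestronglyMeasurable (fun x hx => (hv.continuousAt_boundaryTerm hf r' hx.1
      (hmem x ⟨hx.1.le, hx.2⟩) (hx.2.trans_lt hcx)).continuousWithinAt) measurableSet_Ioc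
  · rw [ae_restrict_iff' measurableSet_Ioc]
    refine Filter.Eventually.of_forall fun x hx => ?_
    have hx' : x ∈ Icc X₁ c := ⟨hx.1.le, hx.2⟩
    have h2 := hmem x hx'
    have hf0 := hf.pos x hx.1 h2
    have b1 : ‖modeGreen k n x' r' x (f x)‖ ≤ C1 := hC1 x hx'
    have b2 : ‖modeGreenDr k n x' r' x (f x)‖ ≤ C2 := hC2 x hx'
    have b3 : |deriv f x| ≤ M := hM x hx.1 hx.2
    have hC10 : 0 ≤ C1 := (norm_nonneg _).trans b1
    have hM0 : 0 ≤ M := (abs_nonneg _).trans b3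
    have hC20 : 0 ≤ C2 := (norm_nonneg _).trans b2
    -- Only `f x * ‖v x (f x)‖` is controlled near the tip, and the kernel carries precisely this
    -- factor `f x`.
    have b4 := hv.surface_value_le hf hx.1 (hx.2.trans_lt hcx) hx'0
      ((le_abs_self _).trans (hF x hx'))
    calc ‖boundaryTerm k n f v x' r' x‖
        = 1 / ‖k‖ * ‖modeGreenDr k n x' r' x (f x)
            + I * k * ((deriv f x : ℝ) : ℂ) * modeGreen k n x' r' x (f x)‖
            * (f x * ‖v x (f x)‖) := by
          rw [boundaryTerm, norm_mul, norm_mul, norm_div, norm_mul, norm_I, Complex.norm_real,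
            Real.norm_of_nonneg hf0.le]
          ring
      _ ≤ D * (f x * ‖v x (f x)‖) := by
          refine mul_le_mul_of_nonneg_right ?_ (by positivity)
          refine mul_le_mul_of_nonneg_left ?_ (by positivity)
          refine (norm_add_le _ _).trans (add_le_add b2 ?_)
          rw [norm_mul, norm_mul, norm_mul, norm_I, one_mul, Complex.norm_real, Real.norm_eq_abs]
          gcongr
      _ ≤ _ := by gcongr

end IsFieldMode


/-! ### Radial cutoffs -/

/-- Both derivatives are continuous and vanish off `[0, 1]`, hence are bounded. -/
theorem Real.smoothTransition.exists_deriv_bound : ∃ C : ℝ, 0 ≤ C ∧ ∀ t : ℝ,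
    |deriv Real.smoothTransition t| ≤ C ∧ |deriv (deriv Real.smoothTransition) t| ≤ C := by
  have h2 : ContDiff ℝ 2 Real.smoothTransition :=
    Real.smoothTransition.contDiff (n := (2 : ℕ∞))
  have h1 : ContDiff ℝ 1 (deriv Real.smoothTransition) := by
    have : ContDiff ℝ (1 + 1) Real.smoothTransition := by simpa [one_add_one_eq_two] using h2
    exact (contDiff_succ_iff_deriv.1 this).2.2
  have c1 : Continuous (deriv Real.smoothTransition) := h1.continuous
  have c2 : Continuous (deriv (deriv Real.smoothTransition)) := h1.continuous_deriv le_rfl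
  obtain ⟨C1, hC1⟩ := (isCompact_Icc (a := (-1 : ℝ)) (b := 2)).exists_bound_of_continuousOn
    c1.continuousOn
  obtain ⟨C2, hC2⟩ := (isCompact_Icc (a := (-1 : ℝ)) (b := 2)).exists_bound_of_continuousOn
    c2.continuousOn
  have z1 : ∀ t : ℝ, t < 0 ∨ 1 < t → deriv Real.smoothTransition t = 0 := by
    rintro t (ht | ht)
    · have : Real.smoothTransition =ᶠ[nhds t] fun _ => 0 := by
        filter_upwards [Iio_mem_nhds ht] with s hs
        exact Real.smoothTransition.zero_of_nonpos (le_of_lt hs)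
      rw [this.deriv_eq, deriv_const]
    · have : Real.smoothTransition =ᶠ[nhds t] fun _ => 1 := by
        filter_upwards [Ioi_mem_nhds ht] with s hs
        exact Real.smoothTransition.one_of_one_le (le_of_lt hs)
      rw [this.deriv_eq, deriv_const]
  have z2 : ∀ t : ℝ, t < 0 ∨ 1 < t → deriv (deriv Real.smoothTransition) t = 0 := by
    rintro t (ht | ht)
    · have : deriv Real.smoothTransition =ᶠ[nhds t] fun _ => 0 := by
        filter_upwards [Iio_mem_nhds ht] with s hs using z1 s (Or.inl hs)
      rw [this.deriv_eq, deriv_const]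
    · have : deriv Real.smoothTransition =ᶠ[nhds t] fun _ => 0 := by
        filter_upwards [Ioi_mem_nhds ht] with s hs using z1 s (Or.inr hs)
      rw [this.deriv_eq, deriv_const]
  refine ⟨max (max C1 C2) 0, le_max_right _ _, fun t => ?_⟩
  by_cases ht : t ∈ Icc (-1 : ℝ) 2
  · exact ⟨(hC1 t ht).trans ((le_max_left _ _).trans (le_max_left _ _)),
      (hC2 t ht).trans ((le_max_right _ _).trans (le_max_left _ _))⟩
  · have : t < 0 ∨ 1 < t := by
      by_contra h
      push Not at h
      exact ht ⟨by linarith, by linarith⟩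
    rw [z1 t this, z2 t this]
    simp

/-- A smooth cutoff at the radius `a`, which vanishes up to `a` and is `1` beyond `2a`. -/
def radialCutoff (a r : ℝ) : ℝ := Real.smoothTransition (r / a - 1)

theorem contDiff_radialCutoff (a : ℝ) : ContDiff ℝ 2 (radialCutoff a) :=
  (Real.smoothTransition.contDiff (n := (2 : ℕ∞))).comp
    ((contDiff_id.div_const a).sub contDiff_const)

theorem radialCutoff_eq_zero {a r : ℝ} (ha : 0 < a) (h : r ≤ a) : radialCutoff a r = 0 :=
  Real.smoothTransition.zero_of_nonpos (by
    rw [sub_nonpos, div_le_one ha]; exact h)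

theorem radialCutoff_eq_one {a r : ℝ} (ha : 0 < a) (h : 2 * a ≤ r) : radialCutoff a r = 1 :=
  Real.smoothTransition.one_of_one_le (by
    rw [le_sub_iff_add_le, le_div_iff₀ ha]; linarith)

theorem deriv_radialCutoff (a r : ℝ) :
    deriv (radialCutoff a) r = deriv Real.smoothTransition (r / a - 1) / a := by
  have h1 : HasDerivAt (fun r : ℝ => r / a - 1) (1 / a) r :=
    ((hasDerivAt_id r).div_const a).sub_const 1
  have h2 := ((Real.smoothTransition.contDiff (n := (2 : ℕ∞))).differentiable
    (by norm_num) (r / a - 1)).hasDerivAt.comp r h1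
  rw [show radialCutoff a = Real.smoothTransition ∘ fun r => r / a - 1 from rfl, h2.deriv]
  ring

theorem hasDerivAt_deriv_radialCutoff (a r : ℝ) : HasDerivAt (deriv (radialCutoff a))
    (deriv (deriv Real.smoothTransition) (r / a - 1) / a ^ 2) r := by
  have h1 : HasDerivAt (fun r : ℝ => r / a - 1) (1 / a) r :=
    ((hasDerivAt_id r).div_const a).sub_const 1
  have h0 : ContDiff ℝ 1 (deriv Real.smoothTransition) := by
    have : ContDiff ℝ (1 + 1) Real.smoothTransition := by
      simpa [one_add_one_eq_two] using Real.smoothTransition.contDiff (n := (2 : ℕ∞))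
    exact (contDiff_succ_iff_deriv.1 this).2.2
  have h2 := ((h0.differentiable one_ne_zero (r / a - 1)).hasDerivAt.comp r h1).div_const a
  rw [show deriv (radialCutoff a) = fun r => deriv Real.smoothTransition (r / a - 1) / a from
    funext (deriv_radialCutoff a)]
  refine h2.congr_deriv ?_
  ring

theorem deriv_radialCutoff_eq_zero {a r : ℝ} (ha : 0 < a) (h : r < a ∨ 2 * a < r) :
    deriv (radialCutoff a) r = 0 := by
  rcases h with h | h
  · have : radialCutoff a =ᶠ[nhds r] fun _ => 0 := by
      filter_upwards [Iio_mem_nhds h] with s hs using radialCutoff_eq_zero ha (le_of_lt hs)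
    rw [this.deriv_eq, deriv_const]
  · have : radialCutoff a =ᶠ[nhds r] fun _ => 1 := by
      filter_upwards [Ioi_mem_nhds h] with s hs using radialCutoff_eq_one ha (le_of_lt hs)
    rw [this.deriv_eq, deriv_const]

/-- These values remove the boundary terms when the outer flux is integrated by parts over exactly
`[a, 2a]`. -/
theorem deriv_radialCutoff_endpoints {a : ℝ} (ha : 0 < a) :
    deriv (radialCutoff a) a = 0 ∧ deriv (radialCutoff a) (2 * a) = 0 := by
  have hc : Continuous (deriv (radialCutoff a)) :=
    (contDiff_radialCutoff a).continuous_deriv (by norm_num)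
  have hz : EqOn (deriv (radialCutoff a)) (fun _ => 0) (Iio a) := fun r hr =>
    deriv_radialCutoff_eq_zero ha (Or.inl hr)
  have hz' : EqOn (deriv (radialCutoff a)) (fun _ => 0) (Ioi (2 * a)) := fun r hr =>
    deriv_radialCutoff_eq_zero ha (Or.inr hr)
  constructor
  · exact hz.closure hc continuous_const (by rw [closure_Iio]; exact self_mem_Iic)
  · exact hz'.closure hc continuous_const (by rw [closure_Ioi]; exact self_mem_Ici)

/-! ### Bounds for the flux through the cutoff annuli -/

namespace IsFieldMode

variable {k : ℂ} {n : ℤ} {X₁ : ℝ} {X₂ : EReal} {f : ℝ → ℝ} {v₀ : ℝ → ℂ} {v vr : ℝ → ℝ → ℂ}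

theorem continuousOn_flux_slice (hf : IsBodyProfile X₁ X₂ f) (hv : IsFieldMode k n X₁ X₂ f v₀ v vr)
    (r' : ℝ) {x x' : ℝ} (h1 : X₁ < x) (h2 : (x : EReal) < X₂) (h3 : x < x') {η : ℝ → ℝ}
    (hη : Continuous η) : ContinuousOn (fun r => flux k n x' r' v vr η x r) (Ici (f x)) :=
  (hv.continuousOn_flux x' r' hη).comp (f := fun r => (x, r))
    (Continuous.continuousOn (by fun_prop)) fun _ hr => ⟨rear_slice hf h1 h2 hr, h3⟩

/-- The flux through the inner cutoff is controlled by the energy near the axis. -/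
theorem inner_flux_bound (hf : IsBodyProfile X₁ X₂ f) (hv : IsFieldMode k n X₁ X₂ f v₀ v vr)
    (hk : 0 < k.im) {r' : ℝ} (hr' : 0 ≤ r') {c x' : ℝ} (hcx : c < x') (hx'0 : (x' : EReal) < X₂) :
    ∃ D : ℝ, 0 ≤ D ∧ ∀ x ρ l : ℝ, X₁ < x → x ≤ c → 0 < ρ → 0 < l →
      ‖∫ r in Ioi (f x), flux k n x' r' v vr (deriv (radialCutoff ρ)) x r‖
        ≤ D * (1 / (2 * l) * (∫ r, energy X₁ X₂ f v vr x' (3 * ρ) (x, r)) + 9 * l) := by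
  obtain ⟨CT, hCT0, hCT⟩ := Real.smoothTransition.exists_deriv_bound
  obtain ⟨CG, hCG0, hCG⟩ := exists_modeGreen_bound hk n (a := X₁) hcx hr' 0
  refine ⟨CT * (1 / (2 * ‖k‖) * CG), by positivity, fun x ρ l hx hxc hρ hl => ?_⟩
  set D := CT * (1 / (2 * ‖k‖) * CG)
  have hD0 : 0 ≤ D := by positivity
  have hxx : x < x' := hxc.trans_lt hcx
  have h2 : (x : EReal) < X₂ := (EReal.coe_lt_coe_iff.2 hxx).trans hx'0
  have hf0 := hf.pos x hx h2
  -- The derivative of the cutoff vanishes beyond `2ρ`; the radius `3ρ` just leaves room for strict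
  -- inequalities.
  have hsub : ∫ r in Ioi (f x), flux k n x' r' v vr (deriv (radialCutoff ρ)) x r
      = ∫ r in Ioo (f x) (3 * ρ), flux k n x' r' v vr (deriv (radialCutoff ρ)) x r := by
    refine setIntegral_eq_of_subset_of_forall_sdiff_eq_zero measurableSet_Ioi
      (fun r hr => hr.1) fun r hr => ?_
    have h3 : 3 * ρ ≤ r := by
      by_contra h
      exact hr.2 ⟨hr.1, not_le.1 h⟩
    simp [flux, deriv_radialCutoff_eq_zero hρ (Or.inr (by linarith : 2 * ρ < r))]
  have cH : ContinuousOn (fun r => (‖vr x r‖ ^ 2 + ‖v x r‖ ^ 2) * r) (Icc (f x) (3 * ρ)) :=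
    ((((hv.continuousOn_slice_dr hf hx h2).norm.pow 2).add
      ((hv.continuousOn_slice hf hx h2).norm.pow 2)).mul continuousOn_id).mono Icc_subset_Ici_self
  have iH : IntegrableOn (fun r => (‖vr x r‖ ^ 2 + ‖v x r‖ ^ 2) * r) (Ioo (f x) (3 * ρ)) :=
    cH.integrableOn_Icc.mono_set Ioo_subset_Icc_self
  have iC : IntegrableOn (fun _ : ℝ => 3 * l / ρ) (Ioo (f x) (3 * ρ)) :=
    integrableOn_const (by simp)
  rw [hsub, integral_energy_slice hf hx hxx hx'0]
  refine (norm_integral_le_of_norm_le (g := fun r => D * (1 / (2 * l) *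
    ((‖vr x r‖ ^ 2 + ‖v x r‖ ^ 2) * r) + 3 * l / ρ)) ?_ ?_).trans ?_
  · exact ((iH.const_mul _).add iC).const_mul D
  · rw [ae_restrict_iff' measurableSet_Ioo]
    refine Filter.Eventually.of_forall fun r hr => ?_
    have hr0 : 0 < r := hf0.trans hr.1
    obtain ⟨g1, g2⟩ := hCG x r hx.le hxc hr0.le
    rw [zero_mul, neg_zero, Real.exp_zero, mul_one] at g1 g2
    have hd : |deriv (radialCutoff ρ) r| ≤ CT / ρ := by
      rw [deriv_radialCutoff, abs_div, abs_of_pos hρ]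
      gcongr
      exact (hCT _).1
    have hnk : ‖(1 / (2 * I * k) : ℂ)‖ = 1 / (2 * ‖k‖) := by simp
    have hin : ‖modeGreen k n x' r' x r * vr x r - v x r * modeGreenDr k n x' r' x r‖
        ≤ CG * (‖vr x r‖ + ‖v x r‖) := by
      refine (norm_sub_le _ _).trans ?_
      rw [norm_mul, norm_mul, mul_add, mul_comm ‖v x r‖]
      gcongr
    -- Young's inequality with a free parameter `l`. The energy alone would give a square root on
    -- each slice; the linear form can be integrated in `x` first and optimized in `l` afterwards.
    -- The constant part is integrated over a length of at most `3ρ`, which gives `9 l`.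
    have hyoung : r / ρ * (‖vr x r‖ + ‖v x r‖)
        ≤ 1 / (2 * l) * ((‖vr x r‖ ^ 2 + ‖v x r‖ ^ 2) * r) + 3 * l / ρ := by
      have hy : ∀ y : ℝ, y / ρ ≤ y ^ 2 / (2 * l) + l / (2 * ρ ^ 2) := fun y => by
        have : y ^ 2 / (2 * l) + l / (2 * ρ ^ 2) - y / ρ = (y - l / ρ) ^ 2 / (2 * l) := by
          field_simp
          ring
        have h3 : 0 ≤ (y - l / ρ) ^ 2 / (2 * l) := by positivity
        linarith
      have h3 : r * (l / ρ ^ 2) ≤ 3 * l / ρ := by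
        rw [mul_div_assoc', div_le_div_iff₀ (by positivity) hρ]
        have := hr.2
        nlinarith [mul_pos hl (mul_pos hρ hρ), mul_pos hl hρ]
      calc r / ρ * (‖vr x r‖ + ‖v x r‖) = r * (‖vr x r‖ / ρ + ‖v x r‖ / ρ) := by ring
        _ ≤ r * ((‖vr x r‖ ^ 2 / (2 * l) + l / (2 * ρ ^ 2))
              + (‖v x r‖ ^ 2 / (2 * l) + l / (2 * ρ ^ 2))) := by
            gcongr
            · exact hy _
            · exact hy _
        _ = 1 / (2 * l) * ((‖vr x r‖ ^ 2 + ‖v x r‖ ^ 2) * r) + r * (l / ρ ^ 2) := by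
            field_simp
            ring
        _ ≤ _ := by gcongr
    rw [flux, norm_mul, norm_mul, norm_mul, hnk, Complex.norm_real, Complex.norm_real,
      Real.norm_eq_abs, Real.norm_of_nonneg hr0.le]
    calc |deriv (radialCutoff ρ) r| * (1 / (2 * ‖k‖) * (r * ‖modeGreen k n x' r' x r * vr x r
          - v x r * modeGreenDr k n x' r' x r‖))
        ≤ CT / ρ * (1 / (2 * ‖k‖) * (r * (CG * (‖vr x r‖ + ‖v x r‖)))) := by gcongr
      _ = D * (r / ρ * (‖vr x r‖ + ‖v x r‖)) := by simp only [D]; ring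
      _ ≤ _ := by gcongr
  · rw [integral_const_mul, integral_add (iH.const_mul _) iC, integral_const_mul,
      setIntegral_const, smul_eq_mul]
    refine mul_le_mul_of_nonneg_left (add_le_add le_rfl ?_) hD0
    rw [measureReal_def, Real.volume_Ioo]
    have h4 : (ENNReal.ofReal (3 * ρ - f x)).toReal ≤ 3 * ρ := by
      rw [ENNReal.toReal_ofReal']
      exact max_le (by linarith) (by linarith)
    calc _ ≤ 3 * ρ * (3 * l / ρ) := by gcongr
      _ = 9 * l := by field_simp; norm_num

/-- The flux through the outer cutoff decays exponentially. -/
theorem outer_flux_bound (hf : IsBodyProfile X₁ X₂ f) (hv : IsFieldMode k n X₁ X₂ f v₀ v vr)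
    (hk : 0 < k.im) {r' : ℝ} (hr' : 0 ≤ r') {c x' : ℝ} (hcx : c < x') (hx'0 : (x' : EReal) < X₂) :
    ∃ D R : ℝ, 0 ≤ D ∧ ∀ x ρ : ℝ, X₁ < x → x ≤ c → R ≤ ρ →
      ‖∫ r in Ioi (f x), flux k n x' r' v vr (deriv (radialCutoff ρ)) x r‖
        ≤ D * (ρ * Real.exp (-ρ)) := by
  have hc : (c : EReal) < X₂ := (EReal.coe_lt_coe_iff.2 hcx).trans hx'0
  obtain ⟨CT, hCT0, hCT⟩ := Real.smoothTransition.exists_deriv_bound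
  obtain ⟨Cv, B, R₀, hCv0, hB0, hgr⟩ := hv.growth c hc
  -- The rate `B + 1` beats the growth `e^{Br}` of the field and leaves `e^{-r} ≤ e^{-ρ}`.
  obtain ⟨CG, hCG0, hCG⟩ := exists_modeGreen_bound hk n (a := X₁) hcx hr' (B + 1)
  obtain ⟨F, hF⟩ := isCompact_Icc.exists_bound_of_continuousOn (hf.continuousOn_Icc hc)
  -- The thresholds ensure the growth bound, `1/ρ ≤ 1`, and an annulus clear of the body. The factor
  -- `7 = 3 + 2 · 2` comes from the bounds `3 CT` for `w'` and `2 CT` for `w`.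
  refine ⟨1 / (2 * ‖k‖) * (7 * CT * CG * Cv), max (max R₀ 1) (F + 1), by positivity,
    fun x ρ hx hxc hρ => ?_⟩
  have hρR : R₀ ≤ ρ := ((le_max_left _ _).trans (le_max_left _ _)).trans hρ
  have hρ1 : 1 ≤ ρ := ((le_max_right _ _).trans (le_max_left _ _)).trans hρ
  have hρF : F + 1 ≤ ρ := (le_max_right _ _).trans hρ
  have hρ0 : 0 < ρ := by linarith
  have hxx : x < x' := hxc.trans_lt hcx
  have h2 : (x : EReal) < X₂ := (EReal.coe_lt_coe_iff.2 hxx).trans hx'0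
  have hfρ : f x < ρ := by
    have := (le_abs_self _).trans (hF x ⟨hx.le, hxc⟩)
    linarith
  have hle : ρ ≤ 2 * ρ := by linarith
  have hk0 : k ≠ 0 := fun h => by simp [h] at hk
  set T' := deriv Real.smoothTransition
  set T'' := deriv (deriv Real.smoothTransition)
  set w : ℝ → ℝ := fun r => r * deriv (radialCutoff ρ) r with hw
  set w' : ℝ → ℝ := fun r => deriv (radialCutoff ρ) r + r * (T'' (r / ρ - 1) / ρ ^ 2) with hw'
  set G : ℝ → ℂ := fun r => modeGreen k n x' r' x r with hG
  set Gr : ℝ → ℂ := fun r => modeGreenDr k n x' r' x r with hGr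
  have hsub : ∫ r in Ioi (f x), flux k n x' r' v vr (deriv (radialCutoff ρ)) x r
      = ∫ r in ρ..(2 * ρ), flux k n x' r' v vr (deriv (radialCutoff ρ)) x r := by
    rw [intervalIntegral.integral_of_le hle]
    refine setIntegral_eq_of_subset_of_forall_sdiff_eq_zero measurableSet_Ioi
      (fun r hr => hfρ.trans hr.1) fun r hr => ?_
    have h3 : deriv (radialCutoff ρ) r = 0 := by
      rcases lt_trichotomy r ρ with h | h | h
      · exact deriv_radialCutoff_eq_zero hρ0 (Or.inl h)
      · rw [h]; exact (deriv_radialCutoff_endpoints hρ0).1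
      · refine deriv_radialCutoff_eq_zero hρ0 (Or.inr ?_)
        by_contra h'
        exact hr.2 ⟨h, not_lt.1 h'⟩
    simp [flux, h3]
  have hwd : ∀ r, HasDerivAt (fun r => (w r : ℂ)) (w' r : ℂ) r := fun r => by
    have := (hasDerivAt_id r).fun_mul (hasDerivAt_deriv_radialCutoff ρ r)
    refine HasDerivAt.ofReal_comp (this.congr_deriv ?_)
    simp only [hw', id, one_mul, T'']
  have hT2 : Continuous T'' := by
    have h0 : ContDiff ℝ 1 (deriv Real.smoothTransition) := by
      have : ContDiff ℝ (1 + 1) Real.smoothTransition := by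
        simpa [one_add_one_eq_two] using Real.smoothTransition.contDiff (n := (2 : ℕ∞))
      exact (contDiff_succ_iff_deriv.1 this).2.2
    exact h0.continuous_deriv le_rfl
  have hcd : Continuous (deriv (radialCutoff ρ)) :=
    (contDiff_radialCutoff ρ).continuous_deriv (by norm_num)
  have cw : Continuous fun r => (w r : ℂ) := by
    simp only [hw]
    fun_prop
  have cw' : Continuous fun r => (w' r : ℂ) := by
    simp only [hw']
    fun_prop
  have cG : Continuous G := continuous_iff_continuousAt.2 fun r =>
    (hasDerivAt_modeGreen_r k n x' r' x r).continuousAt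
  have cGr : Continuous Gr := continuous_iff_continuousAt.2 fun r =>
    (hasDerivAt_modeGreenDr_r k n x' r' x r).continuousAt
  have hIcc : Icc ρ (2 * ρ) ⊆ Ici (f x) := fun r hr => hfρ.le.trans hr.1
  have cv : ContinuousOn (fun r => v x r) (Icc ρ (2 * ρ)) :=
    (hv.continuousOn_slice hf hx h2).mono hIcc
  have cvr : ContinuousOn (fun r => vr x r) (Icc ρ (2 * ρ)) :=
    (hv.continuousOn_slice_dr hf hx h2).mono hIcc
  have ii : ∀ {g : ℝ → ℂ}, ContinuousOn g (Icc ρ (2 * ρ)) →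
      IntervalIntegrable g volume ρ (2 * ρ) := fun hg =>
    ContinuousOn.intervalIntegrable (by rwa [uIcc_of_le hle])
  have i1 : IntervalIntegrable (fun r => ((w' r : ℂ) * G r + (w r : ℂ) * Gr r) * v x r
      + ((w r : ℂ) * G r) * vr x r) volume ρ (2 * ρ) :=
    ii ((((cw'.fun_mul cG).fun_add (cw.fun_mul cGr)).continuousOn.fun_mul cv).fun_add
      ((cw.fun_mul cG).continuousOn.fun_mul cvr))
  have i2 : IntervalIntegrable (fun r => ((w' r : ℂ) * G r + 2 * ((w r : ℂ) * Gr r)) * v x r)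
      volume ρ (2 * ρ) :=
    ii (((cw'.fun_mul cG).fun_add ((cw.fun_mul cGr).const_mul 2)).continuousOn.fun_mul cv)
  -- No bound on `vr` is available at infinity, so the radial derivative is moved from the field
  -- onto `w G` by an integration by parts, whose boundary terms vanish with `w`.
  have hftc : ∫ r in ρ..(2 * ρ), (((w' r : ℂ) * G r + (w r : ℂ) * Gr r) * v x r
      + ((w r : ℂ) * G r) * vr x r) = 0 := by
    rw [intervalIntegral.integral_eq_sub_of_hasDerivAt (f := fun r => (w r : ℂ) * G r * v x r)
      (fun r hr => ?_) i1]
    · simp [hw, (deriv_radialCutoff_endpoints hρ0).1, (deriv_radialCutoff_endpoints hρ0).2]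
    · rw [uIcc_of_le hle] at hr
      exact ((hwd r).fun_mul (hasDerivAt_modeGreen_r k n x' r' x r)).fun_mul
        (hv.hasDerivAt x r hx (interior_slice hf hx h2 (hfρ.trans_le hr.1)))
  have hflux : ∫ r in ρ..(2 * ρ), flux k n x' r' v vr (deriv (radialCutoff ρ)) x r
      = -(1 / (2 * I * k)) * ∫ r in ρ..(2 * ρ),
        ((w' r : ℂ) * G r + 2 * ((w r : ℂ) * Gr r)) * v x r := by
    have : ∀ r, flux k n x' r' v vr (deriv (radialCutoff ρ)) x r = 1 / (2 * I * k) *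
        ((((w' r : ℂ) * G r + (w r : ℂ) * Gr r) * v x r + ((w r : ℂ) * G r) * vr x r)
          - ((w' r : ℂ) * G r + 2 * ((w r : ℂ) * Gr r)) * v x r) := fun r => by
      simp only [flux, hw, hG, hGr]
      push_cast
      ring
    simp only [this]
    rw [intervalIntegral.integral_const_mul, intervalIntegral.integral_sub i1 i2, hftc]
    ring
  rw [hsub, hflux, norm_mul, norm_neg]
  have hbd := intervalIntegral.norm_integral_le_of_norm_le_const (a := ρ) (b := 2 * ρ)
    (f := fun r => ((w' r : ℂ) * G r + 2 * ((w r : ℂ) * Gr r)) * v x r)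
    (C := 7 * CT * CG * Cv * Real.exp (-ρ)) (fun r hr => ?_)
  · rw [show 2 * ρ - ρ = ρ by ring, abs_of_pos hρ0] at hbd
    calc _ ≤ 1 / (2 * ‖k‖) * (7 * CT * CG * Cv * Real.exp (-ρ) * ρ) :=
          mul_le_mul (by simp) hbd (norm_nonneg _) (by positivity)
      _ = _ := by ring
  · rw [uIoc_of_le hle] at hr
    have hr0 : 0 < r := hρ0.trans hr.1
    obtain ⟨g1, g2⟩ := hCG x r hx.le hxc hr0.le
    have g3 := hgr x r (interior_slice hf hx h2 (hfρ.trans hr.1)) hxc (hρR.trans hr.1.le)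
    have hd : |deriv (radialCutoff ρ) r| ≤ CT / ρ := by
      rw [deriv_radialCutoff, abs_div, abs_of_pos hρ0]
      gcongr
      exact (hCT _).1
    have hwb : ‖(w r : ℂ)‖ ≤ 2 * CT := by
      rw [Complex.norm_real, Real.norm_eq_abs, hw, abs_mul, abs_of_pos hr0]
      calc r * |deriv (radialCutoff ρ) r| ≤ (2 * ρ) * (CT / ρ) := by
            gcongr
            exact hr.2
        _ = 2 * CT := by field_simp
    have hwb' : ‖(w' r : ℂ)‖ ≤ 3 * CT := by
      rw [Complex.norm_real, Real.norm_eq_abs]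
      refine (abs_add_le _ _).trans ?_
      have e1 : CT / ρ ≤ CT := div_le_self hCT0 hρ1
      have e2 : |r * (T'' (r / ρ - 1) / ρ ^ 2)| ≤ 2 * CT := by
        rw [abs_mul, abs_div, abs_of_pos hr0, abs_of_pos (by positivity : 0 < ρ ^ 2)]
        calc r * (|T'' (r / ρ - 1)| / ρ ^ 2) ≤ (2 * ρ) * (CT / ρ ^ 2) := by
              gcongr
              · exact hr.2
              · exact (hCT _).2
          _ = 2 * (CT / ρ) := by field_simp
          _ ≤ 2 * CT := by gcongr
      linarith
    have hexp : Real.exp (-((B + 1) * r)) * Real.exp (B * r) ≤ Real.exp (-ρ) := by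
      rw [← Real.exp_add]
      gcongr
      have := hr.1
      linarith
    rw [norm_mul]
    calc ‖(w' r : ℂ) * G r + 2 * ((w r : ℂ) * Gr r)‖ * ‖v x r‖
        ≤ (3 * CT * (CG * Real.exp (-((B + 1) * r)))
            + 2 * (2 * CT * (CG * Real.exp (-((B + 1) * r))))) * (Cv * Real.exp (B * r)) := by
          gcongr
          refine (norm_add_le _ _).trans ?_
          rw [norm_mul, norm_mul, norm_mul, RCLike.norm_ofNat]
          gcongr
      _ = 7 * CT * CG * Cv * (Real.exp (-((B + 1) * r)) * Real.exp (B * r)) := by ring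
      _ ≤ _ := by gcongr

end IsFieldMode


/-! ### Removal of the cutoff -/

/-- The cutoff that vanishes near the axis and near infinity. -/
def annularCutoff (N : ℕ) (r : ℝ) : ℝ :=
  radialCutoff (1 / ((N : ℝ) + 1)) r - radialCutoff ((N : ℝ) + 1) r

theorem abs_annularCutoff_le (N : ℕ) (r : ℝ) : |annularCutoff N r| ≤ 1 := by
  have h1 : ∀ a : ℝ, 0 ≤ radialCutoff a r := fun a => Real.smoothTransition.nonneg _
  have h2 : ∀ a : ℝ, radialCutoff a r ≤ 1 := fun a => Real.smoothTransition.le_one _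
  rw [annularCutoff, abs_le]
  constructor <;> linarith [h1 (1 / ((N : ℝ) + 1)), h1 ((N : ℝ) + 1), h2 (1 / ((N : ℝ) + 1)),
    h2 ((N : ℝ) + 1)]

theorem contDiff_annularCutoff (N : ℕ) : ContDiff ℝ 1 (annularCutoff N) :=
  ((contDiff_radialCutoff _).sub (contDiff_radialCutoff _)).of_le (by norm_num)

theorem tendsto_annularCutoff {r : ℝ} (hr : 0 < r) :
    Filter.Tendsto (fun N => annularCutoff N r) Filter.atTop (nhds 1) := by
  have hN : Filter.Tendsto (fun N : ℕ => (N : ℝ)) Filter.atTop Filter.atTop :=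
    tendsto_natCast_atTop_atTop
  refine tendsto_const_nhds.congr' ?_
  filter_upwards [hN.eventually_ge_atTop r, hN.eventually_ge_atTop (2 / r)] with N h1 h2
  have hN0 : (0 : ℝ) < N + 1 := by positivity
  rw [annularCutoff, radialCutoff_eq_zero hN0 (by linarith), radialCutoff_eq_one (by positivity),
    sub_zero]
  rw [mul_one_div, div_le_iff₀ hN0]
  rw [div_le_iff₀ hr] at h2
  nlinarith

/-- Dominated convergence, with a general radius function `φ`: it is the coordinate `r` on the two
cross-sections and `f x` on the surface. -/
theorem tendsto_integral_annularCutoff {α : Type*} [MeasurableSpace α] {μ : Measure α}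
    {φ : α → ℝ} {h : α → ℂ} (hφ : AEStronglyMeasurable φ μ) (hpos : ∀ᵐ x ∂μ, 0 < φ x)
    (hh : Integrable h μ) :
    Filter.Tendsto (fun N => ∫ x, (annularCutoff N (φ x) : ℂ) * h x ∂μ) Filter.atTop
      (nhds (∫ x, h x ∂μ)) := by
  refine tendsto_integral_of_dominated_convergence (fun x => ‖h x‖) (fun N => ?_) hh.norm
    (fun N => ?_) ?_
  · exact (Complex.continuous_ofReal.comp_aestronglyMeasurable
      ((contDiff_annularCutoff N).continuous.comp_aestronglyMeasurable hφ)).mul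
      hh.aestronglyMeasurable
  · refine Filter.Eventually.of_forall fun x => ?_
    rw [norm_mul, Complex.norm_real, Real.norm_eq_abs]
    exact mul_le_of_le_one_left (norm_nonneg _) (abs_annularCutoff_le N _)
  · filter_upwards [hpos] with x hx
    have := (Complex.continuous_ofReal.tendsto 1).comp (tendsto_annularCutoff hx)
    simpa using this.mul_const (h x)

/-- The Green mode is taken with decay rate `B + 2`: one unit pays for the weight `r ≤ e^r`, `B` for
the growth of `w`, and one unit is left for integrability. -/
theorem integrableOn_weighted_modeGreen {k : ℂ} (hk : 0 < k.im) (n : ℤ) {x x' r' a C B : ℝ}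
    (hx : x < x') (hr' : 0 ≤ r') (ha : 0 ≤ a) {w : ℝ → ℂ} (hw : ContinuousOn w (Ioi a))
    (hC : 0 ≤ C) (hB : ∀ r, a < r → ‖w r‖ ≤ C * Real.exp (B * r)) :
    IntegrableOn (fun r : ℝ => (r : ℂ) * (w r * modeGreen k n x' r' x r)) (Ioi a) := by
  obtain ⟨CG, hCG0, hCG⟩ := exists_modeGreen_bound hk n (a := x) hx hr' (B + 2)
  have hint : IntegrableOn (fun r : ℝ => C * CG * Real.exp (-1 * r)) (Ioi a) :=
    Integrable.const_mul (exp_neg_integrableOn_Ioi a one_pos) _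
  refine Integrable.mono' hint ?_ ?_
  · refine ContinuousOn.aestronglyMeasurable ?_ measurableSet_Ioi
    have cG : Continuous fun r => modeGreen k n x' r' x r := continuous_iff_continuousAt.2 fun r =>
      (hasDerivAt_modeGreen_r k n x' r' x r).continuousAt
    exact Complex.continuous_ofReal.continuousOn.fun_mul (hw.fun_mul cG.continuousOn)
  · rw [ae_restrict_iff' measurableSet_Ioi]
    refine Filter.Eventually.of_forall fun r hr => ?_
    have hr0 : 0 ≤ r := ha.trans (le_of_lt hr)
    have g1 := (hCG x r le_rfl le_rfl hr0).1
    have g2 := hB r hr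
    have g3 : r ≤ Real.exp r := by linarith [Real.add_one_le_exp r]
    rw [norm_mul, norm_mul, Complex.norm_real, Real.norm_of_nonneg hr0]
    calc r * (‖w r‖ * ‖modeGreen k n x' r' x r‖)
        ≤ Real.exp r * (C * Real.exp (B * r) * (CG * Real.exp (-((B + 2) * r)))) := by gcongr
      _ = C * CG * (Real.exp r * Real.exp (B * r) * Real.exp (-((B + 2) * r))) := by ring
      _ = _ := by
        rw [← Real.exp_add, ← Real.exp_add]
        congr 2
        ring

namespace IsFieldMode

variable {k : ℂ} {n : ℤ} {X₁ : ℝ} {X₂ : EReal} {f : ℝ → ℝ} {v₀ : ℝ → ℂ} {v vr : ℝ → ℝ → ℂ}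

/-- Away from the tip the strip between the surface and the far region is the image of a compact
rectangle under the shear, and `v` is continuous on it; beyond the strip the growth condition
applies. -/
theorem exists_growth_bound (hf : IsBodyProfile X₁ X₂ f) (hv : IsFieldMode k n X₁ X₂ f v₀ v vr)
    {a b : ℝ} (ha : X₁ < a) (hb : (b : EReal) < X₂) :
    ∃ C B : ℝ, 0 ≤ C ∧ 0 ≤ B ∧ ∀ x r : ℝ, a ≤ x → x ≤ b → f x ≤ r →
      ‖v x r‖ ≤ C * Real.exp (B * r) := by
  obtain ⟨C, B, R, hC, hB, hgr⟩ := hv.growth b hb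
  have hmem : ∀ x ∈ Icc a b, X₁ < x ∧ (x : EReal) < X₂ := fun x hx =>
    ⟨ha.trans_le hx.1, (EReal.coe_le_coe_iff.2 hx.2).trans_lt hb⟩
  have hfc : ContinuousOn f (Icc a b) := (hf.continuousOn_Icc hb).mono (Icc_subset_Icc_left ha.le)
  have hcont : ContinuousOn (fun p : ℝ × ℝ => v p.1 (f p.1 + p.2)) (Icc a b ×ˢ Icc 0 |R|) := by
    refine hv.continuousOn.comp (f := fun p : ℝ × ℝ => (p.1, f p.1 + p.2)) ?_ fun p hp => ?_
    · exact continuousOn_fst.prodMk ((hfc.comp continuousOn_fst fun p hp => hp.1).add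
        continuousOn_snd)
    · obtain ⟨h1, h2⟩ := hmem p.1 hp.1
      exact rear_slice hf h1 h2 (by linarith [hp.2.1])
  obtain ⟨C', hC'⟩ := (isCompact_Icc.prod isCompact_Icc).exists_bound_of_continuousOn hcont
  refine ⟨max C C', B, hC.trans (le_max_left _ _), hB, fun x r h1 h2 hr => ?_⟩
  obtain ⟨h3, h4⟩ := hmem x ⟨h1, h2⟩
  have hf0 := hf.pos x h3 h4
  rcases le_or_gt r (f x + |R|) with hr' | hr'
  · have := hC' (x, r - f x) ⟨⟨h1, h2⟩, by simp [hr], by simp; linarith⟩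
    simp only [add_sub_cancel] at this
    have he : 1 ≤ Real.exp (B * r) := Real.one_le_exp (by
      have : 0 ≤ r := hf0.le.trans hr
      positivity)
    calc ‖v x r‖ ≤ max C C' := this.trans (le_max_right _ _)
      _ ≤ _ := le_mul_of_one_le_right (hC.trans (le_max_left _ _)) he
  · have h5 : f x < r := by linarith [abs_nonneg R]
    refine (hgr x r (interior_slice hf h3 h4 h5) h2 (by linarith [le_abs_self R])).trans ?_
    gcongr
    exact le_max_left _ _

theorem exists_growth_bound_initial (hf : IsBodyProfile X₁ X₂ f)
    (hv : IsFieldMode k n X₁ X₂ f v₀ v vr) (hX : (X₁ : EReal) < X₂) (hv₀ : Continuous v₀) :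
    ∃ C B : ℝ, 0 ≤ C ∧ 0 ≤ B ∧ ∀ r : ℝ, 0 < r → ‖v₀ r‖ ≤ C * Real.exp (B * r) := by
  obtain ⟨C, B, R, hC, hB, hgr⟩ := hv.growth X₁ hX
  obtain ⟨C', hC'⟩ := (isCompact_Icc (a := (0 : ℝ)) (b := R)).exists_bound_of_continuousOn
    hv₀.continuousOn
  refine ⟨max C C', B, hC.trans (le_max_left _ _), hB, fun r hr => ?_⟩
  rcases le_or_gt r R with h | h
  · have he : 1 ≤ Real.exp (B * r) := Real.one_le_exp (by positivity)
    calc ‖v₀ r‖ ≤ max C C' := (hC' r ⟨hr.le, h⟩).trans (le_max_right _ _)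
      _ ≤ _ := le_mul_of_one_le_right (hC.trans (le_max_left _ _)) he
  · rw [← hv.initial r hr]
    refine (hgr X₁ r ⟨hX, hr, fun _ => by rw [hf.tip]; exact hr⟩ le_rfl h.le).trans ?_
    gcongr
    exact le_max_left _ _

/-- The regions shrink to the axis, where the exterior has no points, so dominated convergence by
the energy in `r < 3` applies. -/
theorem tendsto_integral_energy (hf : IsBodyProfile X₁ X₂ f)
    (hv : IsFieldMode k n X₁ X₂ f v₀ v vr) {b : ℝ} (hb : (b : EReal) < X₂) :
    Filter.Tendsto (fun N : ℕ => ∫ x, ∫ r, energy X₁ X₂ f v vr b (3 * (1 / ((N : ℝ) + 1))) (x, r))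
      Filter.atTop (nhds 0) := by
  have h1 : ∀ N : ℕ, ∫ x, ∫ r, energy X₁ X₂ f v vr b (3 * (1 / ((N : ℝ) + 1))) (x, r)
      = ∫ p, energy X₁ X₂ f v vr b (3 * (1 / ((N : ℝ) + 1))) p := fun N => by
    have := hv.integrable_energy hf hb (3 * (1 / ((N : ℝ) + 1)))
    rw [Measure.volume_eq_prod] at this ⊢
    exact (integral_prod _ this).symm
  simp only [h1]
  rw [← integral_zero (ℝ × ℝ) ℝ]
  refine tendsto_integral_of_dominated_convergence (energy X₁ X₂ f v vr b 3)
    (fun N => (hv.integrable_energy hf hb _).aestronglyMeasurable)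
    (hv.integrable_energy hf hb 3) (fun N => Filter.Eventually.of_forall fun p => ?_)
    (Filter.Eventually.of_forall fun p => ?_)
  · rw [Real.norm_of_nonneg (energy_nonneg _ _ _)]
    have hN : (3 : ℝ) * (1 / ((N : ℝ) + 1)) ≤ 3 := by
      have : (1 : ℝ) / ((N : ℝ) + 1) ≤ 1 := by
        rw [div_le_one (by positivity)]
        linarith [(Nat.cast_nonneg N : (0 : ℝ) ≤ N)]
      linarith
    rw [energy]
    by_cases hp : p ∈ {p : ℝ × ℝ | p ∈ planarExterior X₁ X₂ f ∧ X₁ < p.1 ∧ p.1 < b ∧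
        p.2 < 3 * (1 / ((N : ℝ) + 1))}
    · rw [indicator_of_mem hp, energy, indicator_of_mem]
      exact ⟨hp.1, hp.2.1, hp.2.2.1, hp.2.2.2.trans_le hN⟩
    · rw [indicator_of_notMem hp]
      exact energy_nonneg _ _ _
  · by_cases hp : 0 < p.2
    · refine tendsto_const_nhds.congr' ?_
      have tN : Filter.Tendsto (fun N : ℕ => 3 * ((1 : ℝ) / ((N : ℝ) + 1))) Filter.atTop
          (nhds 0) := by
        simpa using tendsto_one_div_add_atTop_nhds_zero_nat.const_mul (3 : ℝ)
      filter_upwards [tN.eventually_lt_const hp] with N hN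
      rw [energy, indicator_of_notMem]
      exact fun h => not_lt.2 hN.le h.2.2.2
    · refine tendsto_const_nhds.congr fun N => ?_
      rw [energy, indicator_of_notMem]
      exact fun h => hp h.1.2.1

/-- Green's identity on the exterior of the body, without cutoff. -/
theorem green_identity_exterior (hf : IsBodyProfile X₁ X₂ f)
    (hv : IsFieldMode k n X₁ X₂ f v₀ v vr) (hk : 0 < k.im) (hv₀ : Continuous v₀) {r' : ℝ}
    (hr' : 0 ≤ r') {c x' : ℝ} (hXc : X₁ < c) (hcx : c < x') (hx'0 : (x' : EReal) < X₂) :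
    (∫ r in Ioi (f c), (r : ℂ) * (v c r * modeGreen k n x' r' c r))
        - ∫ r in Ioi (0 : ℝ), (r : ℂ) * (v₀ r * modeGreen k n x' r' X₁ r)
      = 1 / 2 * ∫ x in X₁..c, boundaryTerm k n f v x' r' x := by
  have hc : (c : EReal) < X₂ := (EReal.coe_lt_coe_iff.2 hcx).trans hx'0
  have hX : (X₁ : EReal) < X₂ := (EReal.coe_lt_coe_iff.2 hXc).trans hc
  have hk0 : k ≠ 0 := fun h => by simp [h] at hk
  have hfc0 := hf.pos c hXc hc
  obtain ⟨C, B, hC, hB, hgr⟩ := hv.exists_growth_bound hf hXc hc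
  obtain ⟨C', B', hC', hB', hgr'⟩ := hv.exists_growth_bound_initial hf hX hv₀
  have t1 := tendsto_integral_annularCutoff (μ := volume.restrict (Ioi (f c))) (φ := fun r => r)
    continuous_id.aestronglyMeasurable
    ((ae_restrict_iff' measurableSet_Ioi).2 (Filter.Eventually.of_forall fun r hr => hfc0.trans hr))
    (integrableOn_weighted_modeGreen hk n (r' := r') hcx hr' hfc0.le
      ((hv.continuousOn_slice hf hXc hc).mono Ioi_subset_Ici_self) hC
      fun r hr => hgr c r le_rfl le_rfl (le_of_lt hr))
  have t2 := tendsto_integral_annularCutoff (μ := volume.restrict (Ioi (0 : ℝ))) (φ := fun r => r)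
    continuous_id.aestronglyMeasurable
    ((ae_restrict_iff' measurableSet_Ioi).2 (Filter.Eventually.of_forall fun r hr => hr))
    (integrableOn_weighted_modeGreen hk n (r' := r') (hXc.trans hcx) hr' le_rfl hv₀.continuousOn hC'
      hgr')
  have t3 := tendsto_integral_annularCutoff (μ := volume.restrict (Ioc X₁ c)) (φ := f)
    (((hf.continuousOn_Icc hc).mono Ioc_subset_Icc_self).aestronglyMeasurable measurableSet_Ioc)
    ((ae_restrict_iff' measurableSet_Ioc).2 (Filter.Eventually.of_forall fun x hx =>
      hf.pos x hx.1 ((EReal.coe_le_coe_iff.2 hx.2).trans_lt hc)))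
    (hv.integrableOn_boundaryTerm hf r' hcx hx'0)
  obtain ⟨D, hD0, hD⟩ := hv.inner_flux_bound hf hk hr' hcx hx'0
  obtain ⟨D', R, hD'0, hD'⟩ := hv.outer_flux_bound hf hk hr' hcx hx'0
  have hflux : ∀ N : ℕ, ∀ x ∈ Ioc X₁ c, R ≤ N →
      ∀ l : ℝ, 0 < l → ‖∫ r in Ioi (f x), flux k n x' r' v vr (deriv (annularCutoff N)) x r‖
        ≤ D * (1 / (2 * l) * (∫ r, energy X₁ X₂ f v vr x' (3 * (1 / ((N : ℝ) + 1))) (x, r))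
          + 9 * l) + D' * (((N : ℝ) + 1) * Real.exp (-((N : ℝ) + 1))) := by
    intro N x hx hN l hl
    have hxx : x < x' := hx.2.trans_lt hcx
    have h2 : (x : EReal) < X₂ := (EReal.coe_lt_coe_iff.2 hxx).trans hx'0
    have hi : ∀ a : ℝ, 0 < a →
        IntegrableOn (fun r => flux k n x' r' v vr (deriv (radialCutoff a)) x r) (Ioi (f x)) := by
      intro a ha
      have h3 : IntegrableOn (fun r => flux k n x' r' v vr (deriv (radialCutoff a)) x r)
          (Icc (f x) (2 * a)) :=
        ((hv.continuousOn_flux_slice hf r' hx.1 h2 hxx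
          ((contDiff_radialCutoff a).continuous_deriv (by norm_num))).mono
          Icc_subset_Ici_self).integrableOn_Icc
      refine h3.of_forall_sdiff_eq_zero measurableSet_Ioi fun r hr => ?_
      have h4 : 2 * a < r := by
        by_contra h
        exact hr.2 ⟨le_of_lt hr.1, not_lt.1 h⟩
      simp [flux, deriv_radialCutoff_eq_zero ha (Or.inr h4)]
    have hN0 : (0 : ℝ) < N + 1 := by positivity
    have hder : ∀ r, deriv (annularCutoff N) r = deriv (radialCutoff (1 / ((N : ℝ) + 1))) r
        - deriv (radialCutoff ((N : ℝ) + 1)) r := fun r =>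
      deriv_fun_sub ((contDiff_radialCutoff _).differentiable (by norm_num) r)
        ((contDiff_radialCutoff _).differentiable (by norm_num) r)
    have hsplit : ∀ r, flux k n x' r' v vr (deriv (annularCutoff N)) x r
        = flux k n x' r' v vr (deriv (radialCutoff (1 / ((N : ℝ) + 1)))) x r
          - flux k n x' r' v vr (deriv (radialCutoff ((N : ℝ) + 1))) x r := fun r => by
      simp only [flux, hder]
      push_cast
      ring
    simp only [hsplit]
    rw [integral_sub (hi _ (by positivity)) (hi _ hN0)]
    exact (norm_sub_le _ _).trans (add_le_add (hD x _ l hx.1 hx.2 (by positivity) hl)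
      (hD' x _ hx.1 hx.2 (by linarith)))
  set J : ℕ → ℝ := fun N =>
    ∫ x, ∫ r, energy X₁ X₂ f v vr x' (3 * (1 / ((N : ℝ) + 1))) (x, r) with hJ
  have hJ0 : ∀ N, 0 ≤ J N := fun N => integral_nonneg fun x => integral_nonneg fun r =>
    energy_nonneg _ _ _
  -- The parameter of Young's inequality is of the order of `√J`, which balances `J / l` against
  -- `l`; the summand `1/(N+1)` only keeps it positive when the energy vanishes.
  set l : ℕ → ℝ := fun N => √(J N) + 1 / ((N : ℝ) + 1) with hl
  have hl0 : ∀ N, 0 < l N := fun N => by positivity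
  have herr : ∀ N : ℕ, R ≤ N →
      ‖∫ x in X₁..c, ∫ r in Ioi (f x), flux k n x' r' v vr (deriv (annularCutoff N)) x r‖
        ≤ D * (√(J N) / 2 + 9 * l N * (c - X₁))
          + D' * (((N : ℝ) + 1) * Real.exp (-((N : ℝ) + 1))) * (c - X₁) := by
    intro N hN
    have iE := hv.integrable_energy_slice hf hx'0 (3 * (1 / ((N : ℝ) + 1)))
    have iI : IntervalIntegrable (fun x =>
        ∫ r, energy X₁ X₂ f v vr x' (3 * (1 / ((N : ℝ) + 1))) (x, r)) volume X₁ c :=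
      iE.intervalIntegrable
    have hb := intervalIntegral.norm_integral_le_of_norm_le hXc.le
      (Filter.Eventually.of_forall fun x hx => hflux N x hx hN (l N) (hl0 N))
      ((((iI.const_mul _).add intervalIntegrable_const).const_mul D).add intervalIntegrable_const)
    refine hb.trans ?_
    rw [intervalIntegral.integral_add
      (((iI.const_mul _).add intervalIntegrable_const).const_mul D) intervalIntegrable_const,
      intervalIntegral.integral_const_mul,
      intervalIntegral.integral_add (iI.const_mul _) intervalIntegrable_const,
      intervalIntegral.integral_const_mul, intervalIntegral.integral_const,
      intervalIntegral.integral_const, smul_eq_mul, smul_eq_mul]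
    have h1 : ∫ x in X₁..c, ∫ r, energy X₁ X₂ f v vr x' (3 * (1 / ((N : ℝ) + 1))) (x, r) ≤ J N := by
      rw [intervalIntegral.integral_of_le hXc.le]
      exact setIntegral_le_integral iE (Filter.Eventually.of_forall fun x => integral_nonneg
        fun r => energy_nonneg _ _ _)
    have h2 : 1 / (2 * l N) * J N ≤ √(J N) / 2 := by
      rw [one_div_mul_eq_div, div_le_div_iff₀ (by linarith [hl0 N]) two_pos]
      have h3 : √(J N) * √(J N) = J N := Real.mul_self_sqrt (hJ0 N)
      have h4 : √(J N) ≤ l N := by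
        simp only [hl]
        linarith [(by positivity : (0 : ℝ) < 1 / ((N : ℝ) + 1))]
      nlinarith [mul_le_mul_of_nonneg_left h4 (Real.sqrt_nonneg (J N))]
    have h3 : 1 / (2 * l N) * (∫ x in X₁..c,
        ∫ r, energy X₁ X₂ f v vr x' (3 * (1 / ((N : ℝ) + 1))) (x, r)) ≤ √(J N) / 2 :=
      (mul_le_mul_of_nonneg_left h1 (by have := hl0 N; positivity)).trans h2
    rw [mul_comm (c - X₁) (9 * l N), mul_comm (c - X₁)]
    gcongr
  have tJ : Filter.Tendsto J Filter.atTop (nhds 0) := hv.tendsto_integral_energy hf hx'0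
  have tsJ : Filter.Tendsto (fun N => √(J N)) Filter.atTop (nhds 0) := by
    simpa [Function.comp_def] using (Real.continuous_sqrt.tendsto 0).comp tJ
  have tN : Filter.Tendsto (fun N : ℕ => (1 : ℝ) / ((N : ℝ) + 1)) Filter.atTop (nhds 0) :=
    tendsto_one_div_add_atTop_nhds_zero_nat
  have tl : Filter.Tendsto l Filter.atTop (nhds 0) := by
    simpa only [add_zero] using tsJ.add tN
  have te : Filter.Tendsto (fun N : ℕ => ((N : ℝ) + 1) * Real.exp (-((N : ℝ) + 1))) Filter.atTop
      (nhds 0) := by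
    have := Real.tendsto_pow_mul_exp_neg_atTop_nhds_zero 1
    have hN : Filter.Tendsto (fun N : ℕ => (N : ℝ) + 1) Filter.atTop Filter.atTop :=
      Filter.tendsto_atTop_add_const_right _ _ tendsto_natCast_atTop_atTop
    simpa only [Function.comp_def, pow_one] using this.comp hN
  have t4 : Filter.Tendsto (fun N : ℕ => ∫ x in X₁..c, ∫ r in Ioi (f x),
      flux k n x' r' v vr (deriv (annularCutoff N)) x r) Filter.atTop (nhds 0) := by
    refine squeeze_zero_norm' ?_ (?_ : Filter.Tendsto (fun N : ℕ =>
      D * (√(J N) / 2 + 9 * l N * (c - X₁))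
          + D' * (((N : ℝ) + 1) * Real.exp (-((N : ℝ) + 1))) * (c - X₁)) Filter.atTop (nhds 0))
    · have hN : Filter.Tendsto (fun N : ℕ => (N : ℝ)) Filter.atTop Filter.atTop :=
        tendsto_natCast_atTop_atTop
      filter_upwards [hN.eventually_ge_atTop R] with N hN using herr N hN
    · have := ((((tsJ.div_const 2).add ((tl.const_mul 9).mul_const (c - X₁))).const_mul D).add
        ((te.const_mul D').mul_const (c - X₁)))
      simpa using this
  have hid : ∀ N : ℕ, (∫ r in Ioi (f c), density k n x' r' v (annularCutoff N) c r)
        - ∫ r in Ioi 0, density k n x' r' v (annularCutoff N) X₁ r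
      = (∫ x in X₁..c, 1 / 2 * ((annularCutoff N (f x) : ℂ) * boundaryTerm k n f v x' r' x))
        + ∫ x in X₁..c, ∫ r in Ioi (f x),
            flux k n x' r' v vr (deriv (annularCutoff N)) x r := fun N => by
    have hN0 : (0 : ℝ) < N + 1 := by positivity
    have hle : 1 / ((N : ℝ) + 1) ≤ (N : ℝ) + 1 := by
      rw [div_le_iff₀ hN0]
      nlinarith [(Nat.cast_nonneg N : (0 : ℝ) ≤ N)]
    refine hv.green_identity hf hk0 r' hXc hcx hc (contDiff_annularCutoff N)
      (ρ := 1 / ((N : ℝ) + 1)) (R := 2 * ((N : ℝ) + 1)) (by positivity) (fun r hr => ?_)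
      (by positivity) fun r hr => ?_
    · rw [annularCutoff, radialCutoff_eq_zero (by positivity) hr,
        radialCutoff_eq_zero hN0 (hr.trans hle), sub_zero]
    · rw [annularCutoff, radialCutoff_eq_one hN0 hr, radialCutoff_eq_one (by positivity)
        (by linarith), sub_self]
  -- The cutoff identities converge term by term, and the error flux tends to zero.
  refine tendsto_nhds_unique (t1.sub t2) ?_
  have t5 := (t3.const_mul (1 / 2)).add t4
  rw [add_zero, ← intervalIntegral.integral_of_le hXc.le] at t5
  refine t5.congr fun N => ?_
  rw [← intervalIntegral.integral_of_le hXc.le, ← intervalIntegral.integral_const_mul, ← hid N]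
  congr 1
  refine setIntegral_congr_fun measurableSet_Ioi fun r hr => ?_
  simp only [density, hv.initial r hr]

end IsFieldMode


/-! ### The Green's function in the transversal plane -/

/-- The Green's function of the parabolic equation as a function on the transversal plane. -/
def planarGreen (k : ℂ) (D : ℝ) (z : ℂ) : ℂ :=
  k / (2 * Real.pi * I * (D : ℂ)) * exp (-(-(I * k) / (2 * (D : ℂ))) * (‖z‖ : ℂ) ^ 2)

theorem norm_sub_ofReal_sq_polar (r φ r' : ℝ) :
    ‖(r : ℂ) * (Real.cos φ + Real.sin φ * I) - r'‖ ^ 2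
      = r' ^ 2 + r ^ 2 - 2 * r' * r * Real.cos φ := by
  rw [← normSq_eq_norm_sq, normSq_apply]
  simp [-ofReal_cos, -ofReal_sin]
  linear_combination r ^ 2 * Real.sin_sq_add_cos_sq φ

theorem planarGreen_polar (k : ℂ) {x x' : ℝ} (h : x < x') (r φ r' : ℝ) :
    planarGreen k (x' - x) ((r : ℂ) * (Real.cos φ + Real.sin φ * I) - r')
      = parabolicGreen k x' r' φ x r 0 := by
  rw [planarGreen, parabolicGreen, if_pos h, sub_zero, ← Complex.ofReal_pow,
    norm_sub_ofReal_sq_polar]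
  have hD : (x' : ℂ) - x ≠ 0 := by exact_mod_cast (sub_pos.2 h).ne'
  congr 2
  push_cast
  field_simp

/-- The definition of `G` as an angular integral, read backwards in polar coordinates. In the plane
the Green's function is an explicit Gaussian, so translation, scaling and the Fourier transform
become available. -/
theorem integral_Ioi_modeGreen {k : ℂ} (hk : 0 < k.im) (n : ℤ) {x x' r' a C B : ℝ}
    (hx : x < x') (hr' : 0 ≤ r') (ha : 0 ≤ a) {w : ℝ → ℂ} (hw : ContinuousOn w (Ioi a))
    (hC : 0 ≤ C) (hB : ∀ r, a < r → ‖w r‖ ≤ C * Real.exp (B * r)) :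
    ∫ r in Ioi a, (r : ℂ) * (w r * modeGreen k n x' r' x r)
      = ∫ z : ℂ, indicator {z : ℂ | a < ‖z‖}
        (fun z => w ‖z‖ * exp (I * n * (arg z : ℂ)) * planarGreen k (x' - x) (z - r')) z := by
  have hD := sub_pos.2 hx
  have hpi := Real.pi_pos
  set h : ℝ × ℝ → ℂ := fun p => (p.1 : ℂ) * (w p.1 * (exp (I * n * (p.2 : ℂ)) *
    parabolicGreen k x' r' p.2 x p.1 0)) with hh
  rw [← Complex.integral_comp_polarCoord_symm]
  have h1 : ∫ p in polarCoord.target, p.1 • indicator {z : ℂ | a < ‖z‖}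
        (fun z => w ‖z‖ * exp (I * n * (arg z : ℂ)) * planarGreen k (x' - x) (z - r'))
          (Complex.polarCoord.symm p) = ∫ p in Ioi a ×ˢ Ioo (-Real.pi) Real.pi, h p := by
    rw [setIntegral_eq_of_subset_of_forall_sdiff_eq_zero (s := Ioi a ×ˢ Ioo (-Real.pi) Real.pi)
      polarCoord.open_target.measurableSet]
    · refine setIntegral_congr_fun (measurableSet_Ioi.prod measurableSet_Ioo) fun p hp => ?_
      have hp0 : 0 < p.1 := ha.trans_lt hp.1
      have hn : ‖Complex.polarCoord.symm p‖ = p.1 := by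
        rw [Complex.norm_polarCoord_symm, abs_of_pos hp0]
      have harg : arg (Complex.polarCoord.symm p) = p.2 := by
        rw [Complex.polarCoord_symm_apply]
        exact_mod_cast Complex.arg_mul_cos_add_sin_mul_I hp0 ⟨hp.2.1, hp.2.2.le⟩
      have hmem : Complex.polarCoord.symm p ∈ {z : ℂ | a < ‖z‖} := by
        rw [mem_ofPred_eq, hn]; exact hp.1
      simp only [indicator_of_mem hmem, hn, harg, hh]
      rw [Complex.polarCoord_symm_apply, planarGreen_polar k hx, Complex.real_smul]
      ring
    · rintro p ⟨hp1, hp2⟩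
      exact ⟨ha.trans_lt hp1, hp2⟩
    · rintro p ⟨⟨hp1, hp2⟩, hp3⟩
      rw [indicator_of_notMem, smul_zero]
      intro hmem
      rw [mem_ofPred_eq, Complex.norm_polarCoord_symm, abs_of_pos hp1] at hmem
      exact hp3 ⟨hmem, hp2⟩
  have hint : IntegrableOn h (Ioi a ×ˢ Ioo (-Real.pi) Real.pi) := by
    set b := k.im / 2 / (x' - x) with hb
    have hb0 : 0 < b := by positivity
    set E := C * (‖k‖ / (2 * Real.pi * (x' - x))) *
      Real.exp ((B + 2) ^ 2 / (4 * b) + (B + 2) * r') with hE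
    have i1 : IntegrableOn (fun p : ℝ × ℝ => E * Real.exp (-1 * p.1) * 1)
        (Ioi a ×ˢ Ioo (-Real.pi) Real.pi) := by
      rw [IntegrableOn, Measure.volume_eq_prod, ← Measure.prod_restrict]
      exact Integrable.mul_prod (f := fun r : ℝ => E * Real.exp (-1 * r)) (g := fun _ => (1 : ℝ))
        (Integrable.const_mul (exp_neg_integrableOn_Ioi a one_pos) E) (by
          exact integrableOn_const (by simp))
    refine Integrable.mono' i1 ?_ ?_
    · refine ContinuousOn.aestronglyMeasurable ?_ (measurableSet_Ioi.prod measurableSet_Ioo)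
      have c1 : Continuous fun p : ℝ × ℝ => parabolicGreen k x' r' p.2 x p.1 0 := by
        simp only [parabolicGreen, if_pos hx]
        fun_prop
      exact (Continuous.continuousOn (by fun_prop)).fun_mul ((hw.comp continuousOn_fst
        fun p hp => hp.1).fun_mul (Continuous.continuousOn (by fun_prop)))
    · rw [ae_restrict_iff' (measurableSet_Ioi.prod measurableSet_Ioo)]
      refine Filter.Eventually.of_forall fun p hp => ?_
      have hr0 : 0 ≤ p.1 := ha.trans (le_of_lt hp.1)
      have g1 := norm_parabolicGreen_le hk hx hr' hr0 p.2
      have g2 := hB p.1 hp.1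
      have g3 : p.1 ≤ Real.exp p.1 := by linarith [Real.add_one_le_exp p.1]
      have g4 : ‖exp (I * n * (p.2 : ℂ))‖ = 1 := by
        rw [show I * (n : ℂ) * (p.2 : ℂ) = ((n * p.2 : ℝ) : ℂ) * I by push_cast; ring,
          norm_exp_ofReal_mul_I]
      have g5 : Real.exp (-(k.im / 2 * ((p.1 - r') ^ 2 / (x' - x))))
          ≤ Real.exp ((B + 2) ^ 2 / (4 * b) + (B + 2) * r') * Real.exp (-((B + 2) * p.1)) := by
        rw [← Real.exp_add]
        gcongr
        have e1 : k.im / 2 * ((p.1 - r') ^ 2 / (x' - x)) = b * (p.1 - r') ^ 2 := by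
          rw [hb]; ring
        have e2 : b * (p.1 - r') ^ 2 - (B + 2) * (p.1 - r') + (B + 2) ^ 2 / (4 * b)
            = b * (p.1 - r' - (B + 2) / (2 * b)) ^ 2 := by
          field_simp
          ring
        have e3 : 0 ≤ b * (p.1 - r' - (B + 2) / (2 * b)) ^ 2 := by positivity
        rw [e1]
        linarith
      simp only [hh]
      rw [norm_mul, norm_mul, norm_mul, Complex.norm_real, Real.norm_of_nonneg hr0, g4, one_mul,
        mul_one]
      calc p.1 * (‖w p.1‖ * ‖parabolicGreen k x' r' p.2 x p.1 0‖)
          ≤ Real.exp p.1 * (C * Real.exp (B * p.1) * (‖k‖ / (2 * Real.pi * (x' - x)) *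
            (Real.exp ((B + 2) ^ 2 / (4 * b) + (B + 2) * r') *
              Real.exp (-((B + 2) * p.1))))) := by
            gcongr
            refine g1.trans ?_
            gcongr
        _ = E * (Real.exp p.1 * Real.exp (B * p.1) * Real.exp (-((B + 2) * p.1))) := by
            rw [hE]; ring
        _ = _ := by
            rw [← Real.exp_add, ← Real.exp_add]
            congr 2
            ring
  rw [h1]
  rw [Measure.volume_eq_prod] at hint ⊢
  rw [setIntegral_prod _ hint]
  refine setIntegral_congr_fun measurableSet_Ioi fun r hr => ?_
  simp only [hh]
  rw [integral_const_mul, integral_const_mul, ← integral_Ioc_eq_integral_Ioo,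
    ← intervalIntegral.integral_of_le (by linarith)]
  congr 2
  have hper : Function.Periodic (fun φ : ℝ => parabolicGreen k x' r' φ x r 0 *
      exp (-(I * n * (φ : ℂ)))) (2 * Real.pi) := fun φ => by
    simp only [parabolicGreen_eq_factor k hx, Real.cos_add_two_pi]
    congr 1
    rw [Complex.exp_eq_exp_iff_exists_int]
    exact ⟨-n, by push_cast; ring⟩
  rw [modeGreen_eq_integral k n hx]
  have := hper.intervalIntegral_add_eq 0 (-Real.pi)
  rw [zero_add, show -Real.pi + 2 * Real.pi = Real.pi by ring] at this
  -- The plane integral produces `e^{inφ}` and the Green mode `e^{-inφ}`; they agree because the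
  -- Green's function is even in the angle.
  have hneg := intervalIntegral.integral_comp_neg (a := -Real.pi) (b := Real.pi)
    fun φ : ℝ => parabolicGreen k x' r' φ x r 0 * exp (-(I * n * (φ : ℂ)))
  rw [neg_neg] at hneg
  rw [this, ← hneg]
  refine intervalIntegral.integral_congr fun φ _ => ?_
  simp only [parabolicGreen_eq_factor k hx, Real.cos_neg]
  rw [mul_comm]
  congr 2
  push_cast
  ring


/-! ### Gaussian integrals in the transversal plane -/

theorem gaussian_exponent_re {k : ℂ} (hk : 0 < k.im) {D : ℝ} (hD : 0 < D) :
    0 < (-(I * k) / (2 * (D : ℂ))).re := by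
  have : (-(I * k) / (2 * (D : ℂ))) = ((1 / (2 * D) : ℝ) : ℂ) * -(I * k) := by
    push_cast
    ring
  rw [this, re_ofReal_mul]
  simp only [neg_re, mul_re, I_re, I_im, zero_mul, one_mul, zero_sub, neg_neg]
  positivity

theorem continuous_planarGreen (k : ℂ) (D : ℝ) : Continuous (planarGreen k D) := by
  unfold planarGreen
  fun_prop

theorem exp_inner_mul_planarGreen (k : ℂ) (D : ℝ) (c w z : ℂ) :
    exp (c * (inner ℝ w z : ℝ)) * planarGreen k D z = k / (2 * Real.pi * I * (D : ℂ)) *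
      exp (-(-(I * k) / (2 * (D : ℂ))) * (‖z‖ : ℂ) ^ 2 + c * (inner ℝ w z : ℝ)) := by
  rw [planarGreen, Complex.exp_add]
  ring

/-- The Fourier–Laplace transform of a Gaussian. In real dimension two the normalizing power is `1`,
so the prefactor cancels exactly; for `c = ikθ` and `‖w‖ = 1` the result is the phase `e^{-ikθ²D/2}`
gained by the plane wave over the distance `D`. -/
theorem integral_exp_inner_mul_planarGreen {k : ℂ} (hk : 0 < k.im) {D : ℝ} (hD : 0 < D)
    (c w : ℂ) : ∫ z, exp (c * (inner ℝ w z : ℝ)) * planarGreen k D z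
      = exp (I * c ^ 2 * (‖w‖ : ℂ) ^ 2 * D / (2 * k)) := by
  have hk0 : k ≠ 0 := fun h => by simp [h] at hk
  have hD0 : (D : ℂ) ≠ 0 := by exact_mod_cast hD.ne'
  have hpi : (Real.pi : ℂ) ≠ 0 := by exact_mod_cast Real.pi_ne_zero
  simp only [exp_inner_mul_planarGreen]
  rw [integral_const_mul,
    GaussianFourier.integral_cexp_neg_mul_sq_norm_add (gaussian_exponent_re hk hD) c w,
    Complex.finrank_real_complex]
  rw [show ((2 : ℕ) : ℂ) / 2 = 1 by norm_num, Complex.cpow_one, ← mul_assoc]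
  have h1 : k / (2 * Real.pi * I * (D : ℂ)) * (Real.pi / (-(I * k) / (2 * (D : ℂ)))) = 1 := by
    field_simp
    simp [I_sq]
  have h2 : c ^ 2 * (‖w‖ : ℂ) ^ 2 / (4 * (-(I * k) / (2 * (D : ℂ))))
      = I * c ^ 2 * (‖w‖ : ℂ) ^ 2 * D / (2 * k) := by
    field_simp
    linear_combination (-4 * c ^ 2 * (‖w‖ : ℂ) ^ 2) * I_sq
  rw [h1, one_mul, h2]

theorem integral_planarGreen {k : ℂ} (hk : 0 < k.im) {D : ℝ} (hD : 0 < D) :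
    ∫ z, planarGreen k D z = 1 := by
  simpa using integral_exp_inner_mul_planarGreen hk hD 0 0

theorem integrable_exp_norm_mul_planarGreen {k : ℂ} (hk : 0 < k.im) {D : ℝ} (hD : 0 < D)
    (B : ℝ) : Integrable fun z : ℂ => Real.exp (B * ‖z‖) * ‖planarGreen k D z‖ := by
  set b := (-(I * k) / (2 * (D : ℂ))).re with hb
  have hb0 : 0 < b := gaussian_exponent_re hk hD
  have h1 : Integrable fun z : ℂ => exp (-((b / 2 : ℝ) : ℂ) * (‖z‖ : ℂ) ^ 2) := by
    have := GaussianFourier.integrable_cexp_neg_mul_sq_norm_add (V := ℂ)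
      (b := ((b / 2 : ℝ) : ℂ)) (by rw [ofReal_re]; positivity) 0 0
    simpa only [zero_mul, add_zero] using this
  set E := ‖k / (2 * Real.pi * I * (D : ℂ))‖ * Real.exp (B ^ 2 / (2 * b))
  refine Integrable.mono' (h1.norm.const_mul E) ?_ (Filter.Eventually.of_forall fun z => ?_)
  · exact (Continuous.mul (by fun_prop) (continuous_planarGreen k D).norm).aestronglyMeasurable
  · rw [Real.norm_of_nonneg (by positivity), planarGreen, norm_mul, norm_exp, norm_exp,
      ← Complex.ofReal_pow, re_mul_ofReal, re_mul_ofReal, neg_re, neg_re, ofReal_re, ← hb]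
    have : Real.exp (B * ‖z‖) * Real.exp (-b * ‖z‖ ^ 2)
        ≤ Real.exp (B ^ 2 / (2 * b)) * Real.exp (-(b / 2) * ‖z‖ ^ 2) := by
      rw [← Real.exp_add, ← Real.exp_add]
      refine Real.exp_le_exp.2 ?_
      have e : b / 2 * ‖z‖ ^ 2 - B * ‖z‖ + B ^ 2 / (2 * b) = b / 2 * (‖z‖ - B / b) ^ 2 := by
        field_simp
        ring
      have : 0 ≤ b / 2 * (‖z‖ - B / b) ^ 2 := by positivity
      linarith
    calc _ = ‖k / (2 * Real.pi * I * (D : ℂ))‖ *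
          (Real.exp (B * ‖z‖) * Real.exp (-b * ‖z‖ ^ 2)) := by ring
      _ ≤ ‖k / (2 * Real.pi * I * (D : ℂ))‖ *
          (Real.exp (B ^ 2 / (2 * b)) * Real.exp (-(b / 2) * ‖z‖ ^ 2)) := by gcongr
      _ = _ := by ring

theorem integrable_planarGreen {k : ℂ} (hk : 0 < k.im) {D : ℝ} (hD : 0 < D) :
    Integrable (planarGreen k D) := by
  have := integrable_exp_norm_mul_planarGreen hk hD 0
  simp only [zero_mul, Real.exp_zero, one_mul] at this
  exact (integrable_norm_iff (continuous_planarGreen k D).aestronglyMeasurable).1 this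

theorem ae_re_ne_zero : ∀ᵐ z : ℂ, z.re ≠ 0 := by
  have h := Measure.addHaar_submodule (volume : Measure ℂ) (LinearMap.ker Complex.reLm) (by
    intro h
    have : (1 : ℂ) ∈ LinearMap.ker Complex.reLm := by rw [h]; trivial
    simp at this)
  filter_upwards [compl_mem_ae_iff.2 h] with z hz hre
  exact hz (by simpa using hre)

/-- The Gaussian is even and has total mass one, and the dividing line is a null set. This is the
origin of the factor one half in the trace on the surface. -/
theorem integral_halfPlane_planarGreen {k : ℂ} (hk : 0 < k.im) {D : ℝ} (hD : 0 < D) :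
    ∫ z, indicator {z : ℂ | 0 < z.re} (planarGreen k D) z = 1 / 2 := by
  have hm : MeasurableSet {z : ℂ | 0 < z.re} :=
    (isOpen_lt continuous_const Complex.continuous_re).measurableSet
  have hm' : MeasurableSet {z : ℂ | z.re < 0} :=
    (isOpen_lt Complex.continuous_re continuous_const).measurableSet
  have hi := integrable_planarGreen hk hD
  have h1 : ∫ z, indicator {z : ℂ | z.re < 0} (planarGreen k D) z
      = ∫ z, indicator {z : ℂ | 0 < z.re} (planarGreen k D) z := by
    rw [← integral_neg_eq_self]
    refine integral_congr_ae (Filter.Eventually.of_forall fun z => ?_)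
    by_cases h : 0 < z.re
    · simp [indicator, h, planarGreen]
    · simp [indicator, h]
  have h2 : (∫ z, indicator {z : ℂ | z.re < 0} (planarGreen k D) z)
      + ∫ z, indicator {z : ℂ | 0 < z.re} (planarGreen k D) z = 1 := by
    rw [← integral_add (hi.indicator hm') (hi.indicator hm), ← integral_planarGreen hk hD]
    refine integral_congr_ae ?_
    filter_upwards [ae_re_ne_zero] with z hz
    rcases lt_or_gt_of_ne hz with h | h
    · simp [indicator, h, not_lt.2 h.le]
    · simp [indicator, h, not_lt.2 h.le]
  rw [h1] at h2
  linear_combination h2 / 2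

/-! ### Propagation of the incident field -/

/-- The plane wave with the transversal direction `w`. -/
theorem incidentField_eq_inner (k : ℂ) (θ x : ℝ) (z : ℂ) (ψ : ℝ) :
    incidentField k θ x ‖z‖ (ψ + arg z)
      = exp (-(I * k * x * θ ^ 2 / 2)) *
        exp (I * k * θ * (inner ℝ (exp (-(I * ψ))) z : ℝ)) := by
  have h : inner ℝ (exp (-(I * ψ))) z = ‖z‖ * Real.cos (ψ + arg z) := by
    have h1 : z = ‖z‖ * exp (arg z * I) := (norm_mul_exp_arg_mul_I z).symm
    have h2 : (starRingEnd ℂ) (exp (-(I * ψ))) = exp (ψ * I) := by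
      rw [← exp_conj]
      congr 1
      simp [mul_comm]
    have h3 : exp (ψ * I) * z = ‖z‖ * exp (((ψ + arg z : ℝ) : ℂ) * I) := by
      conv_lhs => rw [h1]
      rw [mul_left_comm, ← Complex.exp_add]
      push_cast
      ring_nf
    rw [Complex.inner, mul_comm, h2, h3, re_ofReal_mul, exp_ofReal_mul_I_re]
  rw [h, incidentField, ← Complex.exp_add]
  congr 1
  push_cast
  ring

/-- The shift `φ = ψ + arg z` exhibits the `n`-th mode, as a function on the plane, as a
superposition of rotated plane waves, each of which propagates explicitly. -/
theorem angularMode_incidentField_rotate (k : ℂ) (θ : ℝ) (n : ℤ) (x : ℝ) (z : ℂ) :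
    angularMode n (uncurriedField (incidentField k θ)) x ‖z‖ * exp (I * n * (arg z : ℂ))
      = 1 / (2 * Real.pi) * ∫ ψ in (0 : ℝ)..(2 * Real.pi),
        incidentField k θ x ‖z‖ (ψ + arg z) * exp (-(I * n * (ψ : ℂ))) := by
  set h : ℝ → ℂ := fun φ => incidentField k θ x ‖z‖ φ * exp (-(I * n * (φ : ℂ))) with hh
  have hper : Function.Periodic h (2 * Real.pi) := fun φ => by
    simp only [hh, incidentField, Real.cos_add_two_pi]
    congr 1
    rw [Complex.exp_eq_exp_iff_exists_int]
    exact ⟨-n, by push_cast; ring⟩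
  have h1 := hper.intervalIntegral_add_eq 0 (arg z)
  have h2 : ∀ ψ : ℝ, incidentField k θ x ‖z‖ (ψ + arg z) * exp (-(I * n * (ψ : ℂ)))
      = exp (I * n * (arg z : ℂ)) * h (ψ + arg z) := fun ψ => by
    simp only [hh]
    rw [mul_left_comm, ← Complex.exp_add]
    congr 2
    push_cast
    ring
  simp only [h2]
  rw [intervalIntegral.integral_const_mul, intervalIntegral.integral_comp_add_right h, zero_add,
    add_comm (2 * Real.pi), ← h1, zero_add, angularMode]
  simp only [hh, uncurriedField]
  ring

theorem continuous_angularMode_incidentField (k : ℂ) (θ : ℝ) (n : ℤ) (x : ℝ) :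
    Continuous (angularMode n (uncurriedField (incidentField k θ)) x) := by
  unfold angularMode uncurriedField incidentField
  refine continuous_const.mul ?_
  exact intervalIntegral.continuous_parametric_intervalIntegral_of_continuous' (by fun_prop) _ _

theorem norm_angularMode_incidentField_le (k : ℂ) (θ : ℝ) (n : ℤ) (x : ℝ) {r : ℝ} (hr : 0 ≤ r) :
    ‖angularMode n (uncurriedField (incidentField k θ)) x r‖
      ≤ Real.exp (|k.im| * (|x| * θ ^ 2 / 2)) * Real.exp (|k.im| * |θ| * r) := by
  have hpi := Real.pi_pos
  rw [angularMode, norm_mul]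
  have h1 := intervalIntegral.norm_integral_le_of_norm_le_const (a := 0) (b := 2 * Real.pi)
    (f := fun φ : ℝ => uncurriedField (incidentField k θ) (x, r, φ) * exp (-(I * n * (φ : ℂ))))
    (C := Real.exp (|k.im| * (|x| * θ ^ 2 / 2)) * Real.exp (|k.im| * |θ| * r)) fun φ _ => by
      rw [norm_mul, norm_exp_angular, mul_one, uncurriedField, IsTotalField.norm_incidentField,
        ← Real.exp_add]
      gcongr
      have e1 : |θ * r * Real.cos φ - x * θ ^ 2 / 2| ≤ |θ| * r + |x| * θ ^ 2 / 2 := by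
        refine (abs_sub _ _).trans (add_le_add ?_ ?_)
        · rw [abs_mul, abs_mul, abs_of_nonneg hr]
          exact mul_le_of_le_one_right (by positivity) (Real.abs_cos_le_one φ)
        · rw [abs_div, abs_mul, abs_of_nonneg (sq_nonneg θ), abs_two]
      calc -(k.im * (θ * r * Real.cos φ - x * θ ^ 2 / 2))
          ≤ |k.im * (θ * r * Real.cos φ - x * θ ^ 2 / 2)| := neg_le_abs _
        _ ≤ |k.im| * (|θ| * r + |x| * θ ^ 2 / 2) := by rw [abs_mul]; gcongr
        _ = _ := by ring
  have h2 : ‖(1 / (2 * Real.pi) : ℂ)‖ = 1 / (2 * Real.pi) := by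
    simp [abs_of_pos hpi]
  rw [sub_zero, abs_of_pos (by positivity : (0 : ℝ) < 2 * Real.pi)] at h1
  rw [h2]
  calc _ ≤ 1 / (2 * Real.pi) * _ := mul_le_mul_of_nonneg_left h1 (by positivity)
    _ = _ := by
      rw [mul_comm _ (2 * Real.pi), ← mul_assoc, one_div, inv_mul_cancel₀ (by positivity), one_mul]

/-- The modes of the incident field are propagated by the modes of the Green's function. -/
theorem integral_incidentField_modeGreen {k : ℂ} (hk : 0 < k.im) (θ : ℝ) (n : ℤ) {x x' r' : ℝ}
    (hx : x < x') (hr' : 0 ≤ r') :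
    ∫ r in Ioi (0 : ℝ), (r : ℂ) * (angularMode n (uncurriedField (incidentField k θ)) x r
        * modeGreen k n x' r' x r)
      = angularMode n (uncurriedField (incidentField k θ)) x' r' := by
  have hD := sub_pos.2 hx
  have hk0 : k ≠ 0 := fun h => by simp [h] at hk
  have hpi := Real.pi_pos
  rw [integral_Ioi_modeGreen hk n hx hr' le_rfl
    (continuous_angularMode_incidentField k θ n x).continuousOn (Real.exp_nonneg _)
    fun r hr => norm_angularMode_incidentField_le k θ n x (le_of_lt hr)]
  set Φ : ℂ → ℝ → ℂ := fun z ψ => exp (-(I * k * x * θ ^ 2 / 2)) *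
        exp (I * k * θ * (inner ℝ (exp (-(I * ψ))) z : ℝ)) * exp (-(I * n * (ψ : ℂ)))
        * planarGreen k (x' - x) (z - r') with hΦ
  have h1 : ∫ z : ℂ, indicator {z : ℂ | 0 < ‖z‖} (fun z =>
      angularMode n (uncurriedField (incidentField k θ)) x ‖z‖ * exp (I * n * (arg z : ℂ))
        * planarGreen k (x' - x) (z - r')) z
      = ∫ z : ℂ, 1 / (2 * Real.pi) * ∫ ψ in Ioc 0 (2 * Real.pi), Φ z ψ := by
    refine integral_congr_ae ?_
    filter_upwards [compl_mem_ae_iff.2 (measure_singleton (0 : ℂ))] with z hz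
    have hz' : z ∈ {z : ℂ | 0 < ‖z‖} := norm_pos_iff.2 hz
    rw [indicator_of_mem hz', angularMode_incidentField_rotate, mul_assoc,
      ← intervalIntegral.integral_mul_const, intervalIntegral.integral_of_le (by positivity)]
    simp only [incidentField_eq_inner, hΦ]
  have hcont : Continuous fun p : ℂ × ℝ => Φ p.1 p.2 := by
    have := continuous_planarGreen k (x' - x)
    simp only [hΦ]
    fun_prop
  set B := ‖k‖ * |θ| with hB
  have hint : Integrable (Function.uncurry Φ)
      ((volume : Measure ℂ).prod (volume.restrict (Ioc 0 (2 * Real.pi)))) := by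
    have i0 := (integrable_exp_norm_mul_planarGreen hk hD B).comp_sub_right (r' : ℂ)
    have i1 := Integrable.mul_prod (f := fun z : ℂ => ‖exp (-(I * k * x * θ ^ 2 / 2))‖ *
      Real.exp (B * r') * (Real.exp (B * ‖z - r'‖) * ‖planarGreen k (x' - x) (z - r')‖))
      (g := fun _ => (1 : ℝ)) (i0.const_mul _)
      (μ := volume) (ν := volume.restrict (Ioc (0 : ℝ) (2 * Real.pi)))
      (integrable_const _)
    refine Integrable.mono' i1 hcont.aestronglyMeasurable
      (Filter.Eventually.of_forall fun p => ?_)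
    simp only [Function.uncurry, hΦ]
    rw [norm_mul, norm_mul, norm_mul, norm_exp_angular, mul_one, mul_one]
    have e1 : ‖exp (I * k * θ * (inner ℝ (exp (-(I * p.2))) p.1 : ℝ))‖
        ≤ Real.exp (B * r') * Real.exp (B * ‖p.1 - r'‖) := by
      refine (norm_exp_le_exp_norm _).trans ?_
      rw [← Real.exp_add]
      gcongr
      rw [norm_mul, norm_mul, norm_mul, norm_I, one_mul, Complex.norm_real, Complex.norm_real,
        Real.norm_eq_abs, ← hB, ← mul_add]
      gcongr
      refine (norm_inner_le_norm _ _).trans ?_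
      have e2 : ‖exp (-(I * p.2))‖ = 1 := by simpa using norm_exp_angular 1 p.2
      rw [e2, one_mul]
      calc ‖p.1‖ = ‖(r' : ℂ) + (p.1 - r')‖ := by ring_nf
        _ ≤ ‖(r' : ℂ)‖ + ‖p.1 - r'‖ := norm_add_le _ _
        _ = _ := by rw [Complex.norm_real, Real.norm_of_nonneg hr']
    calc _ ≤ ‖exp (-(I * k * x * θ ^ 2 / 2))‖ * (Real.exp (B * r') * Real.exp (B * ‖p.1 - r'‖))
          * ‖planarGreen k (x' - x) (p.1 - r')‖ := by gcongr
      _ = _ := by ring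
  -- After the exchange, each plane wave is propagated separately, with the Green's function
  -- translated to the observation point `r'`.
  rw [h1, integral_const_mul, integral_integral_swap hint, angularMode,
    intervalIntegral.integral_of_le (by positivity)]
  congr 1
  refine setIntegral_congr_fun measurableSet_Ioc fun ψ _ => ?_
  set Ψ : ℂ → ℂ := fun ζ : ℂ => exp (-(I * k * x * θ ^ 2 / 2)) *
        exp (I * k * θ * (r' * Real.cos ψ : ℝ)) * exp (-(I * n * (ψ : ℂ))) *
        (exp (I * k * θ * (inner ℝ (exp (-(I * ψ))) ζ : ℝ)) * planarGreen k (x' - x) ζ) with hΨ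
  have h2 : ∀ z : ℂ, Φ z ψ = Ψ (z - r') := fun z => by
    have h3 : inner ℝ (exp (-(I * ψ))) (r' : ℂ) = r' * Real.cos ψ := by
      rw [Complex.inner, re_ofReal_mul, ← exp_conj]
      have : (starRingEnd ℂ) (-(I * ψ)) = ψ * I := by simp [mul_comm]
      rw [this, exp_ofReal_mul_I_re]
    have h4 : inner ℝ (exp (-(I * ψ))) z = r' * Real.cos ψ + inner ℝ (exp (-(I * ψ))) (z - r') := by
      rw [← h3, ← inner_add_right, add_sub_cancel]
    simp only [hΦ, hΨ]
    rw [h4, Complex.ofReal_add, mul_add, Complex.exp_add]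
    ring
  simp only [h2]
  rw [integral_sub_right_eq_self Ψ, hΨ, integral_const_mul, integral_exp_inner_mul_planarGreen hk hD]
  have e2 : ‖exp (-(I * (ψ : ℂ)))‖ = 1 := by simpa using norm_exp_angular 1 ψ
  rw [e2, uncurriedField, incidentField, mul_right_comm, ← Complex.exp_add, ← Complex.exp_add]
  congr 2
  push_cast
  field_simp
  linear_combination (θ ^ 2 * (x' - x) : ℂ) * I_sq


/-! ### The trace of the volume potential on the surface -/

/-- Parabolic scaling: a distance `s²` along the axis corresponds to the length `s` across it, and
the factor `s^{-2}` is compensated by the Jacobian in the plane. -/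
theorem planarGreen_smul (k : ℂ) {s : ℝ} (hs : 0 < s) (z : ℂ) :
    planarGreen k (s ^ 2) (s • z) = ((s ^ 2 : ℝ) : ℂ)⁻¹ * planarGreen k 1 z := by
  have hs0 : (s : ℂ) ≠ 0 := by exact_mod_cast hs.ne'
  rw [planarGreen, planarGreen, norm_smul, Real.norm_of_nonneg hs.le]
  have e : -(-(I * k) / (2 * ((s ^ 2 : ℝ) : ℂ))) * ((s * ‖z‖ : ℝ) : ℂ) ^ 2
      = -(-(I * k) / (2 * ((1 : ℝ) : ℂ))) * (‖z‖ : ℂ) ^ 2 := by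
    push_cast
    field_simp
  rw [e]
  push_cast
  field_simp

/-- Substitution of the parabolic scaling `z = a + s η` in an integral with the Green's function. -/
theorem integral_mul_planarGreen_scale (k : ℂ) {s : ℝ} (hs : 0 < s) (a : ℂ) (F : ℂ → ℂ) :
    ∫ z, F z * planarGreen k (s ^ 2) (z - a) = ∫ η, F (a + s • η) * planarGreen k 1 η := by
  have h1 := integral_sub_right_eq_self (μ := volume)
    (fun z => F (a + z) * planarGreen k (s ^ 2) z) a
  simp only [add_sub_cancel] at h1
  have h2 := Measure.integral_comp_smul (volume : Measure ℂ)
    (fun z => F (a + z) * planarGreen k (s ^ 2) z) s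
  rw [Complex.finrank_real_complex, abs_of_pos (by positivity)] at h2
  simp only [planarGreen_smul k hs] at h2
  have h3 : ∀ η : ℂ, F (a + s • η) * (((s ^ 2 : ℝ) : ℂ)⁻¹ * planarGreen k 1 η)
      = ((s ^ 2 : ℝ) : ℂ)⁻¹ * (F (a + s • η) * planarGreen k 1 η) := fun η => by ring
  have hs0 : ((s ^ 2 : ℝ) : ℂ)⁻¹ ≠ 0 :=
    inv_ne_zero (by exact_mod_cast (by positivity : s ^ 2 ≠ 0))
  simp only [h3] at h2
  rw [integral_const_mul, Complex.real_smul, Complex.ofReal_inv] at h2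
  rw [h1, mul_left_cancel₀ hs0 h2]

namespace IsFieldMode

variable {k : ℂ} {n : ℤ} {X₁ : ℝ} {X₂ : EReal} {f : ℝ → ℝ} {v₀ : ℝ → ℂ} {v vr : ℝ → ℝ → ℂ}

theorem tendsto_sqrt_sub_left (x' : ℝ) :
    Filter.Tendsto (fun c : ℝ => √(x' - c)) (nhdsWithin x' (Iio x')) (nhds 0) := by
  have : ContinuousAt (fun c : ℝ => √(x' - c)) x' := by fun_prop
  have h := this.tendsto
  rw [sub_self, Real.sqrt_zero] at h
  exact h.mono_left nhdsWithin_le_nhds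

/-- The position of the surface in the parabolic scaling. -/
theorem tendsto_scaled_position (hf : IsBodyProfile X₁ X₂ f) {x' : ℝ} (h1 : X₁ < x')
    (h2 : (x' : EReal) < X₂) (η : ℂ) :
    Filter.Tendsto (fun c : ℝ => (‖(f x' : ℂ) + √(x' - c) • η‖ ^ 2 - f c ^ 2) / √(x' - c))
      (nhdsWithin x' (Iio x')) (nhds (2 * f x' * η.re)) := by
  have hs := tendsto_sqrt_sub_left x'
  -- As `f²` is differentiable, the surface moves by `O(s²)` with `s = √(x' - c)`, while the point
  -- moves by `s η`; in the limit only `Re η` decides on which side of the surface it lies.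
  have hd : HasDerivAt (fun c => f c ^ 2) (2 * f x' ^ 1 * deriv f x') x' :=
    ((hf.differentiableAt h1 h2).hasDerivAt.pow 2)
  have hslope := (hasDerivAt_iff_tendsto_slope.1 hd).mono_left
    (nhdsWithin_mono x' (fun c hc => ne_of_lt hc : Iio x' ⊆ {x'}ᶜ))
  have hlim := (hs.mul_const (‖η‖ ^ 2)).add (hs.mul hslope)
  have hlim2 := hlim.const_add (2 * f x' * η.re)
  simp only [zero_mul, add_zero] at hlim2
  refine hlim2.congr' ?_
  filter_upwards [self_mem_nhdsWithin] with c hc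
  have hc' : 0 < x' - c := sub_pos.2 hc
  set s := √(x' - c) with hsdef
  have hs0 : 0 < s := Real.sqrt_pos.2 hc'
  have hss : s * s = x' - c := Real.mul_self_sqrt hc'.le
  have hn : ‖(f x' : ℂ) + s • η‖ ^ 2 = f x' ^ 2 + 2 * f x' * s * η.re + s * s * ‖η‖ ^ 2 := by
    rw [← normSq_eq_norm_sq, ← normSq_eq_norm_sq, normSq_apply, normSq_apply]
    simp
    ring
  rw [hn, slope_def_field, eq_div_iff hs0.ne']
  have h3 : (f c ^ 2 - f x' ^ 2) / (c - x') * (s * s) = f x' ^ 2 - f c ^ 2 := by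
    rw [hss]
    have : c - x' ≠ 0 := by linarith
    field_simp
    ring
  linear_combination h3

/-- The rescaled integrand of the volume potential. -/
def scaledIntegrand (k : ℂ) (n : ℤ) (f : ℝ → ℝ) (v : ℝ → ℝ → ℂ) (x' c : ℝ) (η : ℂ) : ℂ :=
  indicator {z : ℂ | f c < ‖z‖} (fun z => v c ‖z‖ * exp (I * n * (arg z : ℂ)))
    ((f x' : ℂ) + √(x' - c) • η) * planarGreen k 1 η

/-- If `Re η < 0` the scaled point is eventually inside the body and the integrand vanishes. If `Re
η > 0` it is eventually outside, and continuity of the mode up to the surface gives the limit. The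
line `Re η = 0` is a null set. -/
theorem tendsto_scaledIntegrand (hf : IsBodyProfile X₁ X₂ f)
    (hv : IsFieldMode k n X₁ X₂ f v₀ v vr) {x' : ℝ} (h1 : X₁ < x') (h2 : (x' : EReal) < X₂)
    {η : ℂ} (hη : η.re ≠ 0) :
    Filter.Tendsto (fun c => scaledIntegrand k n f v x' c η) (nhdsWithin x' (Iio x'))
      (nhds (v x' (f x') * indicator {z : ℂ | 0 < z.re} (planarGreen k 1) η)) := by
  have hf0 := hf.pos x' h1 h2
  have hpos := tendsto_scaled_position hf h1 h2 η
  have hmem : ∀ᶠ c in nhdsWithin x' (Iio x'), X₁ < c ∧ (c : EReal) < X₂ :=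
    nhdsWithin_le_nhds ((IsBodyProfile.isOpen_domain X₁ X₂).mem_nhds ⟨h1, h2⟩)
  rcases lt_or_gt_of_ne hη with hη | hη
  · rw [indicator_of_notMem (by exact not_lt.2 hη.le), mul_zero]
    refine tendsto_const_nhds.congr' ?_
    filter_upwards [hpos.eventually_lt_const (by nlinarith : 2 * f x' * η.re < 0),
      self_mem_nhdsWithin, hmem] with c hc hcx hcm
    have hs0 : 0 < √(x' - c) := Real.sqrt_pos.2 (sub_pos.2 hcx)
    rw [scaledIntegrand, indicator_of_notMem, zero_mul]
    intro h
    rw [mem_ofPred_eq] at h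
    have : f c ^ 2 < ‖(f x' : ℂ) + √(x' - c) • η‖ ^ 2 :=
      pow_lt_pow_left₀ h (hf.pos c hcm.1 hcm.2).le two_ne_zero
    have := div_pos (sub_pos.2 this) hs0
    linarith
  · rw [indicator_of_mem (by exact hη)]
    have hs := tendsto_sqrt_sub_left x'
    have hz : Filter.Tendsto (fun c : ℝ => (f x' : ℂ) + √(x' - c) • η) (nhdsWithin x' (Iio x'))
        (nhds (f x' : ℂ)) := by
      have := (hs.smul_const η).const_add (f x' : ℂ)
      simpa only [zero_smul, add_zero] using this
    have hev : ∀ᶠ c in nhdsWithin x' (Iio x'), f c < ‖(f x' : ℂ) + √(x' - c) • η‖ := by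
      filter_upwards [hpos.eventually_const_lt (by positivity : 0 < 2 * f x' * η.re),
        self_mem_nhdsWithin] with c hc hcx
      have hs0 : 0 < √(x' - c) := Real.sqrt_pos.2 (sub_pos.2 hcx)
      have h3 := (div_pos_iff_of_pos_right hs0).1 hc
      exact lt_of_pow_lt_pow_left₀ 2 (norm_nonneg _) (by linarith)
    have hzn : Filter.Tendsto (fun c : ℝ => ‖(f x' : ℂ) + √(x' - c) • η‖)
        (nhdsWithin x' (Iio x')) (nhds (f x')) := by
      have := hz.norm
      rwa [Complex.norm_real, Real.norm_of_nonneg hf0.le] at this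
    have hid : Filter.Tendsto (fun c : ℝ => c) (nhdsWithin x' (Iio x')) (nhds x') :=
      nhdsWithin_le_nhds
    have t1 : Filter.Tendsto (fun c => v c ‖(f x' : ℂ) + √(x' - c) • η‖)
        (nhdsWithin x' (Iio x')) (nhds (v x' (f x'))) := by
      have hc := hv.continuousOn (x', f x') (rear_slice hf h1 h2 le_rfl)
      refine hc.tendsto.comp (tendsto_nhdsWithin_iff.2 ⟨hid.prodMk_nhds hzn, ?_⟩)
      filter_upwards [hev, hmem] with c hc1 hc2
      exact rear_slice hf hc2.1 hc2.2 hc1.le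
    have t2 : Filter.Tendsto (fun c : ℝ => exp (I * n *
        (arg ((f x' : ℂ) + √(x' - c) • η) : ℂ))) (nhdsWithin x' (Iio x')) (nhds 1) := by
      have ha := (continuousAt_arg (x := (f x' : ℂ)) (Or.inl (by simpa using hf0))).tendsto.comp hz
      rw [arg_ofReal_of_nonneg hf0.le] at ha
      have he : Continuous fun t : ℝ => exp (I * n * (t : ℂ)) := by fun_prop
      have := (he.tendsto 0).comp ha
      simpa only [Function.comp_def, Complex.ofReal_zero, mul_zero, Complex.exp_zero] using this
    have t3 := (t1.mul t2).mul_const (planarGreen k 1 η)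
    rw [mul_one] at t3
    refine t3.congr' ?_
    filter_upwards [hev] with c hc
    rw [scaledIntegrand, indicator_of_mem (by exact hc)]

/-- The volume potential of a mode takes half of the value of the mode on the surface. -/
theorem tendsto_volumePotential (hf : IsBodyProfile X₁ X₂ f)
    (hv : IsFieldMode k n X₁ X₂ f v₀ v vr) (hk : 0 < k.im) {x' : ℝ} (h1 : X₁ < x')
    (h2 : (x' : EReal) < X₂) :
    Filter.Tendsto (fun c => ∫ r in Ioi (f c), (r : ℂ) * (v c r * modeGreen k n x' (f x') c r))
      (nhdsWithin x' (Iio x')) (nhds (1 / 2 * v x' (f x'))) := by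
  have hf0 := hf.pos x' h1 h2
  -- The first entry keeps `c` away from the tip, which gives a uniform growth bound; the second
  -- makes `√(x' - c) ≤ 1`, so the dominating function does not depend on `c`.
  set a := max ((X₁ + x') / 2) (x' - 1) with ha
  have hXa : X₁ < a := lt_max_of_lt_left (by linarith)
  have hax : a < x' := max_lt (by linarith) (by linarith)
  obtain ⟨C, B, hC, hB, hgr⟩ := hv.exists_growth_bound hf hXa h2
  have hev : ∀ᶠ c in nhdsWithin x' (Iio x'), c ∈ Ioo a x' := Ioo_mem_nhdsLT hax
  have hmem : ∀ c ∈ Ioo a x', X₁ < c ∧ (c : EReal) < X₂ := fun c hc =>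
    ⟨hXa.trans hc.1, (EReal.coe_lt_coe_iff.2 hc.2).trans h2⟩
  have hscale : ∀ c ∈ Ioo a x',
      ∫ r in Ioi (f c), (r : ℂ) * (v c r * modeGreen k n x' (f x') c r)
        = ∫ η, scaledIntegrand k n f v x' c η := fun c hc => by
    obtain ⟨hc1, hc2⟩ := hmem c hc
    rw [integral_Ioi_modeGreen hk n hc.2 hf0.le (hf.pos c hc1 hc2).le
      ((hv.continuousOn_slice hf hc1 hc2).mono Ioi_subset_Ici_self) hC
      fun r hr => hgr c r hc.1.le hc.2.le (le_of_lt hr)]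
    have hD : 0 < x' - c := sub_pos.2 hc.2
    have := integral_mul_planarGreen_scale k (Real.sqrt_pos.2 hD) (f x' : ℂ)
      (indicator {z : ℂ | f c < ‖z‖} (fun z => v c ‖z‖ * exp (I * n * (arg z : ℂ))))
    rw [Real.sq_sqrt hD.le] at this
    simp only [scaledIntegrand]
    rw [← this]
    refine integral_congr_ae (Filter.Eventually.of_forall fun z => ?_)
    simp only [indicator]
    split_ifs <;> simp
  have hlim : ∫ η, v x' (f x') * indicator {z : ℂ | 0 < z.re} (planarGreen k 1) η
      = 1 / 2 * v x' (f x') := by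
    rw [integral_const_mul, integral_halfPlane_planarGreen hk one_pos, mul_comm]
  rw [← hlim]
  have hdct := tendsto_integral_filter_of_dominated_convergence
    (μ := (volume : Measure ℂ)) (l := nhdsWithin x' (Iio x'))
    (F := fun c η => scaledIntegrand k n f v x' c η)
    (f := fun η => v x' (f x') * indicator {z : ℂ | 0 < z.re} (planarGreen k 1) η)
    (fun η => C * Real.exp (B * f x') * (Real.exp (B * ‖η‖) * ‖planarGreen k 1 η‖)) ?_ ?_
    ((integrable_exp_norm_mul_planarGreen hk one_pos B).const_mul _) ?_
  · refine hdct.congr' ?_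
    filter_upwards [hev] with c hc using (hscale c hc).symm
  · filter_upwards [hev] with c hc
    obtain ⟨hc1, hc2⟩ := hmem c hc
    set g : ℂ → ℂ := fun η => (f x' : ℂ) + √(x' - c) • η with hg
    have cg : Continuous g := by fun_prop
    have hO : IsOpen {η : ℂ | f c < ‖g η‖} := isOpen_lt continuous_const cg.norm
    have e1 : (fun η => scaledIntegrand k n f v x' c η) = fun η => indicator {η : ℂ | f c < ‖g η‖}
        (fun η => v c ‖g η‖ * exp (I * n * (arg (g η) : ℂ))) η * planarGreen k 1 η := by
      funext η
      simp only [scaledIntegrand, indicator, mem_ofPred_eq, hg]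
    rw [e1]
    refine AEStronglyMeasurable.mul ?_ (continuous_planarGreen k 1).aestronglyMeasurable
    rw [aestronglyMeasurable_indicator_iff hO.measurableSet]
    refine AEStronglyMeasurable.mul ?_ ?_
    · have : ContinuousOn (fun η => v c ‖g η‖) {η : ℂ | f c < ‖g η‖} :=
        (hv.continuousOn_slice hf hc1 hc2).comp cg.norm.continuousOn
          fun η hη => mem_Ici.2 (le_of_lt hη)
      exact this.aestronglyMeasurable hO.measurableSet
    · have : Measurable fun η => exp (I * n * (arg (g η) : ℂ)) :=
        Complex.measurable_exp.comp (measurable_const.mul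
          (Complex.measurable_ofReal.comp (Complex.measurable_arg.comp cg.measurable)))
      exact this.aestronglyMeasurable
  · filter_upwards [hev] with c hc
    refine Filter.Eventually.of_forall fun η => ?_
    rw [scaledIntegrand, norm_mul, ← mul_assoc]
    refine mul_le_mul_of_nonneg_right ?_ (norm_nonneg _)
    by_cases hz : (f x' : ℂ) + √(x' - c) • η ∈ {z : ℂ | f c < ‖z‖}
    · rw [indicator_of_mem hz, norm_mul]
      have e1 : ‖exp (I * n * (arg ((f x' : ℂ) + √(x' - c) • η) : ℂ))‖ = 1 := by
        rw [mul_assoc, mul_comm I, ← Complex.ofReal_intCast, ← Complex.ofReal_mul,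
          norm_exp_ofReal_mul_I]
      rw [e1, mul_one]
      refine (hgr c _ hc.1.le hc.2.le (le_of_lt hz)).trans ?_
      rw [mul_assoc, ← Real.exp_add]
      gcongr
      rw [← mul_add]
      gcongr
      refine (norm_add_le _ _).trans ?_
      rw [Complex.norm_real, Real.norm_of_nonneg hf0.le, norm_smul,
        Real.norm_of_nonneg (Real.sqrt_nonneg _)]
      gcongr
      refine mul_le_of_le_one_left (norm_nonneg _) (Real.sqrt_le_one.2 ?_)
      have := hc.1
      have := le_max_right ((X₁ + x') / 2) (x' - 1)
      linarith
    · rw [indicator_of_notMem hz, norm_zero]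
      positivity
  · filter_upwards [ae_re_ne_zero] with η hη
    exact hv.tendsto_scaledIntegrand hf h1 h2 hη

end IsFieldMode


/-! ### Integrability of the boundary term and the Volterra equation -/

/-- The mean value theorem, applied to `f` and then to `f'`, produces `f''` at an intermediate
point, which is bounded on the compact interval. -/
theorem IsBodyProfile.exists_taylor_bound {X₁ : ℝ} {X₂ : EReal} {f : ℝ → ℝ}
    (hf : IsBodyProfile X₁ X₂ f) {a b : ℝ} (ha : X₁ < a) (hb : (b : EReal) < X₂) :
    ∃ L : ℝ, ∀ x ∈ Ico a b, |f x - f b + (b - x) * deriv f x| ≤ L * (b - x) ^ 2 := by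
  have hO := isOpen_domain X₁ X₂
  have hsub : Icc a b ⊆ {x : ℝ | X₁ < x ∧ (x : EReal) < X₂} := fun x hx =>
    ⟨ha.trans_le hx.1, (EReal.coe_le_coe_iff.2 hx.2).trans_lt hb⟩
  have h1 : ContDiffOn ℝ 1 (deriv f) {x : ℝ | X₁ < x ∧ (x : EReal) < X₂} := fun x hx =>
    (hf.contDiffAt_deriv hx.1 hx.2).contDiffWithinAt
  have h2 := (h1.continuousOn_deriv_of_isOpen hO le_rfl).mono hsub
  obtain ⟨L, hL⟩ := isCompact_Icc.exists_bound_of_continuousOn h2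
  refine ⟨L, fun x hx => ?_⟩
  have hd : ∀ t ∈ Icc x b, t ∈ Icc a b := fun t ht => ⟨hx.1.trans ht.1, ht.2⟩
  have c1 : ContinuousOn f (Icc x b) := fun t ht =>
    (hf.contDiffAt (hsub (hd t ht)).1 (hsub (hd t ht)).2).continuousAt.continuousWithinAt
  have d1 : DifferentiableOn ℝ f (Ioo x b) := fun t ht =>
    (hf.differentiableAt (hsub (hd t (Ioo_subset_Icc_self ht))).1
      (hsub (hd t (Ioo_subset_Icc_self ht))).2).differentiableWithinAt
  obtain ⟨t, ht, hts⟩ := exists_deriv_eq_slope f hx.2 c1 d1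
  have hcd : ∀ s ∈ Icc x t, s ∈ Icc a b := fun s hs => ⟨hx.1.trans hs.1, hs.2.trans ht.2.le⟩
  have d2 : ∀ s ∈ Icc x t, DifferentiableAt ℝ (deriv f) s := fun s hs =>
    (hf.contDiffAt_deriv (hsub (hcd s hs)).1 (hsub (hcd s hs)).2).differentiableAt one_ne_zero
  obtain ⟨q, hq, hqs⟩ := exists_deriv_eq_slope (deriv f) ht.1
    (fun s hs => (d2 s hs).continuousAt.continuousWithinAt)
    fun s hs => (d2 s (Ioo_subset_Icc_self hs)).differentiableWithinAt
  have hxb : 0 < b - x := sub_pos.2 hx.2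
  have hxt : 0 < t - x := sub_pos.2 ht.1
  rw [eq_div_iff hxb.ne'] at hts
  rw [eq_div_iff hxt.ne'] at hqs
  have e : f x - f b + (b - x) * deriv f x = -(deriv (deriv f) q * (t - x) * (b - x)) := by
    linear_combination hts + (b - x) * hqs
  have hLq : |deriv (deriv f) q| ≤ L := hL q (hcd q (Ioo_subset_Icc_self hq))
  have hL0 : 0 ≤ L := (abs_nonneg _).trans hLq
  rw [e, abs_neg, abs_mul, abs_mul, abs_of_pos hxt, abs_of_pos hxb, sq, ← mul_assoc]
  gcongr
  exact ht.2.le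

theorem integrableOn_one_div_sqrt_sub (a b : ℝ) :
    IntegrableOn (fun x => 1 / √(b - x)) (Ioo a b) := by
  rcases le_or_gt b a with h | h
  · rw [Ioo_eq_empty (not_lt.2 h)]; exact integrableOn_empty
  have h1 := (intervalIntegral.intervalIntegrable_rpow' (a := b - a) (b := b - b)
    (by norm_num : (-1 : ℝ) < -(1 / 2))).comp_sub_left b
  simp only [sub_sub_cancel] at h1
  refine (((intervalIntegrable_iff_integrableOn_Ioo_of_le h.le).1 h1)).congr_fun
    (fun x hx => ?_) measurableSet_Ioo
  have : 0 ≤ b - x := (sub_pos.2 hx.2).le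
  simp only [Real.sqrt_eq_rpow, Real.rpow_neg this, one_div]

namespace IsFieldMode

variable {k : ℂ} {n : ℤ} {X₁ : ℝ} {X₂ : EReal} {f : ℝ → ℝ} {v₀ : ℝ → ℂ} {v vr : ℝ → ℝ → ℂ}

theorem boundaryTerm_eq (k : ℂ) (n : ℤ) (f : ℝ → ℝ) (v : ℝ → ℝ → ℂ) {x x' : ℝ} (h : x < x') :
    boundaryTerm k n f v x' (f x') x = modeKernel k f n x' x * v x (f x) := by
  rw [boundaryTerm, modeKernel_eq k f n h]

/-- The interval is split at its midpoint: on the front half the energy controls the surface values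
up to the tip, and on the rear half these are bounded while the kernel is weakly singular at the
diagonal. -/
theorem integrableOn_modeKernel (hf : IsBodyProfile X₁ X₂ f)
    (hv : IsFieldMode k n X₁ X₂ f v₀ v vr) (hk : 0 < k.im) {x' : ℝ} (h1 : X₁ < x')
    (h2 : (x' : EReal) < X₂) :
    IntegrableOn (fun x => modeKernel k f n x' x * v x (f x)) (Ioo X₁ x') := by
  set a := (X₁ + x') / 2 with ha
  have hXa : X₁ < a := by linarith
  have hax : a < x' := by linarith
  have hsub : ∀ x ∈ Icc a x', X₁ < x ∧ (x : EReal) < X₂ := fun x hx =>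
    ⟨hXa.trans_le hx.1, (EReal.coe_le_coe_iff.2 hx.2).trans_lt h2⟩
  rw [← Ioc_union_Ioo_eq_Ioo hXa.le hax]
  refine IntegrableOn.union ?_ ?_
  · exact (hv.integrableOn_boundaryTerm hf (f x') hax h2).congr_fun
      (fun x hx => boundaryTerm_eq k n f v (hx.2.trans_lt hax)) measurableSet_Ioc
  have cf : ContinuousOn f (Icc a x') := (hf.continuousOn_Icc h2).mono (Icc_subset_Icc_left hXa.le)
  obtain ⟨t, ht, htm⟩ := isCompact_Icc.exists_isMinOn (nonempty_Icc.2 hax.le) cf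
  obtain ⟨M, hM⟩ := isCompact_Icc.exists_bound_of_continuousOn cf
  obtain ⟨V, hV⟩ := (isCompact_Icc (a := a) (b := x')).exists_bound_of_continuousOn
    (f := fun x => v x (f x)) fun x hx =>
      (hv.continuousAt_surface hf (hsub x hx).1 (hsub x hx).2).continuousWithinAt
  obtain ⟨L, hL⟩ := hf.exists_taylor_bound hXa h2
  have hm : 0 < f t := hf.pos t (hsub t ht).1 (hsub t ht).2
  have hMb : ∀ x ∈ Icc a x', f x ≤ M := fun x hx => (le_abs_self _).trans (hM x hx)
  have hx'm : x' ∈ Icc a x' := right_mem_Icc.2 hax.le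
  have hi : IntegrableOn (fun x => (M * ‖k‖ * L + M ^ 2 * ‖k‖ / (k.im * f t ^ 2)
      * √(Real.pi / (k.im * f t ^ 2)) * (1 / √(x' - x))) * V) (Ioo a x') :=
    Integrable.mul_const (Integrable.add (integrableOn_const (by simp))
      ((integrableOn_one_div_sqrt_sub a x').const_mul _)) V
  refine Integrable.mono' hi ?_ ?_
  · refine ContinuousOn.aestronglyMeasurable (fun x hx => ?_) measurableSet_Ioo
    have hx' := hsub x (Ioo_subset_Icc_self hx)
    refine (hv.continuousAt_boundaryTerm hf (f x') hx'.1 hx'.2 hx.2).continuousWithinAt.congr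
      (fun y hy => (boundaryTerm_eq k n f v hy.2).symm) (boundaryTerm_eq k n f v hx.2).symm
  · rw [ae_restrict_iff' measurableSet_Ioo]
    refine Filter.Eventually.of_forall fun x hx => ?_
    have hx' := Ioo_subset_Icc_self hx
    rw [norm_mul]
    have b1 := norm_modeKernel_le hk f n hx.2 hm (htm hx') (htm hx'm) (hMb x hx') (hMb x' hx'm)
      (hL x ⟨hx.1.le, hx.2⟩)
    exact mul_le_mul b1 (hV x hx') (norm_nonneg _) ((norm_nonneg _).trans b1)

/-- The Volterra equation for the surface values of a mode. -/
theorem volterra {θ : ℝ} (hf : IsBodyProfile X₁ X₂ f)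
    (hv : IsFieldMode k n X₁ X₂ f (angularMode n (uncurriedField (incidentField k θ)) X₁) v vr)
    (hk : 0 < k.im) {x' : ℝ} (h1 : X₁ < x') (h2 : (x' : EReal) < X₂) :
    v x' (f x') = (∫ x in X₁..x', modeKernel k f n x' x * v x (f x))
      + 2 * angularMode n (uncurriedField (incidentField k θ)) x' (f x') := by
  have hf0 := hf.pos x' h1 h2
  have hint : IntervalIntegrable (fun x => modeKernel k f n x' x * v x (f x)) volume X₁ x' :=
    (intervalIntegrable_iff_integrableOn_Ioo_of_le h1.le).2 (hv.integrableOn_modeKernel hf hk h1 h2)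
  have hcont := intervalIntegral.continuousOn_primitive_interval' hint left_mem_uIcc x'
    right_mem_uIcc
  rw [uIcc_of_le h1.le] at hcont
  -- The observation point stays fixed while the cross-section `c` approaches it. Integrability of
  -- the kernel up to the diagonal makes the surface integral converge.
  have t1 : Filter.Tendsto (fun c => ∫ x in X₁..c, modeKernel k f n x' x * v x (f x))
      (nhdsWithin x' (Iio x')) (nhds (∫ x in X₁..x', modeKernel k f n x' x * v x (f x))) :=
    hcont.tendsto.mono_left (by
      rw [← nhdsWithin_Ioo_eq_nhdsLT h1]
      exact nhdsWithin_mono _ Ioo_subset_Icc_self)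
  have t2 := hv.tendsto_volumePotential hf hk h1 h2
  have hev : ∀ᶠ c in nhdsWithin x' (Iio x'), c ∈ Ioo X₁ x' := Ioo_mem_nhdsLT h1
  have h := tendsto_nhds_unique
    (t2.sub_const (angularMode n (uncurriedField (incidentField k θ)) x' (f x')))
    ((t1.const_mul (1 / 2)).congr' (by
      filter_upwards [hev] with c hc
      have hg := hv.green_identity_exterior hf hk
        (continuous_angularMode_incidentField k θ n X₁) hf0.le hc.1 hc.2 h2
      rw [integral_incidentField_modeGreen hk θ n h1 hf0.le] at hg
      rw [hg]
      congr 1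
      refine intervalIntegral.integral_congr fun x hx => ?_
      rw [uIcc_of_le hc.1.le] at hx
      exact (boundaryTerm_eq k n f v (hx.2.trans_lt hc.2)).symm))
  linear_combination 2 * h

end IsFieldMode

end

/-! ### The Volterra equation and the kernel formula -/

theorem mainTheorem2 (X₁ : ℝ) (X₂ : EReal) (f : ℝ → ℝ) (hf : IsBodyProfile X₁ X₂ f) :
    (∀ k : ℂ, 0 < k.im → ∀ (θ : ℝ) (u : ℝ → ℝ → ℝ → ℂ), IsTotalField k θ X₁ X₂ f u →
      ∀ (n : ℤ) (x' : ℝ), X₁ < x' → (x' : EReal) < X₂ →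
        IntegrableOn (fun x : ℝ => modeKernel k f n x' x * surfaceMode f u n x) (Ioo X₁ x') ∧
        surfaceMode f u n x' =
          (∫ x in X₁..x', modeKernel k f n x' x * surfaceMode f u n x)
            + 2 * surfaceMode f (incidentField k θ) n x') ∧
    (∀ k : ℂ, k ≠ 0 → ∀ (n : ℤ) (x x' : ℝ), X₁ < x → x < x' → (x' : EReal) < X₂ →
        modeKernel k f n x' x =
          I * k * (f x : ℂ) / ((x' - x : ℝ) : ℂ) ^ 2
            * exp (I * k / 2 * (((f x' ^ 2 + f x ^ 2) / (x' - x) : ℝ) : ℂ))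
            * ((-I) ^ n * ((f x + (x' - x) * deriv f x : ℝ) : ℂ)
                  * besselJ n (k * ((f x' * f x / (x' - x) : ℝ) : ℂ))
                + (-I) ^ (n + 1) * (f x' : ℂ)
                  * deriv (besselJ n) (k * ((f x' * f x / (x' - x) : ℝ) : ℂ)))) := by
  refine ⟨fun k hk θ u hu n x' h1 h2 => ?_, fun k hk n x x' _ hx _ => modeKernel_eq_bessel hk f n hx⟩
  have hX : (X₁ : EReal) < X₂ := (EReal.coe_lt_coe_iff.2 h1).trans h2
  have hv := hu.isFieldMode hf hX hk n
  -- `surfaceMode f u n x` is by definition `angularMode n (uncurriedField u)` at `(x, f x)`, so no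
  -- rewriting is needed.
  exact ⟨hv.integrableOn_modeKernel hf hk h1 h2, hv.volterra hf hk h1 h2⟩
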